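/- Let $(M,\bar g)$ be a compact smooth Riemannian manifold without boundary of dimension $n\ge 3$, with Riemann tensor $\bar R_{\alpha\beta\mu\lambda}$ (signed so that constant curvature $K$ means $\bar R_{\alpha\beta\mu\lambda}=K(\bar g_{\alpha\mu}\bar g_{\beta\lambda}-\bar g_{\alpha\lambda}\bar g_{\beta\mu})$) and Ricci tensor $\bar R_{\alpha\beta}$. Say that $c_1,c_2\in\mathbb R$ are Sobolev constants of $M$ if $$\Big(\int_M|u|^{\frac{2n}{n-2}}\Big)^{\frac{n-2}{n}}\le c_1\int_M|Du|^2+c_2\int_M u^2\qquad\text{for all }u\in C^\infty(M).$$ Every such $M$ has Sobolev constants. Moreover, for all $n\ge 3$, $d\ge 0$, $c_0>0$ and $c_1,c_2\in\mathbb R$ there is a constant $\kappa_0>0$, depending only on $n,d,c_0,c_1,c_2$, with the following property. Let $M$ be a compact Riemannian manifold of dimension $n$ with Sobolev constants $c_1,c_2$ such that, at every point, $$\bar R_{\alpha\beta}\Lambda^\alpha{}_\lambda\Lambda^{\beta\lambda}-\tfrac12\bar R_{\alpha\beta\mu\lambda}\Lambda^{\alpha\beta}\Lambda^{\mu\lambda}\ge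 c_0\,\Lambda_{\alpha\beta}\Lambda^{\alpha\beta}\qquad\text{for all skew-symmetric }\Lambda_{\alpha\beta}.$$ Let $G$ be a compact Lie group of dimension $d$ with semisimple Lie algebra $\mathfrak g$, and let $A$ be a smooth connection on a smooth principal $G$-bundle over $M$, with field strength $F_{\mu\lambda}=\partial_\mu A_\lambda-\partial_\lambda A_\mu+[A_\mu,A_\lambda]$, that satisfies the Yang–Mills equation $F^{\alpha}{}_{\lambda;\alpha}=0$. Then either $A$ is flat, i.e. $F\equiv 0$, or $$\Big(\int_M|F|^{\frac n2}\Big)^{\frac 2n}\ge\kappa_0,$$ where $|F|^2=\gamma_{ab}F^a_{\mu\lambda}F^{b\,\mu\lambda}$ and $\gamma(X,Y)=-\operatorname{tr}(\operatorname{ad}X\circ\operatorname{ad}Y)$. -/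

import Mathlib

open scoped Manifold ContDiff Bundle
open MeasureTheory

noncomputable section

namespace YangMills

/-! ### Riemannian geometry in charts

`M` is a smooth manifold without boundary, modelled on `EuclideanSpace ℝ (Fin n)`, and `g` a smooth
Riemannian metric on its tangent bundle. A chart is a member `e` of the smooth maximal atlas; its
coordinates are `y ∈ e.target`, and coordinate indices range over `Fin n`. -/

/-- The `i`-th partial derivative of a function of the coordinates. -/
def partialDeriv {n : ℕ} {F : Type*} [NormedAddCommGroup F] [NormedSpace ℝ F]
    (i : Fin n) (f : EuclideanSpace ℝ (Fin n) → F) (y : EuclideanSpace ℝ (Fin n)) : F :=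
  fderiv ℝ f y (EuclideanSpace.single i 1)

section Riemannian

variable {n : ℕ} {M : Type*} [TopologicalSpace M] [ChartedSpace (EuclideanSpace ℝ (Fin n)) M]

/-- The coordinate vector field `∂_i` of the chart `e`, at the point with coordinates `y`. -/
def coordVector (e : OpenPartialHomeomorph M (EuclideanSpace ℝ (Fin n)))
    (y : EuclideanSpace ℝ (Fin n)) (i : Fin n) : TangentSpace (𝓡 n) (e.symm y) :=
  mfderiv 𝓘(ℝ, EuclideanSpace ℝ (Fin n)) (𝓡 n) e.symm y
    (EuclideanSpace.single i 1 : EuclideanSpace ℝ (Fin n))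

variable [IsManifold (𝓡 n) ∞ M]

variable (n M) in
/-- Smooth Riemannian metrics on the manifold `M` of dimension `n`. -/
abbrev RMetric :=
  Bundle.ContMDiffRiemannianMetric (𝓡 n) ∞ (EuclideanSpace ℝ (Fin n))
    (fun x : M => TangentSpace (𝓡 n) x)

variable (g : RMetric n M) (e : OpenPartialHomeomorph M (EuclideanSpace ℝ (Fin n)))

/-- The metric coefficients `g_{ij} = g(∂_i, ∂_j)` in the chart `e`. -/
def metricCoeff (y : EuclideanSpace ℝ (Fin n)) : Matrix (Fin n) (Fin n) ℝ :=
  Matrix.of fun i j => g.inner (e.symm y) (coordVector e y i) (coordVector e y j)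

/-- The inverse metric `g^{ij}` in the chart `e`. -/
def invMetric (y : EuclideanSpace ℝ (Fin n)) : Matrix (Fin n) (Fin n) ℝ :=
  (metricCoeff g e y)⁻¹

/-- The Christoffel symbols `Γ^k_{ij} = ½ g^{kl} (∂_i g_{jl} + ∂_j g_{il} - ∂_l g_{ij})`
of the Levi-Civita connection. -/
def christoffel (k i j : Fin n) (y : EuclideanSpace ℝ (Fin n)) : ℝ :=
  (1 / 2) * ∑ l, invMetric g e y k l *
    (partialDeriv i (fun z => metricCoeff g e z j l) y
      + partialDeriv j (fun z => metricCoeff g e z i l) y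
      - partialDeriv l (fun z => metricCoeff g e z i j) y)

/-- The curvature tensor `R^a_{bcd}`, defined by `R(∂_c, ∂_d) ∂_b = R^a_{bcd} ∂_a`. -/
def riemannUp (a b c d : Fin n) (y : EuclideanSpace ℝ (Fin n)) : ℝ :=
  partialDeriv c (christoffel g e a d b) y - partialDeriv d (christoffel g e a c b) y
    + ∑ k, (christoffel g e a c k y * christoffel g e k d b y
      - christoffel g e a d k y * christoffel g e k c b y)

/-- The curvature tensor `R_{abcd} = g_{ak} R^k_{bcd}`; on a space of constant curvature `K` it is
`K (g_{ac} g_{bd} - g_{ad} g_{bc})`. -/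
def riemann (a b c d : Fin n) (y : EuclideanSpace ℝ (Fin n)) : ℝ :=
  ∑ k, metricCoeff g e y a k * riemannUp g e k b c d y

/-- The Ricci tensor `R_{bd} = R^a_{bad}`. -/
def ricci (b d : Fin n) (y : EuclideanSpace ℝ (Fin n)) : ℝ :=
  ∑ a, riemannUp g e a b a d y

/-- The curvature term
`R_{αβ} Λ^α_λ Λ^{βλ} - ½ R_{αβμλ} Λ^{αβ} Λ^{μλ}` of the Weitzenböck formula, for `Λ = (Λ_{αβ})`
at the point with coordinates `y`. Indices are raised by `Λ^α_λ = g^{αμ} Λ_{μλ}` and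
`Λ^{αβ} = g^{αμ} Λ_{μν} g^{νβ}`. -/
def weitzenboeck (y : EuclideanSpace ℝ (Fin n)) (Λ : Matrix (Fin n) (Fin n) ℝ) : ℝ :=
  let mixed := invMetric g e y * Λ
  let up := invMetric g e y * Λ * invMetric g e y
  (∑ α, ∑ β, ∑ l, ricci g e α β y * mixed α l * up β l)
    - (1 / 2) * ∑ α, ∑ β, ∑ μ, ∑ l, riemann g e α β μ l y * up α β * up μ l

/-- `|Λ|² = Λ_{αβ} Λ^{αβ}`. -/
def formNormSq (y : EuclideanSpace ℝ (Fin n)) (Λ : Matrix (Fin n) (Fin n) ℝ) : ℝ :=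
  ∑ α, ∑ β, Λ α β * (invMetric g e y * Λ * invMetric g e y) α β

/-- The curvature condition: at every point, in all charts, the curvature term of the Weitzenböck
formula on skew-symmetric `Λ` is at least `c₀ |Λ|²`. -/
def CurvatureCondition (c₀ : ℝ) : Prop :=
  ∀ e ∈ IsManifold.maximalAtlas (𝓡 n) ∞ M, ∀ y ∈ e.target,
    ∀ Λ : Matrix (Fin n) (Fin n) ℝ, Λ.transpose = -Λ →
      c₀ * formNormSq g e y Λ ≤ weitzenboeck g e y Λ

/-- `|Du|²(x) = g^{ij} ∂_i u ∂_j u`, computed in the preferred chart at `x`. -/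
def gradNormSq (u : M → ℝ) (x : M) : ℝ :=
  let e := chartAt (EuclideanSpace ℝ (Fin n)) x
  ∑ i, ∑ j, invMetric g e (e x) i j
    * partialDeriv i (fun y => u (e.symm y)) (e x) * partialDeriv j (fun y => u (e.symm y)) (e x)

variable [MeasurableSpace M]

/-- The measure `√(det g_{ij}) dy` of the chart `e`, transported to `M`. It lives on the domain of
the chart. -/
def chartVolume : Measure M :=
  Measure.map e.symm ((volume.restrict e.target).withDensity
    fun y => ENNReal.ofReal (Real.sqrt (metricCoeff g e y).det))

/-- The Riemannian volume measure. By the transformation formula, the measures of two charts agree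
on the intersection of their domains; so their supremum is the measure whose restriction to the
domain of each chart is `√(det g_{ij}) dy`. -/
def volumeMeasure : Measure M :=
  ⨆ e ∈ atlas (EuclideanSpace ℝ (Fin n)) M, chartVolume g e

/-- The Sobolev inequality
`(∫ |u|^{2n/(n-2)})^{(n-2)/n} ≤ c₁ ∫ |Du|² + c₂ ∫ u²` on `M`, with constants `c₁`, `c₂`.
On a compact manifold the smooth functions are dense in `H^{1,2}(M)`. -/
def SobolevInequality (c₁ c₂ : ℝ) : Prop :=
  ∀ u : M → ℝ, ContMDiff (𝓡 n) 𝓘(ℝ, ℝ) ∞ u →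
    (∫ x, |u x| ^ ((2 * n : ℝ) / (n - 2)) ∂(volumeMeasure g)) ^ (((n : ℝ) - 2) / n)
      ≤ c₁ * (∫ x, gradNormSq g u x ∂(volumeMeasure g))
        + c₂ * ∫ x, u x ^ 2 ∂(volumeMeasure g)

end Riemannian

/-! ### The structure group -/

instance : ENat.LEInfty (minSmoothness ℝ 3) :=
  ⟨by rw [minSmoothness_of_isRCLikeNormedField]; exact ENat.LEInfty.out⟩

section LieGroup

variable {d : ℕ} {G : Type*} [TopologicalSpace G] [ChartedSpace (EuclideanSpace ℝ (Fin d)) G]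
  [Group G]

/-- The adjoint representation: `Ad a` is the derivative at `1` of `h ↦ a h a⁻¹`. -/
def Ad (a : G) : GroupLieAlgebra (𝓡 d) G →L[ℝ] GroupLieAlgebra (𝓡 d) G :=
  mfderiv (𝓡 d) (𝓡 d) (fun h : G => a * h * a⁻¹) 1

/-- The left logarithmic derivative `t⁻¹ dt` of a `G`-valued function `t` at `x`, that is, the
pull-back by `t` of the Maurer-Cartan form of `G`. -/
def leftLogDeriv {n : ℕ} {M : Type*} [TopologicalSpace M] [ChartedSpace (EuclideanSpace ℝ (Fin n)) M]
    (t : M → G) (x : M) : TangentSpace (𝓡 n) x →L[ℝ] GroupLieAlgebra (𝓡 d) G :=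
  mfderiv (𝓡 n) (𝓡 d) (fun z => (t x)⁻¹ * t z) x

variable (G) in
/-- The Lie bracket of the Lie algebra `T_1 G`, on the underlying vector space. -/
def bracket (X Y : EuclideanSpace ℝ (Fin d)) : EuclideanSpace ℝ (Fin d) :=
  Bracket.bracket (L := GroupLieAlgebra (𝓡 d) G) (M := GroupLieAlgebra (𝓡 d) G) X Y

variable (G) in
/-- The Cartan-Killing metric `γ(X, Y) = -tr (ad X ∘ ad Y)`. -/
def killingMetric [LieGroup (𝓡 d) ∞ G] (X Y : EuclideanSpace ℝ (Fin d)) : ℝ :=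
  -killingForm ℝ (GroupLieAlgebra (𝓡 d) G) X Y

end LieGroup

/-! ### Principal bundles, connections, Yang-Mills equation -/

/-- A smooth principal bundle over `M` with structure group `G`, as a coordinate bundle: an open
cover of `M` with smooth transition functions `t i j` (so that local sections are related by
`s j = s i · t i j`) that satisfy the cocycle condition. -/
structure PrincipalBundle (n d : ℕ) (ι : Type*) (M : Type*) [TopologicalSpace M]
    [ChartedSpace (EuclideanSpace ℝ (Fin n)) M] (G : Type*) [TopologicalSpace G]
    [ChartedSpace (EuclideanSpace ℝ (Fin d)) G] [Group G] where
  /-- the domain of the `i`-th trivialization -/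
  baseSet : ι → Set M
  isOpen_baseSet : ∀ i, IsOpen (baseSet i)
  /-- a trivialization around each point -/
  indexAt : M → ι
  mem_baseSet_at : ∀ x, x ∈ baseSet (indexAt x)
  /-- the transition functions -/
  t : ι → ι → M → G
  contMDiffOn_t : ∀ i j, ContMDiffOn (𝓡 n) (𝓡 d) ∞ (t i j) (baseSet i ∩ baseSet j)
  t_self : ∀ i, ∀ x ∈ baseSet i, t i i x = 1
  t_mul : ∀ i j k, ∀ x ∈ baseSet i ∩ baseSet j ∩ baseSet k, t i j x * t j k x = t i k x

section Connection

variable {n d : ℕ} {ι : Type*} {M : Type*} [TopologicalSpace M]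
    [ChartedSpace (EuclideanSpace ℝ (Fin n)) M] {G : Type*} [TopologicalSpace G]
    [ChartedSpace (EuclideanSpace ℝ (Fin d)) G] [Group G]

/-- The components `A_μ = A(∂_μ)` of a Lie algebra valued 1-form in the chart `e`. -/
def formCoeff (A : (x : M) → TangentSpace (𝓡 n) x →L[ℝ] GroupLieAlgebra (𝓡 d) G)
    (e : OpenPartialHomeomorph M (EuclideanSpace ℝ (Fin n))) (μ : Fin n)
    (y : EuclideanSpace ℝ (Fin n)) : EuclideanSpace ℝ (Fin d) :=
  A (e.symm y) (coordVector e y μ)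

/-- A smooth connection on the principal bundle `P`, given by its local connection forms: smooth
Lie algebra valued 1-forms `A i` on `P.baseSet i` with
`A j = Ad (t⁻¹) (A i) + t⁻¹ dt`, `t = P.t i j`, on overlaps. (The values of `form i` outside
`P.baseSet i` are irrelevant.) -/
structure Connection (P : PrincipalBundle n d ι M G) where
  /-- the local connection forms -/
  form : ι → (x : M) → TangentSpace (𝓡 n) x →L[ℝ] GroupLieAlgebra (𝓡 d) G
  contDiffOn_form : ∀ i, ∀ e ∈ IsManifold.maximalAtlas (𝓡 n) ∞ M, ∀ μ : Fin n,
    ContDiffOn ℝ ∞ (formCoeff (form i) e μ) (e.target ∩ e.symm ⁻¹' P.baseSet i)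
  form_transform : ∀ i j, ∀ x ∈ P.baseSet i ∩ P.baseSet j, ∀ v : TangentSpace (𝓡 n) x,
    form j x v = Ad (P.t i j x)⁻¹ (form i x v) + leftLogDeriv (P.t i j) x v

namespace Connection

variable {P : PrincipalBundle n d ι M G} (A : Connection P)

/-- The components `F_{μλ} = ∂_μ A_λ - ∂_λ A_μ + [A_μ, A_λ]` of the field strength (curvature) of the
connection, in the `i`-th trivialization and the chart `e`. -/
def fieldStrength (i : ι) (e : OpenPartialHomeomorph M (EuclideanSpace ℝ (Fin n)))
    (μ l : Fin n) (y : EuclideanSpace ℝ (Fin n)) : EuclideanSpace ℝ (Fin d) :=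
  partialDeriv μ (formCoeff (A.form i) e l) y - partialDeriv l (formCoeff (A.form i) e μ) y
    + bracket G (formCoeff (A.form i) e μ y) (formCoeff (A.form i) e l y)

/-- The connection is flat: its field strength vanishes. -/
def IsFlat : Prop :=
  ∀ i, ∀ e ∈ IsManifold.maximalAtlas (𝓡 n) ∞ M, ∀ y ∈ e.target, e.symm y ∈ P.baseSet i →
    ∀ μ l : Fin n, A.fieldStrength i e μ l y = 0

variable [IsManifold (𝓡 n) ∞ M] (g : RMetric n M)

/-- The full covariant derivative
`F_{μλ;α} = ∂_α F_{μλ} + [A_α, F_{μλ}] - Γ^γ_{αμ} F_{γλ} - Γ^γ_{αλ} F_{μγ}`. -/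
def covDerivFieldStrength (i : ι) (e : OpenPartialHomeomorph M (EuclideanSpace ℝ (Fin n)))
    (μ l α : Fin n) (y : EuclideanSpace ℝ (Fin n)) : EuclideanSpace ℝ (Fin d) :=
  partialDeriv α (A.fieldStrength i e μ l) y
    + bracket G (formCoeff (A.form i) e α y) (A.fieldStrength i e μ l y)
    - ∑ γ, christoffel g e γ α μ y • A.fieldStrength i e γ l y
    - ∑ γ, christoffel g e γ α l y • A.fieldStrength i e μ γ y

/-- The Yang-Mills equation `F^α_{λ;α} = g^{αμ} F_{μλ;α} = 0`. -/
def IsYangMills : Prop :=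
  ∀ i, ∀ e ∈ IsManifold.maximalAtlas (𝓡 n) ∞ M, ∀ y ∈ e.target, e.symm y ∈ P.baseSet i →
    ∀ l : Fin n, ∑ α, ∑ μ, invMetric g e y α μ • A.covDerivFieldStrength g i e μ l α y = 0

variable [LieGroup (𝓡 d) ∞ G]

/-- The energy density `F² = γ_{ab} F^a_{μλ} F^{bμλ}`, as a function on `M`; at `x` it is computed
in the preferred chart and trivialization at `x` (its value does not depend on them). -/
def energyDensity (x : M) : ℝ :=
  let e := chartAt (EuclideanSpace ℝ (Fin n)) x
  let F := A.fieldStrength (P.indexAt x) e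
  ∑ μ, ∑ l, ∑ α, ∑ β, invMetric g e (e x) μ α * invMetric g e (e x) l β
    * killingMetric G (F μ l (e x)) (F α β (e x))

/-- The energy `(∫_M |F|^{n/2})^{2/n}`, where `|F| = √F²`. -/
def energy [MeasurableSpace M] : ℝ :=
  (∫ x, Real.sqrt (A.energyDensity g x) ^ ((n : ℝ) / 2) ∂(volumeMeasure g)) ^ (2 / (n : ℝ))

end Connection

end Connection

end YangMills

end

/-! Write w = |F|². For a Yang–Mills connection the Bochner formula says ½Δw = |∇F|² + (2 Ric(F,F) −
Rm(F,F)) + 2⟨[F,F],F⟩. The curvature condition bounds the middle term below by 2c₀w, and the cubic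
term is at least −2n³w^{3/2}. Kato's inequality |Dw|² ≤ 4w|∇F|² replaces |∇F|² by the Dirichlet
density of √(w+ε), a smooth substitute for |F|. Integration over the closed manifold removes Δw and
leaves ∫|D√(w+ε)|² + 2c₀∫w ≤ 2n³∫√w·w. By Hölder with exponents n/2 and n/(n−2), the right side is
at most 2n³ times the energy times the squared L^{2n/(n−2)} norm of √(w+ε), which the Sobolev
inequality controls by the Dirichlet integral and ∫(w+ε). If the energy is small, all this is
absorbed on the left; ε → 0 gives ∫w = 0, hence F = 0. The carriers are `IsNormalAt.bochner`,
`IsNormalAt.sq_partialDeriv_energyIn_le`, `integral_bochner_le`, `integral_sqrt_mul_le` and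
`energy_gap`.

The cubic bound needs no constant from the group. Averaging over the compact group gives an
Ad-invariant inner product, for which every ad x is skew; as the centre is trivial, minus the
Killing form is positive definite. In the Killing norm, ‖x‖ is the Hilbert–Schmidt norm of ad x, so
‖[x,y]‖ ≤ ‖x‖‖y‖ (`exists_killingMetric_embedding`).

Pointwise computations are made at the centre of a chart in which the metric is Euclidean to first
order. Such charts come from one affine and one quadratic change of coordinates
(`exists_isNormalAt`). Transferring the result to the manifold requires that w and Δ depend neither
on the chart nor on the trivialization: for w this follows from the transformation laws of F
(`energyDensity_symm`), for Δ from Green's formula against test functions (`lapIn_eq`).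

Sobolev constants exist because a partition of unity reduces the inequality to functions supported
in one chart, where the Euclidean inequality applies and the metric is comparable to the flat one on
compact sets (`exists_sobolev_chart`). -/

noncomputable section

namespace YangMills

open Set Filter Topology
set_option linter.unusedSectionVars false
set_option linter.unusedSimpArgs false

/-! ### Coordinate changes, the metric in charts, and invariance of gradients. -/

section Charts

variable {n : ℕ} {M : Type*} [TopologicalSpace M] [ChartedSpace (EuclideanSpace ℝ (Fin n)) M]

/-- The derivative of `e.symm`, with the tangent spaces of `M` identified with the model space. -/
def dsymm (e : OpenPartialHomeomorph M (EuclideanSpace ℝ (Fin n)))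
    (y : EuclideanSpace ℝ (Fin n)) : EuclideanSpace ℝ (Fin n) →L[ℝ] EuclideanSpace ℝ (Fin n) :=
  mfderiv 𝓘(ℝ, EuclideanSpace ℝ (Fin n)) (𝓡 n) e.symm y

/-- The coordinate change from the chart `e'` to the chart `e`. -/
def coordChange (e' e : OpenPartialHomeomorph M (EuclideanSpace ℝ (Fin n)))
    (y : EuclideanSpace ℝ (Fin n)) : EuclideanSpace ℝ (Fin n) := e (e'.symm y)

variable (e e' : OpenPartialHomeomorph M (EuclideanSpace ℝ (Fin n)))

/-- The part of the target of `e'` that corresponds to the source of `e`. -/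
def overlap (e' e : OpenPartialHomeomorph M (EuclideanSpace ℝ (Fin n))) :
    Set (EuclideanSpace ℝ (Fin n)) := e'.target ∩ e'.symm ⁻¹' e.source

lemma isOpen_overlap : IsOpen (overlap e' e) :=
  e'.isOpen_inter_preimage_symm e.open_source

lemma coordChange_mem {y} (hy : y ∈ overlap e' e) : coordChange e' e y ∈ overlap e e' := by
  refine ⟨e.map_source hy.2, ?_⟩
  simp only [coordChange, mem_preimage, e.left_inv hy.2]
  exact e'.map_target hy.1

lemma symm_coordChange {y} (hy : y ∈ overlap e' e) : e.symm (coordChange e' e y) = e'.symm y :=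
  e.left_inv hy.2

lemma coordChange_coordChange {y} (hy : y ∈ overlap e' e) :
    coordChange e e' (coordChange e' e y) = y := by
  rw [coordChange, symm_coordChange _ _ hy, e'.right_inv hy.1]

variable [IsManifold (𝓡 n) ∞ M] {e e'}
  (he : e ∈ IsManifold.maximalAtlas (𝓡 n) ∞ M) (he' : e' ∈ IsManifold.maximalAtlas (𝓡 n) ∞ M)

include he he' in
lemma contDiffOn_coordChange : ContDiffOn ℝ ∞ (coordChange e' e) (overlap e' e) := by
  rw [← contMDiffOn_iff_contDiffOn]
  exact (contMDiffOn_of_mem_maximalAtlas he).comp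
    ((contMDiffOn_symm_of_mem_maximalAtlas he').mono inter_subset_left) (fun y hy => hy.2)

include he in
lemma mdifferentiableAt_symm {y} (hy : y ∈ e.target) :
    MDifferentiableAt 𝓘(ℝ, EuclideanSpace ℝ (Fin n)) (𝓡 n) e.symm y :=
  (contMDiffAt_symm_of_mem_maximalAtlas he hy).mdifferentiableAt (by simp)

include he he' in
-- The chain rule applied to `e'.symm = e.symm ∘ coordChange e' e`, which holds near `y`. All tensor
-- transformation laws below come from this identity.
lemma dsymm_eq {y} (hy : y ∈ overlap e' e) :
    dsymm e' y = (dsymm e (coordChange e' e y)).comp (fderiv ℝ (coordChange e' e) y) := by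
  have h1 : e'.symm =ᶠ[𝓝 y] e.symm ∘ coordChange e' e := by
    filter_upwards [(isOpen_overlap e e').mem_nhds hy] with z hz
    exact (symm_coordChange _ _ hz).symm
  have hd : DifferentiableAt ℝ (coordChange e' e) y :=
    ((contDiffOn_coordChange he he').contDiffAt ((isOpen_overlap e e').mem_nhds hy)).differentiableAt
      (by simp)
  have h3 : mfderiv 𝓘(ℝ, EuclideanSpace ℝ (Fin n)) (𝓡 n) (e.symm ∘ coordChange e' e) y = _ :=
    mfderiv_comp (I' := 𝓘(ℝ, EuclideanSpace ℝ (Fin n))) y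
      (mdifferentiableAt_symm he (coordChange_mem _ _ hy).1) hd.mdifferentiableAt
  rw [mfderiv_eq_fderiv] at h3
  have h2 := h1.mfderiv_eq (I := 𝓘(ℝ, EuclideanSpace ℝ (Fin n))) (I' := 𝓡 n)
  exact h2.trans h3

lemma clm_eq_sum {V : Type*} [NormedAddCommGroup V] [NormedSpace ℝ V]
    (L : EuclideanSpace ℝ (Fin n) →L[ℝ] V) (v : EuclideanSpace ℝ (Fin n)) :
    L v = ∑ i, v i • L (EuclideanSpace.single i 1) := by
  conv_lhs => rw [← (EuclideanSpace.basisFun (Fin n) ℝ).sum_repr v]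
  simp

/-- The Jacobian matrix of the coordinate change. -/
def jacobian (e' e : OpenPartialHomeomorph M (EuclideanSpace ℝ (Fin n)))
    (y : EuclideanSpace ℝ (Fin n)) : Matrix (Fin n) (Fin n) ℝ :=
  Matrix.of fun i j => partialDeriv j (coordChange e' e) y i

include he he' in
lemma dsymm_single {y} (hy : y ∈ overlap e' e) (j : Fin n) :
    dsymm e' y (EuclideanSpace.single j 1) = ∑ i, jacobian e' e y i j •
      dsymm e (coordChange e' e y) (EuclideanSpace.single i 1) := by
  rw [dsymm_eq he he' hy, ContinuousLinearMap.comp_apply, clm_eq_sum]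
  rfl

include he in
-- A coordinate field is the image of a constant section under the tangent map of `e.symm`, and the
-- tangent map of a smooth map is smooth.
lemma contMDiffOn_coordVector (i : Fin n) :
    ContMDiffOn 𝓘(ℝ, EuclideanSpace ℝ (Fin n)) ((𝓡 n).prod 𝓘(ℝ, EuclideanSpace ℝ (Fin n))) ∞
      (fun y => (⟨e.symm y, coordVector e y i⟩ : TangentBundle (𝓡 n) M)) e.target := by
  have h1 := (contMDiffOn_symm_of_mem_maximalAtlas he).contMDiffOn_tangentMapWithin (m := ∞)
    (by simp) e.open_target.uniqueMDiffOn
  have h2 : ContMDiff 𝓘(ℝ, EuclideanSpace ℝ (Fin n))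
      ((𝓘(ℝ, EuclideanSpace ℝ (Fin n))).prod 𝓘(ℝ, EuclideanSpace ℝ (Fin n))) ∞
      (fun y => (⟨y, EuclideanSpace.single i 1⟩ :
        TangentBundle 𝓘(ℝ, EuclideanSpace ℝ (Fin n)) (EuclideanSpace ℝ (Fin n)))) := by
    intro y
    rw [Bundle.contMDiffAt_totalSpace]
    refine ⟨contMDiffAt_id, ?_⟩
    simpa using contMDiffAt_const
  have h3 := h1.comp h2.contMDiffOn (s := e.target) (fun y hy => hy)
  refine h3.congr fun y hy => ?_
  simp only [Function.comp, tangentMapWithin, coordVector]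
  rw [mfderivWithin_of_isOpen e.open_target hy]

include he in
lemma contMDiffOn_inner_coordVector (g : RMetric n M) (i j : Fin n) :
    ContDiffOn ℝ ∞ (fun y => metricCoeff g e y i j) e.target := by
  rw [← contMDiffOn_iff_contDiffOn]
  -- With `g` installed as the bundle metric, the coefficients are inner products of smooth
  -- sections.
  let _ : Bundle.RiemannianBundle (fun x : M => TangentSpace (𝓡 n) x) := ⟨g.toRiemannianMetric⟩
  exact (contMDiffOn_coordVector he i).inner_bundle (contMDiffOn_coordVector he j)

/-- The metric at a point, with the tangent space identified with the model space. -/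
def metricAt (g : RMetric n M) (x : M) :
    EuclideanSpace ℝ (Fin n) →L[ℝ] EuclideanSpace ℝ (Fin n) →L[ℝ] ℝ := g.inner x

lemma metricCoeff_apply (g : RMetric n M) (e : OpenPartialHomeomorph M (EuclideanSpace ℝ (Fin n)))
    (y) (i j) : metricCoeff g e y i j = metricAt g (e.symm y)
      (dsymm e y (EuclideanSpace.single i 1)) (dsymm e y (EuclideanSpace.single j 1)) := rfl

lemma metricCoeff_transpose (g : RMetric n M)
    (e : OpenPartialHomeomorph M (EuclideanSpace ℝ (Fin n))) (y) :
    (metricCoeff g e y).transpose = metricCoeff g e y := by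
  ext i j
  exact g.symm _ _ _

include he he' in
lemma metricCoeff_coordChange (g : RMetric n M) {y} (hy : y ∈ overlap e' e) :
    metricCoeff g e' y = (jacobian e' e y).transpose * metricCoeff g e (coordChange e' e y) *
      jacobian e' e y := by
  ext i j
  rw [metricCoeff_apply, dsymm_single he he' hy, dsymm_single he he' hy,
    ← symm_coordChange _ _ hy]
  simp only [map_sum, map_smul, _root_.sum_apply, _root_.smul_apply,
    smul_eq_mul, Matrix.mul_apply, Matrix.transpose_apply, metricCoeff_apply, Finset.sum_mul,
    Finset.mul_sum]
  refine Finset.sum_congr rfl fun k _ => Finset.sum_congr rfl fun l _ => ?_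
  ring

include he in
lemma dsymm_injective {y} (hy : y ∈ e.target) : Function.Injective (dsymm e y) := by
  have h : e.MDifferentiable (𝓡 n) (𝓡 n) := ⟨fun x hx =>
    ((contMDiffAt_of_mem_maximalAtlas he hx).mdifferentiableAt (by simp)).mdifferentiableWithinAt, fun x hx =>
    (mdifferentiableAt_symm he hx).mdifferentiableWithinAt⟩
  exact h.symm.mfderiv_injective hy

lemma metricAt_dsymm (g : RMetric n M) (e : OpenPartialHomeomorph M (EuclideanSpace ℝ (Fin n)))
    (y v w : EuclideanSpace ℝ (Fin n)) :
    metricAt g (e.symm y) (dsymm e y v) (dsymm e y w) = v ⬝ᵥ (metricCoeff g e y).mulVec w := by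
  rw [clm_eq_sum (dsymm e y) v, clm_eq_sum (dsymm e y) w]
  simp only [map_sum, map_smul, _root_.sum_apply, _root_.smul_apply, smul_eq_mul,
    ← metricCoeff_apply, dotProduct, Matrix.mulVec, Finset.mul_sum]
  refine Finset.sum_comm.trans
    (Finset.sum_congr rfl fun k _ => Finset.sum_congr rfl fun l _ => ?_)
  ring

include he in
-- The matrix is the Gram matrix of the coordinate vectors, which are linearly independent because
-- `dsymm e y` is injective.
lemma metricCoeff_posDef (g : RMetric n M) {y} (hy : y ∈ e.target) :
    (metricCoeff g e y).PosDef := by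
  refine Matrix.PosDef.of_dotProduct_mulVec_pos ?_ fun v hv => ?_
  · rw [Matrix.IsHermitian, Matrix.conjTranspose_eq_transpose_of_trivial]
    exact metricCoeff_transpose g e y
  · set w : EuclideanSpace ℝ (Fin n) := WithLp.toLp 2 v with hw
    have hw0 : dsymm e y w ≠ 0 := by
      intro h
      have : w = 0 := dsymm_injective he hy (by simpa using h)
      exact hv (by simpa [hw] using this)
    have := g.pos (e.symm y) (dsymm e y w) hw0
    change 0 < metricAt g (e.symm y) (dsymm e y w) (dsymm e y w) at this
    rwa [metricAt_dsymm] at this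

lemma contDiffOn_det {E : Type*} [NormedAddCommGroup E] [NormedSpace ℝ E] {s : Set E}
    {A : E → Matrix (Fin n) (Fin n) ℝ} (hA : ∀ i j, ContDiffOn ℝ ∞ (fun y => A y i j) s) :
    ContDiffOn ℝ ∞ (fun y => (A y).det) s := by
  simp only [Matrix.det_apply]
  exact ContDiffOn.sum fun σ _ => (contDiffOn_prod fun i _ => hA _ _).const_smul _

/-- Cramer's rule: each entry of the inverse is a quotient of two determinants, polynomial in the
entries. -/
lemma contDiffOn_matrix_inv {E : Type*} [NormedAddCommGroup E] [NormedSpace ℝ E] {s : Set E}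
    {A : E → Matrix (Fin n) (Fin n) ℝ} (hA : ∀ i j, ContDiffOn ℝ ∞ (fun y => A y i j) s)
    (hdet : ∀ y ∈ s, (A y).det ≠ 0) (i j) :
    ContDiffOn ℝ ∞ (fun y => (A y)⁻¹ i j) s := by
  simp only [Matrix.inv_def, Matrix.smul_apply, Ring.inverse_eq_inv', smul_eq_mul,
    Matrix.adjugate_apply]
  refine ((contDiffOn_det hA).inv hdet).mul (contDiffOn_det fun k l => ?_)
  by_cases h : k = j
  · subst h; simpa using contDiffOn_const
  · simpa [Matrix.updateRow_ne h] using hA k l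

include he in
lemma metricCoeff_det_pos (g : RMetric n M) {y} (hy : y ∈ e.target) :
    0 < (metricCoeff g e y).det := (metricCoeff_posDef he g hy).det_pos

include he in
lemma contDiffOn_invMetric (g : RMetric n M) (i j : Fin n) :
    ContDiffOn ℝ ∞ (fun y => invMetric g e y i j) e.target :=
  contDiffOn_matrix_inv (contMDiffOn_inner_coordVector he g)
    (fun _ hy => (metricCoeff_det_pos he g hy).ne') i j

include he in
lemma invMetric_posDef (g : RMetric n M) {y} (hy : y ∈ e.target) :
    (invMetric g e y).PosDef := (metricCoeff_posDef he g hy).inv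

lemma partialDeriv_comp {V : Type*} [NormedAddCommGroup V] [NormedSpace ℝ V]
    {f : EuclideanSpace ℝ (Fin n) → V} {τ : EuclideanSpace ℝ (Fin n) → EuclideanSpace ℝ (Fin n)}
    {y} (hf : DifferentiableAt ℝ f (τ y)) (hτ : DifferentiableAt ℝ τ y) (j : Fin n) :
    partialDeriv j (fun z => f (τ z)) y = ∑ i, partialDeriv j τ y i • partialDeriv i f (τ y) := by
  have : fderiv ℝ (fun z => f (τ z)) y = _ := fderiv_comp y hf hτ
  rw [partialDeriv, this, ContinuousLinearMap.comp_apply, clm_eq_sum]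
  rfl

include he he' in
lemma differentiableAt_coordChange {y} (hy : y ∈ overlap e' e) :
    DifferentiableAt ℝ (coordChange e' e) y :=
  ((contDiffOn_coordChange he he').contDiffAt ((isOpen_overlap e e').mem_nhds hy)).differentiableAt
    (by simp)

include he he' in
-- Differentiate the identity that the two coordinate changes are inverse to each other near `y`.
lemma jacobian_mul_jacobian {y} (hy : y ∈ overlap e' e) :
    jacobian e e' (coordChange e' e y) * jacobian e' e y = 1 := by
  have h1 : (fun z => coordChange e e' (coordChange e' e z)) =ᶠ[𝓝 y] id := by
    filter_upwards [(isOpen_overlap e e').mem_nhds hy] with z hz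
    exact coordChange_coordChange _ _ hz
  ext i j
  have h2 := partialDeriv_comp (differentiableAt_coordChange he' he (coordChange_mem _ _ hy))
    (differentiableAt_coordChange he he' hy) j
  rw [partialDeriv, h1.fderiv_eq, fderiv_id] at h2
  have h3 := congrArg (fun v : EuclideanSpace ℝ (Fin n) => v i) h2
  simp only [ContinuousLinearMap.id_apply, WithLp.ofLp_sum, WithLp.ofLp_smul, Finset.sum_apply,
    Pi.smul_apply, smul_eq_mul] at h3
  rw [Matrix.mul_apply, Matrix.one_apply]
  simp only [jacobian, Matrix.of_apply]
  rw [Finset.sum_congr rfl fun k _ => mul_comm _ _, ← h3]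
  simp [eq_comm]

include he he' in
-- Invert g' = JᵀgJ, J being invertible. This form, with J on the outside, is the one that absorbs
-- Jacobians in contractions.
lemma invMetric_coordChange (g : RMetric n M) {y} (hy : y ∈ overlap e' e) :
    jacobian e' e y * invMetric g e' y * (jacobian e' e y).transpose =
      invMetric g e (coordChange e' e y) := by
  have h := jacobian_mul_jacobian he he' hy
  have hJ : IsUnit (jacobian e' e y).det := by
    have := congrArg Matrix.det h
    rw [Matrix.det_mul, Matrix.det_one] at this
    exact IsUnit.of_mul_eq_one_right _ this
  have hJt : IsUnit (jacobian e' e y).transpose.det := by rwa [Matrix.det_transpose]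
  rw [invMetric, metricCoeff_coordChange he he' g hy, Matrix.mul_inv_rev, Matrix.mul_inv_rev,
    ← mul_assoc, Matrix.mul_nonsing_inv _ hJ, one_mul, mul_assoc, Matrix.nonsing_inv_mul _ hJt,
    mul_one, invMetric]

/-- The Riemannian inner product of the gradients of two functions of the coordinates. -/
def gradInner (g : RMetric n M) (e : OpenPartialHomeomorph M (EuclideanSpace ℝ (Fin n)))
    (f h : EuclideanSpace ℝ (Fin n) → ℝ) (y : EuclideanSpace ℝ (Fin n)) : ℝ :=
  ∑ i, ∑ j, invMetric g e y i j * partialDeriv i f y * partialDeriv j h y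

lemma gradInner_eq (g : RMetric n M) (e : OpenPartialHomeomorph M (EuclideanSpace ℝ (Fin n)))
    (f h : EuclideanSpace ℝ (Fin n) → ℝ) (y : EuclideanSpace ℝ (Fin n)) :
    gradInner g e f h y = (fun i => partialDeriv i f y) ⬝ᵥ
      (invMetric g e y).mulVec (fun i => partialDeriv i h y) := by
  simp only [gradInner, dotProduct, Matrix.mulVec, Finset.mul_sum]
  exact Finset.sum_congr rfl fun i _ => Finset.sum_congr rfl fun j _ => by ring

include he he' in
lemma partialDeriv_coordChange {V : Type*} [NormedAddCommGroup V] [NormedSpace ℝ V] {u : M → V} {y}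
    (hy : y ∈ overlap e' e)
    (hu : DifferentiableAt ℝ (fun z => u (e.symm z)) (coordChange e' e y)) (j : Fin n) :
    partialDeriv j (fun z => u (e'.symm z)) y = ∑ i, jacobian e' e y i j •
      partialDeriv i (fun z => u (e.symm z)) (coordChange e' e y) := by
  have h1 : (fun z => u (e'.symm z)) =ᶠ[𝓝 y] fun z => u (e.symm (coordChange e' e z)) := by
    filter_upwards [(isOpen_overlap e e').mem_nhds hy] with z hz
    rw [symm_coordChange _ _ hz]
  rw [partialDeriv, h1.fderiv_eq]
  exact partialDeriv_comp hu (differentiableAt_coordChange he he' hy) j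

include he he' in
/-- The inner product of gradients does not depend on the chart. -/
lemma gradInner_coordChange (g : RMetric n M) {u v : M → ℝ} {y} (hy : y ∈ overlap e' e)
    (hu : DifferentiableAt ℝ (fun z => u (e.symm z)) (coordChange e' e y))
    (hv : DifferentiableAt ℝ (fun z => v (e.symm z)) (coordChange e' e y)) :
    gradInner g e' (fun z => u (e'.symm z)) (fun z => v (e'.symm z)) y =
      gradInner g e (fun z => u (e.symm z)) (fun z => v (e.symm z)) (coordChange e' e y) := by
  have key : ∀ {w : M → ℝ}, DifferentiableAt ℝ (fun z => w (e.symm z)) (coordChange e' e y) →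
      (fun j => partialDeriv j (fun z => w (e'.symm z)) y) = (jacobian e' e y).transpose.mulVec
        (fun i => partialDeriv i (fun z => w (e.symm z)) (coordChange e' e y)) := by
    intro w hw
    ext j
    rw [partialDeriv_coordChange he he' hy hw j]
    simp [Matrix.mulVec, dotProduct]
  rw [gradInner_eq, gradInner_eq, key hu, key hv, ← invMetric_coordChange he he' g hy,
    Matrix.mulVec_transpose, ← Matrix.dotProduct_mulVec, Matrix.mulVec_mulVec, Matrix.mulVec_mulVec,
    mul_assoc]

end Charts

/-! ### Second derivatives as bilinear maps and their chain rule. -/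

section SecondDerivative

variable {E F H : Type*} [NormedAddCommGroup E] [NormedSpace ℝ E] [NormedAddCommGroup F]
  [NormedSpace ℝ F] [NormedAddCommGroup H] [NormedSpace ℝ H]

/-- The second derivative of `f` at `p`, as a bilinear map. -/
def sndDeriv (f : E → F) (p u v : E) : F := fderiv ℝ (fderiv ℝ f) p u v

lemma ContDiffAt.differentiableAt_fderiv {f : E → F} {p : E} (hf : ContDiffAt ℝ ∞ f p) :
    DifferentiableAt ℝ (fderiv ℝ f) p :=
  (hf.fderiv_right (m := ∞) (by simp)).differentiableAt (by simp)

lemma eventually_contDiffAt {f : E → F} {p : E} (hf : ContDiffAt ℝ ∞ f p) :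
    ∀ᶠ x in 𝓝 p, DifferentiableAt ℝ f x := by
  filter_upwards [(hf.of_le (m := 1) (by exact_mod_cast le_top)).eventually (by simp)] with x hx
  exact hx.differentiableAt (by simp)

lemma fderiv_fderiv_apply {f : E → F} {p : E} (hf : ContDiffAt ℝ ∞ f p) (u v : E) :
    fderiv ℝ (fun x => fderiv ℝ f x v) p u = sndDeriv f p u v := by
  rw [fderiv_clm_apply (ContDiffAt.differentiableAt_fderiv hf) (differentiableAt_const v)]
  simp [sndDeriv]

lemma sndDeriv_symm {f : E → F} {p : E} (hf : ContDiffAt ℝ ∞ f p) (u v : E) :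
    sndDeriv f p u v = sndDeriv f p v u :=
  (hf.isSymmSndFDerivAt (by simpa using ENat.LEInfty.out)).eq u v

lemma sndDeriv_congr {f h : E → F} {p : E} (hfh : f =ᶠ[𝓝 p] h) (u v : E) :
    sndDeriv f p u v = sndDeriv h p u v := by
  rw [sndDeriv, sndDeriv, hfh.fderiv.fderiv_eq]

/-- The second-order chain rule. It is the tool with which group identities such as x(x⁻¹y) = y are
differentiated twice at the identity. -/
lemma sndDeriv_comp {f : F → H} {h : E → F} {p : E} (hf : ContDiffAt ℝ ∞ f (h p))
    (hh : ContDiffAt ℝ ∞ h p) (u v : E) :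
    sndDeriv (fun x => f (h x)) p u v = sndDeriv f (h p) (fderiv ℝ h p u) (fderiv ℝ h p v) +
      fderiv ℝ f (h p) (sndDeriv h p u v) := by
  have hd : DifferentiableAt ℝ h p := hh.differentiableAt (by simp)
  have h1 : fderiv ℝ (fun x => f (h x)) =ᶠ[𝓝 p]
      fun x => (fderiv ℝ f (h x)).comp (fderiv ℝ h x) := by
    filter_upwards [eventually_contDiffAt hh,
      hh.continuousAt.eventually (eventually_contDiffAt hf)] with x hx hx'
    exact fderiv_comp x hx' hx
  have h2 := ContDiffAt.differentiableAt_fderiv hf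
  have h3 : HasFDerivAt (fun x => fderiv ℝ f (h x))
      ((fderiv ℝ (fderiv ℝ f) (h p)).comp (fderiv ℝ h p)) p :=
    h2.hasFDerivAt.comp p hd.hasFDerivAt
  have h4 := (h3.clm_comp (ContDiffAt.differentiableAt_fderiv hh).hasFDerivAt).fderiv
  rw [sndDeriv, h1.fderiv_eq, h4]
  simp [sndDeriv, add_comm]

lemma sndDeriv_clm (L : E →L[ℝ] F) (p u v : E) : sndDeriv L p u v = 0 := by
  have : fderiv ℝ (L : E → F) = fun _ => L := by ext1 x; exact L.fderiv
  simp [sndDeriv, this]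

lemma sndDeriv_const (c : F) (p u v : E) : sndDeriv (fun _ : E => c) p u v = 0 := by
  have : fderiv ℝ (fun _ : E => c) = fun _ => 0 := by ext1 x; simp
  simp [sndDeriv, this]

lemma sndDeriv_id (p u v : E) : sndDeriv (fun x : E => x) p u v = 0 :=
  sndDeriv_clm (ContinuousLinearMap.id ℝ E) p u v

lemma sndDeriv_clm_comp (L : F →L[ℝ] H) {h : E → F} {p : E} (hh : ContDiffAt ℝ ∞ h p) (u v : E) :
    sndDeriv (fun x => L (h x)) p u v = L (sndDeriv h p u v) := by
  rw [sndDeriv_comp L.contDiff.contDiffAt hh, sndDeriv_clm, L.fderiv, zero_add]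

lemma sndDeriv_prodMk {f : E → F} {h : E → H} {p : E} (hf : ContDiffAt ℝ ∞ f p)
    (hh : ContDiffAt ℝ ∞ h p) (u v : E) :
    sndDeriv (fun x => (f x, h x)) p u v = (sndDeriv f p u v, sndDeriv h p u v) := by
  have h0 := hf.prodMk hh
  exact Prod.ext (sndDeriv_clm_comp (ContinuousLinearMap.fst ℝ F H) h0 u v).symm
    (sndDeriv_clm_comp (ContinuousLinearMap.snd ℝ F H) h0 u v).symm

lemma contDiffAt_fun_id {x : E} : ContDiffAt ℝ ∞ (fun z : E => z) x := contDiffAt_id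

lemma fderiv_pair_left {f : E × F → H} {x : E} {y : F} (hf : DifferentiableAt ℝ f (x, y)) (v : E) :
    fderiv ℝ (fun z => f (z, y)) x v = fderiv ℝ f (x, y) (v, 0) := by
  have := (hf.hasFDerivAt.comp (f := fun z => (z, y)) x
    (hasFDerivAt_prodMk_left x y)).fderiv
  rw [show (fun z => f (z, y)) = f ∘ fun z => (z, y) from rfl, this]
  rfl

lemma fderiv_pair_right {f : E × F → H} {x : E} {y : F} (hf : DifferentiableAt ℝ f (x, y)) (v : F) :
    fderiv ℝ (fun z => f (x, z)) y v = fderiv ℝ f (x, y) (0, v) := by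
  have := (hf.hasFDerivAt.comp (f := fun z => (x, z)) y
    (hasFDerivAt_prodMk_right x y)).fderiv
  rw [show (fun z => f (x, z)) = f ∘ fun z => (x, z) from rfl, this]
  rfl

lemma sndDeriv_pair_right {f : E × F → H} {x : E} {y : F} (hf : ContDiffAt ℝ ∞ f (x, y)) (u v : F) :
    sndDeriv (fun z => f (x, z)) y u v = sndDeriv f (x, y) (0, u) (0, v) := by
  have hp : ContDiffAt ℝ ∞ (fun z : F => (x, z)) y := contDiffAt_const.prodMk contDiffAt_id
  have h1 : fderiv ℝ (fun z : F => (x, z)) y = ContinuousLinearMap.inr ℝ E F :=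
    (hasFDerivAt_prodMk_right x y).fderiv
  rw [sndDeriv_comp (f := f) (h := fun z => (x, z)) hf hp, h1,
    sndDeriv_prodMk contDiffAt_const contDiffAt_fun_id, sndDeriv_const,
    sndDeriv_id]
  simp [Prod.mk_zero_zero]

lemma sndDeriv_add_left (f : E → F) (p u u' v : E) :
    sndDeriv f p (u + u') v = sndDeriv f p u v + sndDeriv f p u' v := by simp [sndDeriv]

end SecondDerivative

/-! ### Derivatives of maps between manifolds, read in charts. -/

section ManifoldDeriv

variable {n d : ℕ} {M : Type*} [TopologicalSpace M] [ChartedSpace (EuclideanSpace ℝ (Fin n)) M]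
  {N : Type*} [TopologicalSpace N] [ChartedSpace (EuclideanSpace ℝ (Fin d)) N]

/-- The derivative of a map between manifolds, with the tangent spaces identified with the model
spaces. -/
def modelDeriv (f : M → N) (x : M) : EuclideanSpace ℝ (Fin n) →L[ℝ] EuclideanSpace ℝ (Fin d) :=
  mfderiv (𝓡 n) (𝓡 d) f x

/-- Both sides are the derivative of `f ∘ e.symm`, factored once through `M` and once through the
target chart. -/
lemma modelDeriv_dsymm [IsManifold (𝓡 n) ∞ M] [IsManifold (𝓡 d) ∞ N]
    {e : OpenPartialHomeomorph M (EuclideanSpace ℝ (Fin n))}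
    (he : e ∈ IsManifold.maximalAtlas (𝓡 n) ∞ M)
    {e' : OpenPartialHomeomorph N (EuclideanSpace ℝ (Fin d))}
    (he' : e' ∈ IsManifold.maximalAtlas (𝓡 d) ∞ N) {f : M → N} {y} (hy : y ∈ e.target)
    (hfy : f (e.symm y) ∈ e'.source) (hf : MDifferentiableAt (𝓡 n) (𝓡 d) f (e.symm y)) (v) :
    modelDeriv f (e.symm y) (dsymm e y v) =
      dsymm e' (e' (f (e.symm y))) (fderiv ℝ (fun z => e' (f (e.symm z))) y v) := by
  have hs := mdifferentiableAt_symm he hy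
  have hfs : MDifferentiableAt 𝓘(ℝ, EuclideanSpace ℝ (Fin n)) (𝓡 d) (f ∘ e.symm) y :=
    hf.comp y hs
  have h1 : (f ∘ e.symm) =ᶠ[𝓝 y] e'.symm ∘ fun z => e' (f (e.symm z)) := by
    filter_upwards [hfs.continuousAt (e'.open_source.mem_nhds hfy)] with z hz
    exact (e'.left_inv hz).symm
  have hd : MDifferentiableAt 𝓘(ℝ, EuclideanSpace ℝ (Fin n)) 𝓘(ℝ, EuclideanSpace ℝ (Fin d))
      (fun z => e' (f (e.symm z))) y :=
    ((contMDiffAt_of_mem_maximalAtlas he' hfy).mdifferentiableAt (by simp)).comp y hfs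
  have h2 : mfderiv 𝓘(ℝ, EuclideanSpace ℝ (Fin n)) (𝓡 d) (f ∘ e.symm) y = _ :=
    mfderiv_comp (I' := 𝓡 n) y hf hs
  have h3 : mfderiv 𝓘(ℝ, EuclideanSpace ℝ (Fin n)) (𝓡 d)
      (e'.symm ∘ fun z => e' (f (e.symm z))) y = _ :=
    mfderiv_comp (I' := 𝓘(ℝ, EuclideanSpace ℝ (Fin d))) y
      (mdifferentiableAt_symm he' (e'.map_source hfy)) hd
  rw [mfderiv_eq_fderiv] at h3
  have h4 : (modelDeriv f (e.symm y)).comp (dsymm e y) =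
      (dsymm e' (e' (f (e.symm y)))).comp (fderiv ℝ (fun z => e' (f (e.symm z))) y) :=
    h2.symm.trans ((h1.mfderiv_eq (I := 𝓘(ℝ, EuclideanSpace ℝ (Fin n))) (I' := 𝓡 d)).trans h3)
  exact congrArg (fun L : EuclideanSpace ℝ (Fin n) →L[ℝ] EuclideanSpace ℝ (Fin d) => L v) h4

/-- The tangent space at `x` is identified with the model space through the preferred chart at `x`,
so the derivative of that chart is the identity there. For a Lie group, vectors at 1 thus coincide
with their coordinates in `chartOne`. -/
lemma dsymm_chartAt_self [IsManifold (𝓡 n) ∞ M] (x : M) :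
    dsymm (chartAt (EuclideanSpace ℝ (Fin n)) x) (chartAt (EuclideanSpace ℝ (Fin n)) x x) =
      ContinuousLinearMap.id ℝ _ := by
  have : IsManifold (𝓡 n) 1 M := IsManifold.of_le (n := ∞) (by simp)
  have h := mfderivWithin_range_extChartAt_symm (I := 𝓡 n) (x := x)
  simp only [ modelWithCornersSelf_coe, range_id, mfderivWithin_univ] at h
  exact h

end ManifoldDeriv

/-! ### The Lie group in the chart at the identity: bracket and adjoint action as derivatives of
multiplication. -/

section LieGroupChart

variable {d : ℕ} {G : Type*} [TopologicalSpace G] [ChartedSpace (EuclideanSpace ℝ (Fin d)) G]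
  [Group G]

variable (d G) in
/-- The preferred chart at the identity. -/
def chartOne : OpenPartialHomeomorph G (EuclideanSpace ℝ (Fin d)) :=
  chartAt (EuclideanSpace ℝ (Fin d)) (1 : G)

variable (d G) in
/-- The coordinates of the identity. -/
def origin : EuclideanSpace ℝ (Fin d) := chartOne d G 1

variable (d G) in
/-- Multiplication in the chart at the identity. -/
def mulChart (p : EuclideanSpace ℝ (Fin d) × EuclideanSpace ℝ (Fin d)) : EuclideanSpace ℝ (Fin d) :=
  chartOne d G ((chartOne d G).symm p.1 * (chartOne d G).symm p.2)

variable (d G) in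
/-- Left division in the chart at the identity. -/
def ldivChart (p : EuclideanSpace ℝ (Fin d) × EuclideanSpace ℝ (Fin d)) :
    EuclideanSpace ℝ (Fin d) :=
  chartOne d G (((chartOne d G).symm p.1)⁻¹ * (chartOne d G).symm p.2)

/-- Conjugation by `a` in the chart at the identity. -/
def conjChart (a : G) (h : EuclideanSpace ℝ (Fin d)) : EuclideanSpace ℝ (Fin d) :=
  chartOne d G (a * (chartOne d G).symm h * a⁻¹)

lemma one_mem_source : (1 : G) ∈ (chartOne d G).source := mem_chart_source _ _

lemma origin_mem : origin d G ∈ (chartOne d G).target := mem_chart_target _ _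

@[simp] lemma symm_origin : (chartOne d G).symm (origin d G) = 1 :=
  (chartOne d G).left_inv one_mem_source

variable [LieGroup (𝓡 d) ∞ G]

variable (d G) in
lemma chartOne_mem : chartOne d G ∈ IsManifold.maximalAtlas (𝓡 d) ∞ G :=
  IsManifold.chart_mem_maximalAtlas _

variable (d G) in
lemma dsymm_origin : dsymm (chartOne d G) (origin d G) = ContinuousLinearMap.id ℝ _ :=
  dsymm_chartAt_self (1 : G)

section

variable {E : Type*} [NormedAddCommGroup E] [NormedSpace ℝ E] {f g : E → G} {x : E}

lemma contDiffAt_chartOne_comp (hf : ContMDiffAt 𝓘(ℝ, E) (𝓡 d) ∞ f x) (hx : f x = 1) :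
    ContDiffAt ℝ ∞ (fun z => chartOne d G (f z)) x := by
  rw [← contMDiffAt_iff_contDiffAt]
  exact (contMDiffAt_of_mem_maximalAtlas (chartOne_mem d G) (hx ▸ one_mem_source)).comp x hf

lemma contMDiffAt_symm_comp {f : E → EuclideanSpace ℝ (Fin d)} (hf : ContDiffAt ℝ ∞ f x)
    (hx : f x ∈ (chartOne d G).target) :
    ContMDiffAt 𝓘(ℝ, E) (𝓡 d) ∞ (fun z => (chartOne d G).symm (f z)) x :=
  (contMDiffAt_symm_of_mem_maximalAtlas (chartOne_mem d G) hx).comp x hf.contMDiffAt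

end

variable (d G) in
lemma contDiffAt_mulChart : ContDiffAt ℝ ∞ (mulChart d G) (origin d G, origin d G) :=
  contDiffAt_chartOne_comp
    ((contMDiffAt_symm_comp contDiffAt_fst origin_mem).mul
      (contMDiffAt_symm_comp contDiffAt_snd origin_mem)) (by simp)

variable (d G) in
lemma contDiffAt_ldivChart : ContDiffAt ℝ ∞ (ldivChart d G) (origin d G, origin d G) :=
  contDiffAt_chartOne_comp
    ((contMDiffAt_symm_comp contDiffAt_fst origin_mem).inv.mul
      (contMDiffAt_symm_comp contDiffAt_snd origin_mem)) (by simp)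

lemma contDiffAt_conjChart (a : G) : ContDiffAt ℝ ∞ (conjChart (d := d) a) (origin d G) :=
  contDiffAt_chartOne_comp
    ((contMDiffAt_const.mul (contMDiffAt_symm_comp contDiffAt_id origin_mem)).mul
      contMDiffAt_const) (by simp)

@[simp] lemma mulChart_origin_left {y} (hy : y ∈ (chartOne d G).target) :
    mulChart d G (origin d G, y) = y := by
  simp [mulChart, (chartOne d G).right_inv hy]

@[simp] lemma mulChart_origin_right {y} (hy : y ∈ (chartOne d G).target) :
    mulChart d G (y, origin d G) = y := by
  simp [mulChart, (chartOne d G).right_inv hy]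

@[simp] lemma ldivChart_origin_left {y} (hy : y ∈ (chartOne d G).target) :
    ldivChart d G (origin d G, y) = y := by
  simp [ldivChart, (chartOne d G).right_inv hy]

lemma ldivChart_self (y) : ldivChart d G (y, y) = origin d G := by
  simp [ldivChart, origin]

lemma conjChart_origin (a : G) : conjChart a (origin d G) = origin d G := by
  rw [conjChart, symm_origin]
  simp [origin]

lemma eventually_mem_target : ∀ᶠ y in 𝓝 (origin d G), y ∈ (chartOne d G).target :=
  (chartOne d G).open_target.mem_nhds origin_mem

lemma eventually_comp_mem_source {E : Type*} [TopologicalSpace E] {f : E → G} {x : E}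
    (hf : ContinuousAt f x) (hx : f x = 1) : ∀ᶠ z in 𝓝 x, f z ∈ (chartOne d G).source :=
  hf ((chartOne d G).open_source.mem_nhds (hx ▸ one_mem_source))

/-- With either factor fixed at the identity, multiplication is the identity map of the other
factor; the two partial derivatives add up. -/
lemma fderiv_mulChart (v w : EuclideanSpace ℝ (Fin d)) :
    fderiv ℝ (mulChart d G) (origin d G, origin d G) (v, w) = v + w := by
  have hd : DifferentiableAt ℝ (mulChart d G) (origin d G, origin d G) :=
    (contDiffAt_mulChart d G).differentiableAt (by simp)
  have h : ((v, w) : EuclideanSpace ℝ (Fin d) × EuclideanSpace ℝ (Fin d)) = (v, 0) + (0, w) := by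
    simp
  have h1 : (fun z => mulChart d G (z, origin d G)) =ᶠ[𝓝 (origin d G)] id := by
    filter_upwards [eventually_mem_target] with z hz using mulChart_origin_right hz
  have h2 : (fun z => mulChart d G (origin d G, z)) =ᶠ[𝓝 (origin d G)] id := by
    filter_upwards [eventually_mem_target] with z hz using mulChart_origin_left hz
  rw [h, map_add, ← fderiv_pair_left hd, ← fderiv_pair_right hd, h1.fderiv_eq, h2.fderiv_eq]
  simp

lemma sndDeriv_mulChart_right (v w : EuclideanSpace ℝ (Fin d)) :
    sndDeriv (mulChart d G) (origin d G, origin d G) (0, v) (0, w) = 0 := by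
  rw [← sndDeriv_pair_right (contDiffAt_mulChart d G), ← sndDeriv_id (origin d G) v w]
  refine sndDeriv_congr ?_ v w
  filter_upwards [eventually_mem_target] with z hz using mulChart_origin_left hz

variable (G) in
/-- The mixed second derivative of the multiplication at the identity. -/
def mulMixed (v w : EuclideanSpace ℝ (Fin d)) : EuclideanSpace ℝ (Fin d) :=
  sndDeriv (mulChart d G) (origin d G, origin d G) (v, 0) (0, w)

lemma modelDeriv_eq_fderiv_chartOne {f : G → G} (hf : MDifferentiableAt (𝓡 d) (𝓡 d) f 1)
    (h1 : f 1 = 1) (v : EuclideanSpace ℝ (Fin d)) :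
    modelDeriv f 1 v = fderiv ℝ (fun z => chartOne d G (f ((chartOne d G).symm z)))
      (origin d G) v := by
  have := modelDeriv_dsymm (chartOne_mem d G) (chartOne_mem d G) (f := f) (y := origin d G)
    origin_mem (by rw [symm_origin, h1]; exact one_mem_source) (by rwa [symm_origin]) v
  rw [symm_origin, h1, ← origin, dsymm_origin] at this
  exact this

lemma Ad_eq (a : G) (v : EuclideanSpace ℝ (Fin d)) :
    (Ad a v : EuclideanSpace ℝ (Fin d)) = fderiv ℝ (conjChart a) (origin d G) v := by
  refine modelDeriv_eq_fderiv_chartOne (f := fun h : G => a * h * a⁻¹) ?_ (by simp) v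
  exact ((contMDiffAt_const.mul contMDiffAt_id).mul contMDiffAt_const).mdifferentiableAt
    (n := ∞) (by simp)

/-- The invariant field at a point is the derivative at 1 of left translation by that point, here
written in coordinates. -/
lemma mulInvariantVectorField_eq {y} (hy : y ∈ (chartOne d G).target)
    (v : EuclideanSpace ℝ (Fin d)) :
    (mulInvariantVectorField (I := 𝓡 d) (G := G) v ((chartOne d G).symm y) :
      EuclideanSpace ℝ (Fin d)) = dsymm (chartOne d G) y
        (fderiv ℝ (fun h => mulChart d G (y, h)) (origin d G) v) := by
  have := modelDeriv_dsymm (chartOne_mem d G) (chartOne_mem d G)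
    (f := fun h => (chartOne d G).symm y * h) (y := origin d G)
    origin_mem (by simpa using (chartOne d G).map_target hy)
    ((contMDiffAt_const.mul contMDiffAt_id).mdifferentiableAt (n := ∞) (by simp)) v
  rw [symm_origin, mul_one, (chartOne d G).right_inv hy, dsymm_origin] at this
  exact this

lemma dsymm_inverse_apply {y} (hy : y ∈ (chartOne d G).target) (v : EuclideanSpace ℝ (Fin d)) :
    (dsymm (chartOne d G) y).inverse (dsymm (chartOne d G) y v) = v := by
  have h : Function.Injective (dsymm (chartOne d G) y) := dsymm_injective (chartOne_mem d G) hy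
  let L : EuclideanSpace ℝ (Fin d) ≃L[ℝ] EuclideanSpace ℝ (Fin d) :=
    (LinearEquiv.ofInjectiveEndo (dsymm (chartOne d G) y).toLinearMap h).toContinuousLinearEquiv
  have hL : dsymm (chartOne d G) y = L := rfl
  rw [hL, ContinuousLinearMap.inverse_equiv]
  exact L.symm_apply_apply v

/-- The bracket on `T_1 G` is that of left-invariant fields, computed by pulling them back to the
chart at 1. The outer pull-back factor is the identity there and drops out. -/
lemma bracket_eq_lieBracket (v w : GroupLieAlgebra (𝓡 d) G) :
    bracket G v w = VectorField.lieBracket ℝ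
      (fun y => (dsymm (chartOne d G) y).inverse
        (mulInvariantVectorField v ((chartOne d G).symm y)))
      (fun y => (dsymm (chartOne d G) y).inverse
        (mulInvariantVectorField w ((chartOne d G).symm y)))
      (origin d G) := by
  have h1 : IsManifold (𝓡 d) 1 G := IsManifold.of_le (n := ∞) (by simp)
  have h2 : bracket G v w = VectorField.mlieBracketWithin (𝓡 d) (mulInvariantVectorField v)
    (mulInvariantVectorField w) univ (1 : G) := rfl
  rw [h2, VectorField.mlieBracketWithin_apply, mfderiv_extChartAt_self]
  have h3 : ∀ L : TangentSpace (𝓡 d) (1 : G),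
      (ContinuousLinearMap.id ℝ (TangentSpace (𝓡 d) (1 : G))).inverse L = L := by
    intro L; rw [ContinuousLinearMap.inverse_id]; rfl
  refine (h3 _).trans ?_
  simp only [preimage_univ, univ_inter, modelWithCornersSelf_coe, range_id]
  unfold VectorField.mpullbackWithin
  simp only [mfderivWithin_univ]
  refine Eq.trans ?_ (congrFun VectorField.lieBracketWithin_univ (origin d G))
  rfl

/-- In coordinates the left-invariant field of v is y ↦ ∂₂m(y,0)v with m the multiplication. Its
derivative at the origin along w is the mixed derivative in (w,v), and the Lie bracket
antisymmetrizes. -/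
lemma bracket_eq (v w : EuclideanSpace ℝ (Fin d)) :
    bracket G v w = mulMixed G v w - mulMixed G w v := by
  have hV : ∀ v : EuclideanSpace ℝ (Fin d), (fun y => (dsymm (chartOne d G) y).inverse
      (mulInvariantVectorField (I := 𝓡 d) (G := G) v ((chartOne d G).symm y) :
        EuclideanSpace ℝ (Fin d))) =ᶠ[𝓝 (origin d G)]
      fun y => fderiv ℝ (mulChart d G) (y, origin d G) (0, v) := by
    intro v
    have hc : ContinuousAt (fun y => (y, origin d G)) (origin d G) := by fun_prop
    filter_upwards [eventually_mem_target,
      hc.eventually (eventually_contDiffAt (contDiffAt_mulChart d G))] with y hy hy'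
    rw [mulInvariantVectorField_eq hy, dsymm_inverse_apply hy, fderiv_pair_right hy']
  have hder : ∀ v w : EuclideanSpace ℝ (Fin d), fderiv ℝ (fun y => fderiv ℝ (mulChart d G)
      (y, origin d G) (0, v)) (origin d G) w = mulMixed G w v := by
    intro v w
    have h := ContDiffAt.differentiableAt_fderiv (contDiffAt_mulChart d G)
    rw [fderiv_pair_left (f := fun p => fderiv ℝ (mulChart d G) p (0, v))
      (h.clm_apply (differentiableAt_const _)), fderiv_fderiv_apply (contDiffAt_mulChart d G)]
    rfl
  have hval : ∀ v : EuclideanSpace ℝ (Fin d),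
      fderiv ℝ (mulChart d G) (origin d G, origin d G) (0, v) = v := by
    intro v; rw [fderiv_mulChart, zero_add]
  refine (bracket_eq_lieBracket v w).trans ?_
  rw [VectorField.lieBracket, (hV v).fderiv_eq, (hV w).fderiv_eq, (hV v).eq_of_nhds,
    (hV w).eq_of_nhds, hval, hval, hder, hder]

/-- Meant for c = x⁻¹y and c = x⁻¹yx: the product x·c is then known explicitly, so the formula can
be solved for the mixed second derivative of c. -/
lemma fderiv_fst_snd_mulChart_comp {c : EuclideanSpace ℝ (Fin d) × EuclideanSpace ℝ (Fin d) →
      EuclideanSpace ℝ (Fin d)} (hc : ContDiffAt ℝ ∞ c (origin d G, origin d G))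
    (hc0 : c (origin d G, origin d G) = origin d G)
    (v w : EuclideanSpace ℝ (Fin d)) :
    sndDeriv (fun p => mulChart d G (p.1, c p)) (origin d G, origin d G) (v, 0) (0, w) =
      sndDeriv (mulChart d G) (origin d G, origin d G)
        (v, fderiv ℝ c (origin d G, origin d G) (v, 0))
        (0, fderiv ℝ c (origin d G, origin d G) (0, w)) +
      sndDeriv c (origin d G, origin d G) (v, 0) (0, w) := by
  have hp : ContDiffAt ℝ ∞ (fun p : EuclideanSpace ℝ (Fin d) × EuclideanSpace ℝ (Fin d) =>
      (p.1, c p)) (origin d G, origin d G) := contDiffAt_fst.prodMk hc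
  have hm : ContDiffAt ℝ ∞ (mulChart d G) ((origin d G, origin d G).1, c (origin d G, origin d G)) := by
    rw [hc0]; exact contDiffAt_mulChart d G
  rw [sndDeriv_comp (f := mulChart d G) (h := fun p => (p.1, c p)) hm hp,
    sndDeriv_prodMk contDiffAt_fst hc,
    (differentiableAt_fst (p := (origin d G, origin d G))).fderiv_prodMk (hc.differentiableAt (by simp)), fderiv_fst,
    show sndDeriv (fun p : EuclideanSpace ℝ (Fin d) × EuclideanSpace ℝ (Fin d) => p.1)
      (origin d G, origin d G) (v, 0) (0, w) = 0 from
      sndDeriv_clm (ContinuousLinearMap.fst ℝ (EuclideanSpace ℝ (Fin d)) (EuclideanSpace ℝ (Fin d))) _ _ _]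
  simp only [hc0, fderiv_mulChart, zero_add]
  rfl

lemma sndDeriv_mulChart_of_snd (a b w : EuclideanSpace ℝ (Fin d)) :
    sndDeriv (mulChart d G) (origin d G, origin d G) (a, b) (0, w) = mulMixed G a w := by
  have h : ((a, b) : EuclideanSpace ℝ (Fin d) × EuclideanSpace ℝ (Fin d)) = (a, 0) + (0, b) := by
    simp
  rw [h, sndDeriv_add_left, sndDeriv_mulChart_right, add_zero, mulMixed]

lemma fderiv_snd_eq {c : EuclideanSpace ℝ (Fin d) × EuclideanSpace ℝ (Fin d) →
      EuclideanSpace ℝ (Fin d)} (hc : ContDiffAt ℝ ∞ c (origin d G, origin d G))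
    (hc1 : ∀ᶠ y in 𝓝 (origin d G), c (origin d G, y) = y) (w) :
    fderiv ℝ c (origin d G, origin d G) (0, w) = w := by
  have h : (fun y => c (origin d G, y)) =ᶠ[𝓝 (origin d G)] id := hc1
  rw [← fderiv_pair_right (hc.differentiableAt (by simp)), h.fderiv_eq, fderiv_id]
  rfl

lemma tendsto_fst_origin : Tendsto Prod.fst (𝓝 (origin d G, origin d G)) (𝓝 (origin d G)) :=
  continuousAt_fst

lemma tendsto_snd_origin : Tendsto Prod.snd (𝓝 (origin d G, origin d G)) (𝓝 (origin d G)) :=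
  continuousAt_snd

lemma continuousAt_symm_origin : ContinuousAt (chartOne d G).symm (origin d G) :=
  (chartOne d G).continuousAt_symm origin_mem

variable (d G) in
lemma continuousAt_symm_fst : ContinuousAt (fun p : EuclideanSpace ℝ (Fin d) ×
    EuclideanSpace ℝ (Fin d) => (chartOne d G).symm p.1) (origin d G, origin d G) :=
  ContinuousAt.comp (g := (chartOne d G).symm) continuousAt_symm_origin continuousAt_fst

variable (d G) in
lemma continuousAt_symm_snd : ContinuousAt (fun p : EuclideanSpace ℝ (Fin d) ×
    EuclideanSpace ℝ (Fin d) => (chartOne d G).symm p.2) (origin d G, origin d G) :=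
  ContinuousAt.comp (g := (chartOne d G).symm) continuousAt_symm_origin continuousAt_snd

/-- The product x·(x⁻¹y) = y is linear in coordinates, so its mixed second derivative vanishes. -/
lemma sndDeriv_ldivChart (v w : EuclideanSpace ℝ (Fin d)) :
    sndDeriv (ldivChart d G) (origin d G, origin d G) (v, 0) (0, w) = - mulMixed G v w := by
  have hq := contDiffAt_ldivChart d G
  have h0 := fderiv_fst_snd_mulChart_comp hq (ldivChart_self _) v w
  rw [fderiv_snd_eq hq (eventually_mem_target.mono fun y hy => ldivChart_origin_left hy), sndDeriv_mulChart_of_snd] at h0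
  have hG : IsTopologicalGroup G := topologicalGroup_of_lieGroup (𝓡 d) ∞
  have h1 : (fun p => mulChart d G (p.1, ldivChart d G p)) =ᶠ[𝓝 (origin d G, origin d G)]
      Prod.snd := by
    have hcont : ContinuousAt (fun p : EuclideanSpace ℝ (Fin d) × EuclideanSpace ℝ (Fin d) =>
        ((chartOne d G).symm p.1)⁻¹ * (chartOne d G).symm p.2) (origin d G, origin d G) :=
      (continuousAt_symm_fst d G).inv.mul
        (continuousAt_symm_snd d G)
    filter_upwards [eventually_comp_mem_source (d := d) hcont (by simp),
      tendsto_snd_origin.eventually eventually_mem_target] with p hp hp2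
    simp [mulChart, ldivChart, (chartOne d G).left_inv hp, (chartOne d G).right_inv hp2]
  rw [sndDeriv_congr h1, show sndDeriv Prod.snd (origin d G, origin d G) (v, 0) (0, w) = 0 from
    sndDeriv_clm (ContinuousLinearMap.snd ℝ (EuclideanSpace ℝ (Fin d))
    (EuclideanSpace ℝ (Fin d))) _ _ _] at h0
  exact eq_neg_of_add_eq_zero_right h0.symm

variable (d G) in
/-- The map `(x, h) ↦ x⁻¹ h x` in the chart at the identity. -/
def conjInvChart (p : EuclideanSpace ℝ (Fin d) × EuclideanSpace ℝ (Fin d)) :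
    EuclideanSpace ℝ (Fin d) :=
  chartOne d G (((chartOne d G).symm p.1)⁻¹ * (chartOne d G).symm p.2 * (chartOne d G).symm p.1)

variable (d G) in
lemma contDiffAt_conjInvChart : ContDiffAt ℝ ∞ (conjInvChart d G) (origin d G, origin d G) :=
  contDiffAt_chartOne_comp
    (((contMDiffAt_symm_comp contDiffAt_fst origin_mem).inv.mul
      (contMDiffAt_symm_comp contDiffAt_snd origin_mem)).mul
      (contMDiffAt_symm_comp contDiffAt_fst origin_mem)) (by simp)

/-- This is the statement that the derivative of Ad(x⁻¹) at 1 is −ad. It comes from x·(x⁻¹yx) = yx,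
whose right side is the multiplication with its arguments exchanged. -/
lemma sndDeriv_conjInvChart (v w : EuclideanSpace ℝ (Fin d)) :
    sndDeriv (conjInvChart d G) (origin d G, origin d G) (v, 0) (0, w) = - bracket G v w := by
  have hq := contDiffAt_conjInvChart d G
  have hq0 : conjInvChart d G (origin d G, origin d G) = origin d G := by
    rw [conjInvChart, symm_origin]; simp [origin]
  have h0 := fderiv_fst_snd_mulChart_comp hq hq0 v w
  rw [fderiv_snd_eq hq (eventually_mem_target.mono fun y hy => by
    simp [conjInvChart, (chartOne d G).right_inv hy]), sndDeriv_mulChart_of_snd] at h0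
  have hG : IsTopologicalGroup G := topologicalGroup_of_lieGroup (𝓡 d) ∞
  have h1 : (fun p => mulChart d G (p.1, conjInvChart d G p)) =ᶠ[𝓝 (origin d G, origin d G)]
      fun p => mulChart d G (ContinuousLinearEquiv.prodComm ℝ (EuclideanSpace ℝ (Fin d))
        (EuclideanSpace ℝ (Fin d)) p) := by
    have hcont : ContinuousAt (fun p : EuclideanSpace ℝ (Fin d) × EuclideanSpace ℝ (Fin d) =>
        ((chartOne d G).symm p.1)⁻¹ * (chartOne d G).symm p.2 * (chartOne d G).symm p.1)
        (origin d G, origin d G) :=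
      ((continuousAt_symm_fst d G).inv.mul
        (continuousAt_symm_snd d G)).mul
        (continuousAt_symm_fst d G)
    filter_upwards [eventually_comp_mem_source (d := d) hcont (by simp)] with p hp
    simp only [mulChart, conjInvChart, (chartOne d G).left_inv hp]
    simp [mul_assoc]
  have h2 := sndDeriv_comp (f := mulChart d G) (h := ContinuousLinearEquiv.prodComm ℝ
    (EuclideanSpace ℝ (Fin d)) (EuclideanSpace ℝ (Fin d))) (p := (origin d G, origin d G))
    (contDiffAt_mulChart d G) (ContinuousLinearEquiv.contDiff _).contDiffAt (v, 0) (0, w)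
  rw [ContinuousLinearEquiv.fderiv, show sndDeriv (ContinuousLinearEquiv.prodComm ℝ
    (EuclideanSpace ℝ (Fin d)) (EuclideanSpace ℝ (Fin d))) (origin d G, origin d G) (v, 0) (0, w)
    = 0 from sndDeriv_clm (ContinuousLinearEquiv.prodComm ℝ (EuclideanSpace ℝ (Fin d))
      (EuclideanSpace ℝ (Fin d))).toContinuousLinearMap _ _ _, map_zero, add_zero] at h2
  rw [sndDeriv_congr h1, h2] at h0
  rw [bracket_eq]
  have h3 : sndDeriv (mulChart d G) (origin d G, origin d G) (0, v) (w, 0) = mulMixed G w v :=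
    sndDeriv_symm (contDiffAt_mulChart d G) _ _
  have h4 : sndDeriv (mulChart d G) (origin d G, origin d G) (0, v) (w, 0) = mulMixed G v w +
    sndDeriv (conjInvChart d G) (origin d G, origin d G) (v, 0) (0, w) := h0
  rw [h3] at h4
  rw [h4]; abel

/-- `Ad a` is compatible with the Lie bracket. -/
lemma Ad_bracket (a : G) (v w : EuclideanSpace ℝ (Fin d)) :
    (Ad a (bracket G v w : EuclideanSpace ℝ (Fin d)) : EuclideanSpace ℝ (Fin d)) =
      bracket G (Ad a v : EuclideanSpace ℝ (Fin d)) (Ad a w : EuclideanSpace ℝ (Fin d)) := by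
  have hG : IsTopologicalGroup G := topologicalGroup_of_lieGroup (𝓡 d) ∞
  set D := fderiv ℝ (conjChart (d := d) a) (origin d G) with hD
  have hC := contDiffAt_conjChart (d := d) a
  have hm := contDiffAt_mulChart d G
  -- Differentiate twice the fact that conjugation c is a homomorphism, c(xy) = c(x)c(y). The extra
  -- term D²c(v,w) is symmetric and disappears from the antisymmetrized bracket.
  have key : ∀ v w, sndDeriv (conjChart (d := d) a) (origin d G) v w + D (mulMixed G v w) =
      mulMixed G (D v) (D w) := by
    intro v w
    have e : (fun p => conjChart a (mulChart d G p)) =ᶠ[𝓝 (origin d G, origin d G)]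
        fun p => mulChart d G (conjChart a p.1, conjChart a p.2) := by
      have hcont : ContinuousAt (fun p : EuclideanSpace ℝ (Fin d) × EuclideanSpace ℝ (Fin d) =>
          (chartOne d G).symm p.1 * (chartOne d G).symm p.2) (origin d G, origin d G) :=
        (continuousAt_symm_fst d G).mul
          (continuousAt_symm_snd d G)
      have h' : ContinuousAt (fun p : EuclideanSpace ℝ (Fin d) => a * (chartOne d G).symm p * a⁻¹)
          (origin d G) :=
        (continuousAt_const.mul continuousAt_symm_origin).mul continuousAt_const
      have h'' := eventually_comp_mem_source (d := d) h' (by simp)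
      filter_upwards [eventually_comp_mem_source (d := d) hcont (by simp),
        tendsto_fst_origin.eventually h'', tendsto_snd_origin.eventually h''] with p h1 h2 h3
      simp only [conjChart, mulChart, (chartOne d G).left_inv h1, (chartOne d G).left_inv h2,
        (chartOne d G).left_inv h3]
      congr 1
      group
    have hm0 : mulChart d G (origin d G, origin d G) = origin d G :=
      mulChart_origin_left origin_mem
    have h1 := sndDeriv_comp (f := conjChart (d := d) a) (h := mulChart d G)
      (p := (origin d G, origin d G)) (by rw [hm0]; exact hC) hm (v, 0) (0, w)
    have hC1 : ContDiffAt ℝ ∞ (fun p : EuclideanSpace ℝ (Fin d) × EuclideanSpace ℝ (Fin d) =>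
        conjChart a p.1) (origin d G, origin d G) := ContDiffAt.comp (g := conjChart a) _ hC contDiffAt_fst
    have hC2 : ContDiffAt ℝ ∞ (fun p : EuclideanSpace ℝ (Fin d) × EuclideanSpace ℝ (Fin d) =>
        conjChart a p.2) (origin d G, origin d G) := ContDiffAt.comp (g := conjChart a) _ hC contDiffAt_snd
    have hd := hC.differentiableAt (by simp : (∞ : ℕ∞ω) ≠ 0)
    have hf1 : HasFDerivAt (fun p : EuclideanSpace ℝ (Fin d) × EuclideanSpace ℝ (Fin d) =>
        conjChart a p.1) (D.comp (ContinuousLinearMap.fst ℝ _ _)) (origin d G, origin d G) :=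
      HasFDerivAt.comp (g := conjChart a) _ hd.hasFDerivAt hasFDerivAt_fst
    have hf2 : HasFDerivAt (fun p : EuclideanSpace ℝ (Fin d) × EuclideanSpace ℝ (Fin d) =>
        conjChart a p.2) (D.comp (ContinuousLinearMap.snd ℝ _ _)) (origin d G, origin d G) :=
      HasFDerivAt.comp (g := conjChart a) _ hd.hasFDerivAt hasFDerivAt_snd
    have hs1 := sndDeriv_comp (f := conjChart (d := d) a)
      (h := ContinuousLinearMap.fst ℝ (EuclideanSpace ℝ (Fin d)) (EuclideanSpace ℝ (Fin d)))
      (p := (origin d G, origin d G)) hC (ContinuousLinearMap.contDiff _).contDiffAt (v, 0) (0, w)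
    have hs2 := sndDeriv_comp (f := conjChart (d := d) a)
      (h := ContinuousLinearMap.snd ℝ (EuclideanSpace ℝ (Fin d)) (EuclideanSpace ℝ (Fin d)))
      (p := (origin d G, origin d G)) hC (ContinuousLinearMap.contDiff _).contDiffAt (v, 0) (0, w)
    have h2 := sndDeriv_comp (f := mulChart d G) (h := fun p => (conjChart a p.1, conjChart a p.2))
      (p := (origin d G, origin d G)) (by simpa only [conjChart_origin] using hm)
      (hC1.prodMk hC2) (v, 0) (0, w)
    rw [(hf1.prodMk hf2).fderiv, sndDeriv_prodMk hC1 hC2] at h2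
    rw [sndDeriv_clm, ContinuousLinearMap.fderiv] at hs1 hs2
    simp only [ContinuousLinearMap.coe_fst', ContinuousLinearMap.coe_snd', map_zero, add_zero]
      at hs1 hs2
    rw [hs1, hs2, sndDeriv_congr e.symm, h1, hm0] at h2
    simp only [fderiv_mulChart, conjChart_origin, ContinuousLinearMap.prod_apply,
      ContinuousLinearMap.comp_apply, ContinuousLinearMap.coe_fst', ContinuousLinearMap.coe_snd',
      map_zero, add_zero, zero_add] at h2
    rw [show sndDeriv (conjChart a) (origin d G) v 0 = 0 by simp [sndDeriv],
      show sndDeriv (conjChart a) (origin d G) 0 w = 0 by simp [sndDeriv], add_zero, add_zero] at h2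
    exact h2
  rw [Ad_eq, Ad_eq, Ad_eq, bracket_eq, bracket_eq, ← hD, map_sub, ← key, ← key,
    sndDeriv_symm hC w v]
  abel

end LieGroupChart

/-! ### Definiteness of the Killing form and the norm of the bracket. -/

section KillingForm

lemma exists_isometry_of_posDef {L : Type*} [AddCommGroup L] [Module ℝ L] [FiniteDimensional ℝ L]
    (S : LinearMap.BilinForm ℝ L) (hsymm : ∀ x y, S x y = S y x) (hpos : ∀ x, x ≠ 0 → 0 < S x x) :
    ∃ m : ℕ, ∃ ι : L ≃ₗ[ℝ] EuclideanSpace ℝ (Fin m), ∀ x y, inner ℝ (ι x) (ι y) = S x y := by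
  have hnn : ∀ x, 0 ≤ S x x := fun x => by
    by_cases hx : x = 0
    · simp [hx]
    · exact (hpos x hx).le
  let core : InnerProductSpace.Core ℝ L :=
    { inner := fun x y => S x y
      conj_inner_symm := fun x y => hsymm y x
      re_inner_nonneg := fun x => hnn x
      add_left := fun x y z => by simp
      smul_left := fun x y r => by simp
      definite := fun x hx => by_contra fun h => (hpos x h).ne' hx }
  let _ : NormedAddCommGroup L := core.toNormedAddCommGroup
  let _ : InnerProductSpace ℝ L := InnerProductSpace.ofCore core.toCore
  exact ⟨_, (stdOrthonormalBasis ℝ L).repr.toLinearEquiv, fun x y =>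
    (stdOrthonormalBasis ℝ L).repr.inner_map_map x y⟩

variable {L : Type*} [LieRing L] [LieAlgebra ℝ L] [FiniteDimensional ℝ L]

/-- Each ad x is skew for an invariant inner product, so tr((ad x)²) is minus the squared
Hilbert–Schmidt norm of ad x. -/
lemma killingForm_self_eq {m : ℕ} (ι : L ≃ₗ[ℝ] EuclideanSpace ℝ (Fin m))
    (hinv : ∀ z x y : L, inner ℝ (ι ⁅z, x⁆) (ι y) = - inner ℝ (ι x) (ι ⁅z, y⁆)) (x : L) :
    killingForm ℝ L x x =
      - ∑ i, ‖ι ⁅x, ι.symm (EuclideanSpace.single i 1)⁆‖ ^ 2 := by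
  rw [killingForm_apply_apply, ← LinearMap.trace_conj' _ ι,
    LinearMap.trace_eq_sum_inner _ (EuclideanSpace.basisFun (Fin m) ℝ), ← Finset.sum_neg_distrib]
  refine Finset.sum_congr rfl fun i _ => ?_
  have h := hinv x ⁅x, ι.symm (EuclideanSpace.single i 1)⁆ (ι.symm (EuclideanSpace.single i 1))
  rw [← real_inner_self_eq_norm_sq, ← h]
  simp [LinearEquiv.conj_apply, real_inner_comm]

/-- A Lie algebra with an invariant inner product and trivial center embeds isometrically into a
Euclidean space for minus the Killing form, and the bracket is bounded by the product of the
norms. -/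
lemma exists_killing_embedding (hcenter : ∀ x : L, (∀ y : L, ⁅x, y⁆ = 0) → x = 0)
    (S : LinearMap.BilinForm ℝ L) (hsymm : ∀ x y, S x y = S y x) (hpos : ∀ x, x ≠ 0 → 0 < S x x)
    (hinv : ∀ z x y : L, S ⁅z, x⁆ y = - S x ⁅z, y⁆) :
    ∃ m : ℕ, ∃ ι : L ≃ₗ[ℝ] EuclideanSpace ℝ (Fin m),
      (∀ x y, inner ℝ (ι x) (ι y) = - killingForm ℝ L x y) ∧
      ∀ x y, ‖ι ⁅x, y⁆‖ ≤ ‖ι x‖ * ‖ι y‖ := by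
  -- The auxiliary inner product `S` serves only to prove that minus the Killing form is definite.
  obtain ⟨k, ι₀, h₀⟩ := exists_isometry_of_posDef S hsymm hpos
  have hneg := killingForm_self_eq ι₀ (fun z x y => by rw [h₀, h₀, hinv])
  have hkpos : ∀ x : L, x ≠ 0 → 0 < (-killingForm ℝ L) x x := by
    intro x hx
    rw [LinearMap.neg_apply, LinearMap.neg_apply, hneg, neg_neg]
    by_contra hle
    have h0 : ∑ i, ‖ι₀ ⁅x, ι₀.symm (EuclideanSpace.single i 1)⁆‖ ^ 2 = 0 :=
      le_antisymm (not_lt.1 hle) (Finset.sum_nonneg fun i _ => sq_nonneg _)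
    rw [Finset.sum_eq_zero_iff_of_nonneg fun i _ => sq_nonneg _] at h0
    refine hx (hcenter x fun y => ?_)
    -- If the Hilbert–Schmidt norm vanishes, ad x kills a basis, so x is central.
    have hT : ((LieAlgebra.ad ℝ L x).comp ι₀.symm.toLinearMap) = 0 := by
      refine (EuclideanSpace.basisFun (Fin k) ℝ).toBasis.ext fun i => ?_
      have := h0 i (Finset.mem_univ i)
      simpa using this
    have := LinearMap.congr_fun hT (ι₀ y)
    simpa using this
  -- Minus the Killing form is itself an invariant inner product. With respect to it,
  -- `killingForm_self_eq` says that ‖x‖ equals the Hilbert–Schmidt norm of ad x.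
  obtain ⟨m, ι, h⟩ := exists_isometry_of_posDef (-killingForm ℝ L)
    (fun x y => by simp only [LinearMap.neg_apply]; rw [LieModule.traceForm_comm]) hkpos
  refine ⟨m, ι, h, fun x y => ?_⟩
  have hsq := killingForm_self_eq ι (fun z x y => by
    rw [h, h, LinearMap.neg_apply, LinearMap.neg_apply, LinearMap.neg_apply, LinearMap.neg_apply,
      LieModule.traceForm_apply_lie_apply']) x
  have hx : ‖ι x‖ ^ 2 = ∑ i, ‖ι ⁅x, ι.symm (EuclideanSpace.single i 1)⁆‖ ^ 2 := by
    rw [← real_inner_self_eq_norm_sq, h, LinearMap.neg_apply, LinearMap.neg_apply, hsq, neg_neg]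
  have hy : y = ∑ i, ι y i • ι.symm (EuclideanSpace.single i 1) := by
    apply ι.injective
    rw [map_sum]
    simp only [map_smul, LinearEquiv.apply_symm_apply]
    exact clm_eq_sum (ContinuousLinearMap.id ℝ _) (ι y)
  have hb : ‖ι ⁅x, y⁆‖ ≤ ∑ i, |ι y i| * ‖ι ⁅x, ι.symm (EuclideanSpace.single i 1)⁆‖ := by
    conv_lhs => rw [hy, lie_sum, map_sum]
    refine (norm_sum_le _ _).trans (Finset.sum_le_sum fun i _ => ?_)
    rw [lie_smul, map_smul, norm_smul, Real.norm_eq_abs]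
  -- The operator norm of ad x is at most its Hilbert–Schmidt norm, by Cauchy–Schwarz over the
  -- basis.
  have hcs := Finset.sum_mul_sq_le_sq_mul_sq Finset.univ (fun i => |ι y i|)
    (fun i => ‖ι ⁅x, ι.symm (EuclideanSpace.single i 1)⁆‖)
  rw [← hx] at hcs
  simp only [sq_abs] at hcs
  rw [← EuclideanSpace.real_norm_sq_eq] at hcs
  refine hb.trans (abs_le_of_sq_le_sq' ?_ (by positivity)).2
  linarith [mul_pow ‖ι x‖ ‖ι y‖ 2]

end KillingForm

/-! ### The adjoint representation, invariant forms and the Killing metric of the group. -/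

section Adjoint

variable {d : ℕ} {G : Type*} [TopologicalSpace G] [ChartedSpace (EuclideanSpace ℝ (Fin d)) G]
  [Group G] [LieGroup (𝓡 d) ∞ G]

/-- The adjoint representation, with the Lie algebra identified with the model space. -/
def adj (a : G) : EuclideanSpace ℝ (Fin d) →L[ℝ] EuclideanSpace ℝ (Fin d) := Ad a

lemma adj_eq (a : G) : adj (d := d) a = fderiv ℝ (conjChart a) (origin d G) := by
  ext1 v
  exact Ad_eq a v

lemma adj_mul (a b : G) : adj (d := d) (a * b) = (adj a).comp (adj b) := by
  have hG : IsTopologicalGroup G := topologicalGroup_of_lieGroup (𝓡 d) ∞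
  have h : conjChart (d := d) (a * b) =ᶠ[𝓝 (origin d G)] conjChart (d := d) a ∘ conjChart b := by
    have hc : ContinuousAt (fun p => b * (chartOne d G).symm p * b⁻¹) (origin d G) :=
      (continuousAt_const.mul continuousAt_symm_origin).mul continuousAt_const
    filter_upwards [eventually_comp_mem_source (d := d) hc (by simp)] with p hp
    simp only [Function.comp, conjChart, (chartOne d G).left_inv hp]
    congr 1
    group
  rw [adj_eq, adj_eq, adj_eq, h.fderiv_eq, fderiv_comp, conjChart_origin]
  · rw [conjChart_origin]; exact (contDiffAt_conjChart a).differentiableAt (by simp)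
  · exact (contDiffAt_conjChart b).differentiableAt (by simp)

lemma adj_one : adj (d := d) (1 : G) = ContinuousLinearMap.id ℝ _ := by
  have h : conjChart (d := d) (1 : G) =ᶠ[𝓝 (origin d G)] id := by
    filter_upwards [eventually_mem_target] with p hp
    simp [conjChart, (chartOne d G).right_inv hp]
  rw [adj_eq, h.fderiv_eq, fderiv_id]

lemma adj_inv_symm (v : EuclideanSpace ℝ (Fin d)) : ∀ᶠ x in 𝓝 (origin d G),
    adj ((chartOne d G).symm x)⁻¹ v = fderiv ℝ (conjInvChart d G) (x, origin d G) (0, v) := by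
  have hc : ContinuousAt (fun y => (y, origin d G)) (origin d G) := by fun_prop
  filter_upwards [hc.eventually (eventually_contDiffAt (contDiffAt_conjInvChart d G))] with x hx
  rw [adj_eq, ← fderiv_pair_right hx]
  congr 2
  ext1 h
  simp [conjChart, conjInvChart]

/-- The product rule for Ad(σ⁻¹)V at a point where σ = 1, with `s` the coordinates of σ:
differentiating Ad(σ⁻¹) gives −ad, by `sndDeriv_conjInvChart`. -/
lemma hasFDerivAt_conjInvChart {E : Type*} [NormedAddCommGroup E] [NormedSpace ℝ E]
    {s V : E → EuclideanSpace ℝ (Fin d)} {x : E} (hs : DifferentiableAt ℝ s x)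
    (hsx : s x = origin d G) (hV : DifferentiableAt ℝ V x) (u : E) :
    fderiv ℝ (fun y => fderiv ℝ (conjInvChart d G) (s y, origin d G) (0, V y)) x u =
      fderiv ℝ V x u - bracket G (fderiv ℝ s x u) (V x) := by
  have h1 : HasFDerivAt (fun y => fderiv ℝ (conjInvChart d G) (s y, origin d G))
      ((fderiv ℝ (fderiv ℝ (conjInvChart d G)) (s x, origin d G)).comp
        ((fderiv ℝ s x).prod 0)) x := by
    refine HasFDerivAt.comp (g := fderiv ℝ (conjInvChart d G)) x ?_
      (hs.hasFDerivAt.prodMk (hasFDerivAt_const (origin d G) x))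
    rw [hsx]
    exact (ContDiffAt.differentiableAt_fderiv (contDiffAt_conjInvChart d G)).hasFDerivAt
  have h2 : HasFDerivAt (fun y => ((0 : EuclideanSpace ℝ (Fin d)), V y))
      ((0 : E →L[ℝ] EuclideanSpace ℝ (Fin d)).prod (fderiv ℝ V x)) x :=
    (hasFDerivAt_const 0 x).prodMk hV.hasFDerivAt
  rw [(h1.clm_apply h2).fderiv, hsx]
  have h3 := sndDeriv_conjInvChart (G := G) (fderiv ℝ s x u) (V x)
  rw [sndDeriv] at h3
  have h4 := fderiv_snd_eq (contDiffAt_conjInvChart d G) (eventually_mem_target.mono fun y hy => by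
    simp [conjInvChart, (chartOne d G).right_inv hy]) (fderiv ℝ V x u)
  simp only [_root_.add_apply, ContinuousLinearMap.comp_apply, ContinuousLinearMap.prod_apply,
    ContinuousLinearMap.flip_apply, _root_.zero_apply]
  rw [h3, h4]
  abel

/-- Near 1, continuity is read off from the smooth coordinate formula. At another point b it is
transported by Ad(a⁻¹) = Ad((b⁻¹a)⁻¹) Ad(b⁻¹). -/
lemma continuous_adj_inv (v : EuclideanSpace ℝ (Fin d)) : Continuous fun a : G => adj a⁻¹ v := by
  have hG : IsTopologicalGroup G := topologicalGroup_of_lieGroup (𝓡 d) ∞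
  have key : ∀ w : EuclideanSpace ℝ (Fin d), ContinuousAt (fun a : G => adj a⁻¹ w) 1 := by
    intro w
    have h0 : ContinuousAt (chartOne d G) 1 := (chartOne d G).continuousAt one_mem_source
    have h1 : ContinuousAt (fun x => fderiv ℝ (conjInvChart d G) (x, origin d G) (0, w))
        (origin d G) := by
      have h2 : ContinuousAt (fderiv ℝ (conjInvChart d G)) (origin d G, origin d G) :=
        (ContDiffAt.differentiableAt_fderiv (contDiffAt_conjInvChart d G)).continuousAt
      have h3 : ContinuousAt (fun x => fderiv ℝ (conjInvChart d G) (x, origin d G)) (origin d G) :=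
        ContinuousAt.comp (g := fderiv ℝ (conjInvChart d G)) h2 (by fun_prop)
      exact h3.clm_apply continuousAt_const
    have h4 : ContinuousAt (fun a : G => fderiv ℝ (conjInvChart d G)
      (chartOne d G a, origin d G) (0, w)) 1 := ContinuousAt.comp
        (g := fun x => fderiv ℝ (conjInvChart d G) (x, origin d G) (0, w)) h1 h0
    refine h4.congr ?_
    filter_upwards [(chartOne d G).open_source.mem_nhds one_mem_source,
      h0.eventually (adj_inv_symm (G := G) w)] with a ha ha'
    rw [← ha', (chartOne d G).left_inv ha]
  rw [continuous_iff_continuousAt]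
  intro b
  have h5 : (fun a : G => adj (d := d) a⁻¹ v) = (fun a : G => adj a⁻¹ (adj b⁻¹ v)) ∘
      fun a => b⁻¹ * a := by
    ext1 a
    rw [Function.comp, ← ContinuousLinearMap.comp_apply, ← adj_mul]
    congr 2
    group
  rw [h5]
  refine ContinuousAt.comp ?_ (by fun_prop)
  rw [inv_mul_cancel]
  exact key _

/-- Averaging over a compact group gives an inner product that is invariant under the adjoint
representation. -/
lemma exists_adj_invariant_form [T2Space G] [CompactSpace G] :
    ∃ S : LinearMap.BilinForm ℝ (EuclideanSpace ℝ (Fin d)), (∀ x y, S x y = S y x) ∧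
      (∀ x, x ≠ 0 → 0 < S x x) ∧ ∀ (b : G) x y, S (adj b⁻¹ x) (adj b⁻¹ y) = S x y := by
  have hG : IsTopologicalGroup G := topologicalGroup_of_lieGroup (𝓡 d) ∞
  let _ : MeasurableSpace G := borel G
  have _ : BorelSpace G := ⟨rfl⟩
  let μ : Measure G := Measure.haar
  have hc : ∀ x y : EuclideanSpace ℝ (Fin d),
      Continuous fun a : G => inner ℝ (adj a⁻¹ x) (adj a⁻¹ y) :=
    fun x y => (continuous_adj_inv x).inner (continuous_adj_inv y)
  have hi : ∀ x y : EuclideanSpace ℝ (Fin d),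
      Integrable (fun a : G => inner ℝ (adj a⁻¹ x) (adj a⁻¹ y)) μ :=
    fun x y => (hc x y).integrable_of_hasCompactSupport (HasCompactSupport.of_compactSpace _)
  refine ⟨LinearMap.mk₂ ℝ (fun x y => ∫ a : G, inner ℝ (adj a⁻¹ x) (adj a⁻¹ y) ∂μ) ?_ ?_ ?_ ?_,
    ?_, ?_, ?_⟩
  · intro x x' y
    simp only [map_add, inner_add_left]
    exact integral_add (hi _ _) (hi _ _)
  · intro c x y
    simp only [map_smul, inner_smul_left, RCLike.conj_to_real, smul_eq_mul]
    exact integral_const_mul _ _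
  · intro x y y'
    simp only [map_add, inner_add_right]
    exact integral_add (hi _ _) (hi _ _)
  · intro c x y
    simp only [map_smul, inner_smul_right, smul_eq_mul]
    exact integral_const_mul _ _
  · intro x y
    simp only [LinearMap.mk₂_apply]
    exact integral_congr_ae (ae_of_all _ fun a => real_inner_comm _ _)
  · intro x hx
    rw [LinearMap.mk₂_apply]
    refine (hc x x).integral_pos_of_hasCompactSupport_nonneg_nonzero (x := 1)
      (HasCompactSupport.of_compactSpace _) (fun a => real_inner_self_nonneg) ?_
    simpa [adj_one] using hx
  · intro b x y
    simp only [LinearMap.mk₂_apply]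
    -- Averaging over a⁻¹ instead of a makes left invariance of Haar measure the right one, because
    -- (ba)⁻¹ = a⁻¹b⁻¹.
    rw [← integral_mul_left_eq_self (fun a : G => inner ℝ (adj (d := d) a⁻¹ x) (adj a⁻¹ y)) b]
    simp only [mul_inv_rev, adj_mul, ContinuousLinearMap.comp_apply]

lemma adj_bracket (a : G) (v w : EuclideanSpace ℝ (Fin d)) :
    adj a (bracket G v w) = bracket G (adj a v) (adj a w) := Ad_bracket a v w

instance : FiniteDimensional ℝ (GroupLieAlgebra (𝓡 d) G) :=
  inferInstanceAs (FiniteDimensional ℝ (EuclideanSpace ℝ (Fin d)))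

/-- Differentiate at the identity the constant function p ↦ S(Ad(p⁻¹)x, Ad(p⁻¹)y). -/
lemma infinitesimal_invariance (S : LinearMap.BilinForm ℝ (EuclideanSpace ℝ (Fin d)))
    (hS : ∀ (b : G) x y, S (adj b⁻¹ x) (adj b⁻¹ y) = S x y) (z x y : EuclideanSpace ℝ (Fin d)) :
    S (bracket G z x) y = - S x (bracket G z y) := by
  let f : EuclideanSpace ℝ (Fin d) → EuclideanSpace ℝ (Fin d) → EuclideanSpace ℝ (Fin d) :=
    fun v p => fderiv ℝ (conjInvChart d G) (p, origin d G) (0, v)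
  have hd : ∀ v, DifferentiableAt ℝ (f v) (origin d G) := fun v =>
    (((ContDiffAt.differentiableAt_fderiv (contDiffAt_conjInvChart d G)).comp (origin d G)
      (f := fun p => (p, origin d G)) (by fun_prop)).clm_apply (differentiableAt_const _))
  have hf : ∀ v, fderiv ℝ (f v) (origin d G) z = - bracket G z v := by
    intro v
    have := hasFDerivAt_conjInvChart (G := G) (s := fun p => p) (V := fun _ => v)
      (x := origin d G) differentiableAt_id rfl (differentiableAt_const _) z
    simpa using this
  have hf0 : ∀ v, f v (origin d G) = v := fun v =>
    fderiv_snd_eq (contDiffAt_conjInvChart d G) (eventually_mem_target.mono fun y hy => by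
      simp [conjInvChart, (chartOne d G).right_inv hy]) v
  have hconst : (fun p => LinearMap.toContinuousBilinearMap S (f x p) (f y p))
      =ᶠ[𝓝 (origin d G)] fun _ => S x y := by
    filter_upwards [adj_inv_symm (G := G) x, adj_inv_symm (G := G) y] with p h1 h2
    simp only [f, ← h1, ← h2]
    exact hS _ x y
  have h := (LinearMap.toContinuousBilinearMap S).fderiv_of_bilinear (hd x) (hd y)
  rw [hconst.fderiv_eq] at h
  have h2 := congrArg (fun T : EuclideanSpace ℝ (Fin d) →L[ℝ] ℝ => T z) h
  simp [hf, hf0] at h2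
  linarith

/-- The Lie algebra of a compact semisimple Lie group is a Euclidean space for the Cartan-Killing
metric. -/
lemma exists_killingMetric_embedding [T2Space G] [CompactSpace G]
    [LieAlgebra.IsSemisimple ℝ (GroupLieAlgebra (𝓡 d) G)] :
    ∃ m : ℕ, ∃ ι : EuclideanSpace ℝ (Fin d) →L[ℝ] EuclideanSpace ℝ (Fin m), Function.Injective ι ∧
      (∀ x y, inner ℝ (ι x) (ι y) = killingMetric G x y) ∧
      ∀ x y, ‖ι (bracket G x y)‖ ≤ ‖ι x‖ * ‖ι y‖ := by
  obtain ⟨S, h1, h2, h3⟩ := exists_adj_invariant_form (d := d) (G := G)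
  have hcenter : ∀ x : GroupLieAlgebra (𝓡 d) G,
      (∀ y : GroupLieAlgebra (𝓡 d) G, ⁅x, y⁆ = 0) → x = 0 := by
    intro x hx
    have hmem : x ∈ LieAlgebra.center ℝ (GroupLieAlgebra (𝓡 d) G) := by
      rw [LieModule.mem_maxTrivSubmodule]
      intro y
      rw [← lie_skew, hx, neg_zero]
    -- The centre is contained in the radical, which is zero by semisimplicity.
    have hbot : LieAlgebra.center ℝ (GroupLieAlgebra (𝓡 d) G) = ⊥ :=
      le_bot_iff.1 ((LieAlgebra.center_le_radical ℝ _).trans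
        (LieAlgebra.HasTrivialRadical.radical_eq_bot).le)
    rwa [hbot, LieSubmodule.mem_bot] at hmem
  obtain ⟨m, ι, h4, h5⟩ := exists_killing_embedding (L := GroupLieAlgebra (𝓡 d) G) hcenter S h1 h2
    (infinitesimal_invariance S h3)
  let ι' : EuclideanSpace ℝ (Fin d) →ₗ[ℝ] EuclideanSpace ℝ (Fin m) := ι.toLinearMap
  exact ⟨m, LinearMap.toContinuousLinearMap ι', ι.injective, h4, h5⟩

/-- Ad a is an automorphism of the Lie algebra, with inverse Ad(a⁻¹), and the Killing form is
invariant under automorphisms. -/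
lemma killingMetric_adj (a : G) (x y : EuclideanSpace ℝ (Fin d)) :
    killingMetric G (adj a x) (adj a y) = killingMetric G x y := by
  have hinv : ∀ (a : G) (v : EuclideanSpace ℝ (Fin d)), adj a⁻¹ (adj a v) = v := by
    intro a v
    rw [← ContinuousLinearMap.comp_apply, ← adj_mul, inv_mul_cancel, adj_one]
    rfl
  let φ : GroupLieAlgebra (𝓡 d) G →ₗ[ℝ] GroupLieAlgebra (𝓡 d) G := (adj (d := d) a).toLinearMap
  let E : GroupLieAlgebra (𝓡 d) G ≃ₗ⁅ℝ⁆ GroupLieAlgebra (𝓡 d) G :=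
    { toLinearMap := φ
      map_lie' := fun {x y} => adj_bracket a x y
      invFun := fun v => adj (d := d) a⁻¹ v
      left_inv := fun v => hinv a v
      right_inv := fun v => by
        have := hinv a⁻¹ v
        rwa [inv_inv] at this }
  exact congrArg Neg.neg (LieAlgebra.killingForm_of_equiv_apply E x y)

variable (G) in
/-- The Lie bracket as a continuous bilinear map. -/
def bracketCLM : EuclideanSpace ℝ (Fin d) →L[ℝ] EuclideanSpace ℝ (Fin d) →L[ℝ]
    EuclideanSpace ℝ (Fin d) :=
  LinearMap.toContinuousBilinearMap (LinearMap.mk₂ ℝ (bracket G)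
    (fun x y z => add_lie (M := GroupLieAlgebra (𝓡 d) G) (L := GroupLieAlgebra (𝓡 d) G) x y z)
    (fun c x y => smul_lie (M := GroupLieAlgebra (𝓡 d) G) (R := ℝ) (L := GroupLieAlgebra (𝓡 d) G) c x y)
    (fun x y z => lie_add (M := GroupLieAlgebra (𝓡 d) G) (L := GroupLieAlgebra (𝓡 d) G) x y z)
    (fun c x y => lie_smul (M := GroupLieAlgebra (𝓡 d) G) (R := ℝ) (L := GroupLieAlgebra (𝓡 d) G) c x y))

lemma bracketCLM_apply (x y : EuclideanSpace ℝ (Fin d)) : bracketCLM G x y = bracket G x y := rfl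

lemma bracket_skew (x y : EuclideanSpace ℝ (Fin d)) : bracket G x y = - bracket G y x :=
  (lie_skew (L := GroupLieAlgebra (𝓡 d) G) x y).symm

lemma bracket_jacobi (x y z : EuclideanSpace ℝ (Fin d)) :
    bracket G x (bracket G y z) = bracket G (bracket G x y) z + bracket G y (bracket G x z) :=
  leibniz_lie (L₁ := GroupLieAlgebra (𝓡 d) G) (L₂ := GroupLieAlgebra (𝓡 d) G)
    (M := GroupLieAlgebra (𝓡 d) G) x y z

lemma killingMetric_bracket (x y z : EuclideanSpace ℝ (Fin d)) :
    killingMetric G (bracket G x y) z = - killingMetric G y (bracket G x z) := by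
  exact congrArg Neg.neg (LieModule.traceForm_apply_lie_apply' ℝ (GroupLieAlgebra (𝓡 d) G)
    (GroupLieAlgebra (𝓡 d) G) x y z)

end Adjoint

/-! ### Rules for partial derivatives. -/

section PartialDeriv

variable {n : ℕ} {V W X : Type*} [NormedAddCommGroup V] [NormedSpace ℝ V] [NormedAddCommGroup W]
  [NormedSpace ℝ W] [NormedAddCommGroup X] [NormedSpace ℝ X]
  {y : EuclideanSpace ℝ (Fin n)} {i : Fin n}

lemma partialDeriv_congr {f h : EuclideanSpace ℝ (Fin n) → V} (hfh : f =ᶠ[𝓝 y] h) :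
    partialDeriv i f y = partialDeriv i h y := by
  rw [partialDeriv, partialDeriv, hfh.fderiv_eq]

lemma partialDeriv_const (c : V) : partialDeriv i (fun _ => c) y = 0 := by
  simp [partialDeriv]

lemma partialDeriv_add {f h : EuclideanSpace ℝ (Fin n) → V} (hf : DifferentiableAt ℝ f y)
    (hh : DifferentiableAt ℝ h y) :
    partialDeriv i (fun z => f z + h z) y = partialDeriv i f y + partialDeriv i h y := by
  simp only [partialDeriv]
  rw [fderiv_fun_add hf hh]
  rfl

lemma partialDeriv_sub {f h : EuclideanSpace ℝ (Fin n) → V} (hf : DifferentiableAt ℝ f y)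
    (hh : DifferentiableAt ℝ h y) :
    partialDeriv i (fun z => f z - h z) y = partialDeriv i f y - partialDeriv i h y := by
  simp only [partialDeriv]
  rw [fderiv_fun_sub hf hh]
  rfl

lemma partialDeriv_neg {f : EuclideanSpace ℝ (Fin n) → V} :
    partialDeriv i (fun z => - f z) y = - partialDeriv i f y := by
  simp only [partialDeriv]
  rw [fderiv_fun_neg]
  rfl

lemma partialDeriv_sum {κ : Type*} {s : Finset κ} {f : κ → EuclideanSpace ℝ (Fin n) → V}
    (hf : ∀ k ∈ s, DifferentiableAt ℝ (f k) y) :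
    partialDeriv i (fun z => ∑ k ∈ s, f k z) y = ∑ k ∈ s, partialDeriv i (f k) y := by
  simp only [partialDeriv]
  rw [fderiv_fun_sum hf]
  simp

lemma partialDeriv_bilin (B : V →L[ℝ] W →L[ℝ] X) {f : EuclideanSpace ℝ (Fin n) → V}
    {h : EuclideanSpace ℝ (Fin n) → W} (hf : DifferentiableAt ℝ f y) (hh : DifferentiableAt ℝ h y) :
    partialDeriv i (fun z => B (f z) (h z)) y =
      B (partialDeriv i f y) (h y) + B (f y) (partialDeriv i h y) := by
  simp only [partialDeriv]
  rw [B.fderiv_of_bilinear hf hh]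
  simp [add_comm]

lemma partialDeriv_smul {c : EuclideanSpace ℝ (Fin n) → ℝ} {f : EuclideanSpace ℝ (Fin n) → V}
    (hc : DifferentiableAt ℝ c y) (hf : DifferentiableAt ℝ f y) :
    partialDeriv i (fun z => c z • f z) y = partialDeriv i c y • f y + c y • partialDeriv i f y := by
  simp only [partialDeriv]
  rw [fderiv_fun_smul hc hf]
  simp [add_comm]

lemma partialDeriv_mul {f h : EuclideanSpace ℝ (Fin n) → ℝ}
    (hf : DifferentiableAt ℝ f y) (hh : DifferentiableAt ℝ h y) :
    partialDeriv i (fun z => f z * h z) y =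
      partialDeriv i f y * h y + f y * partialDeriv i h y :=
  partialDeriv_smul hf hh

lemma partialDeriv_clm (L : V →L[ℝ] W) {f : EuclideanSpace ℝ (Fin n) → V}
    (hf : DifferentiableAt ℝ f y) :
    partialDeriv i (fun z => L (f z)) y = L (partialDeriv i f y) := by
  simp only [partialDeriv]
  have : fderiv ℝ (fun z => L (f z)) y = _ := fderiv_comp y L.differentiableAt hf
  rw [this, L.fderiv]
  rfl

lemma contDiffAt_partialDeriv {f : EuclideanSpace ℝ (Fin n) → V} (hf : ContDiffAt ℝ ∞ f y) :
    ContDiffAt ℝ ∞ (partialDeriv i f) y :=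
  (hf.fderiv_right (m := ∞) (by simp)).clm_apply contDiffAt_const

lemma partialDeriv_partialDeriv {f : EuclideanSpace ℝ (Fin n) → V} (hf : ContDiffAt ℝ ∞ f y)
    (j : Fin n) : partialDeriv i (partialDeriv j f) y =
      sndDeriv f y (EuclideanSpace.single i 1) (EuclideanSpace.single j 1) :=
  fderiv_fderiv_apply hf _ _

lemma partialDeriv_comm {f : EuclideanSpace ℝ (Fin n) → V} (hf : ContDiffAt ℝ ∞ f y)
    (j : Fin n) : partialDeriv i (partialDeriv j f) y = partialDeriv j (partialDeriv i f) y := by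
  rw [partialDeriv_partialDeriv hf, partialDeriv_partialDeriv hf, sndDeriv_symm hf]

lemma _root_.ContDiffAt.differentiableAt_infty {f : V → W} {x : V} (hf : ContDiffAt ℝ ∞ f x) :
    DifferentiableAt ℝ f x := hf.differentiableAt (by simp)

end PartialDeriv

/-! ### Transformation of the field strength under changes of chart and of trivialization. -/

section FieldStrength

variable {n d : ℕ} {ι : Type*} {M : Type*} [TopologicalSpace M]
    [ChartedSpace (EuclideanSpace ℝ (Fin n)) M] {G : Type*} [TopologicalSpace G]
    [ChartedSpace (EuclideanSpace ℝ (Fin d)) G] [Group G] [IsManifold (𝓡 n) ∞ M]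
  {e e' : OpenPartialHomeomorph M (EuclideanSpace ℝ (Fin n))}
  (he : e ∈ IsManifold.maximalAtlas (𝓡 n) ∞ M) (he' : e' ∈ IsManifold.maximalAtlas (𝓡 n) ∞ M)

include he he' in
lemma formCoeff_coordChange (θ : (x : M) → TangentSpace (𝓡 n) x →L[ℝ] GroupLieAlgebra (𝓡 d) G)
    {y} (hy : y ∈ overlap e' e) (j : Fin n) :
    formCoeff θ e' j y = ∑ i, jacobian e' e y i j • formCoeff θ e i (coordChange e' e y) := by
  let θ' : M → EuclideanSpace ℝ (Fin n) →L[ℝ] EuclideanSpace ℝ (Fin d) := fun x => θ x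
  have h : ∀ (e : OpenPartialHomeomorph M (EuclideanSpace ℝ (Fin n))) j y,
    formCoeff θ e j y = θ' (e.symm y) (dsymm e y (EuclideanSpace.single j 1)) := fun _ _ _ => rfl
  rw [h, dsymm_single he he' hy, map_sum, ← symm_coordChange _ _ hy]
  simp only [map_smul, h]

/-- The part of the target of the chart `e` that lies over the domain of a trivialization. -/
def chartDomain (P : PrincipalBundle n d ι M G) (i : ι)
    (e : OpenPartialHomeomorph M (EuclideanSpace ℝ (Fin n))) : Set (EuclideanSpace ℝ (Fin n)) :=
  e.target ∩ e.symm ⁻¹' P.baseSet i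

variable {P : PrincipalBundle n d ι M G} (A : Connection P)

lemma isOpen_chartDomain (i : ι) (e : OpenPartialHomeomorph M (EuclideanSpace ℝ (Fin n))) :
    IsOpen (chartDomain P i e) := e.isOpen_inter_preimage_symm (P.isOpen_baseSet i)

include he in
lemma contDiffAt_formCoeff {i : ι} {y} (hy : y ∈ chartDomain P i e) (μ : Fin n) :
    ContDiffAt ℝ ∞ (formCoeff (A.form i) e μ) y :=
  (A.contDiffOn_form i e he μ).contDiffAt ((isOpen_chartDomain i e).mem_nhds hy)

variable [LieGroup (𝓡 d) ∞ G]

lemma contDiffAt_bracket {E : Type*} [NormedAddCommGroup E] [NormedSpace ℝ E]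
    {f h : E → EuclideanSpace ℝ (Fin d)} {x : E}
    (hf : ContDiffAt ℝ ∞ f x) (hh : ContDiffAt ℝ ∞ h x) :
    ContDiffAt ℝ ∞ (fun z => bracket G (f z) (h z)) x :=
  ((bracketCLM G).contDiff.contDiffAt.comp x hf).clm_apply hh

include he in
lemma contDiffAt_fieldStrength {i : ι} {y} (hy : y ∈ chartDomain P i e) (μ l : Fin n) :
    ContDiffAt ℝ ∞ (A.fieldStrength i e μ l) y :=
  ((contDiffAt_partialDeriv (contDiffAt_formCoeff he A hy l)).sub
    (contDiffAt_partialDeriv (contDiffAt_formCoeff he A hy μ))).add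
    (contDiffAt_bracket (contDiffAt_formCoeff he A hy μ) (contDiffAt_formCoeff he A hy l))

lemma fieldStrength_skew (i : ι) (μ l : Fin n) (y : EuclideanSpace ℝ (Fin n)) :
    A.fieldStrength i e μ l y = - A.fieldStrength i e l μ y := by
  rw [Connection.fieldStrength, Connection.fieldStrength, bracket_skew]
  abel

include he he' in
-- The derivatives of the Jacobian are second derivatives of the coordinate change, symmetric in μ
-- and l, so they cancel in ∂_μ A_l − ∂_l A_μ.
lemma fieldStrength_coordChange {i : ι} {y} (hy : y ∈ overlap e' e) (hyi : e'.symm y ∈ P.baseSet i)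
    (μ l : Fin n) :
    A.fieldStrength i e' μ l y = ∑ a, ∑ b, (jacobian e' e y a μ * jacobian e' e y b l) •
      A.fieldStrength i e a b (coordChange e' e y) := by
  set τ := coordChange e' e with hτ
  have hτs : ContDiffAt ℝ ∞ τ y :=
    (contDiffOn_coordChange he he').contDiffAt ((isOpen_overlap e e').mem_nhds hy)
  have hτy : τ y ∈ chartDomain P i e := ⟨(coordChange_mem _ _ hy).1, by
    rw [mem_preimage, hτ, symm_coordChange _ _ hy]; exact hyi⟩
  set J := jacobian e' e with hJ
  have hJd : ∀ b l, ContDiffAt ℝ ∞ (fun z => J z b l) y := fun b l =>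
    (EuclideanSpace.proj b : EuclideanSpace ℝ (Fin n) →L[ℝ] ℝ).contDiff.contDiffAt.comp y
      (contDiffAt_partialDeriv (i := l) hτs)
  set a : Fin n → EuclideanSpace ℝ (Fin n) → EuclideanSpace ℝ (Fin d) := formCoeff (A.form i) e
  have ha : ∀ b, DifferentiableAt ℝ (a b) (τ y) := fun b =>
    (contDiffAt_formCoeff he A hτy b).differentiableAt_infty
  have hform : ∀ l, formCoeff (A.form i) e' l =ᶠ[𝓝 y] fun z => ∑ b, J z b l • a b (τ z) := by
    intro l
    filter_upwards [(isOpen_overlap e e').mem_nhds hy] with z hz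
    exact formCoeff_coordChange he he' _ hz l
  have hJsymm : ∀ b μ l, partialDeriv μ (fun z => J z b l) y = partialDeriv l (fun z => J z b μ) y := by
    intro b μ l
    have h1 := fun l => partialDeriv_clm (i := μ) (EuclideanSpace.proj b : EuclideanSpace ℝ (Fin n) →L[ℝ] ℝ)
      (contDiffAt_partialDeriv (i := l) hτs).differentiableAt_infty
    have h2 := partialDeriv_clm (i := l) (EuclideanSpace.proj b : EuclideanSpace ℝ (Fin n) →L[ℝ] ℝ)
      (contDiffAt_partialDeriv (i := μ) hτs).differentiableAt_infty
    rw [partialDeriv_comm hτs] at h2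
    exact (h1 l).trans h2.symm
  have hder : ∀ μ l, partialDeriv μ (formCoeff (A.form i) e' l) y =
      ∑ b, (partialDeriv μ (fun z => J z b l) y • a b (τ y) +
        ∑ c, (J y c μ * J y b l) • partialDeriv c (a b) (τ y)) := by
    intro μ l
    have hat : ∀ b, DifferentiableAt ℝ (fun z => a b (τ z)) y := fun b =>
      (ha b).comp y hτs.differentiableAt_infty
    rw [partialDeriv_congr (hform l), partialDeriv_sum (f := fun b z => J z b l • a b (τ z))
      fun b _ => (hJd b l).differentiableAt_infty.smul (hat b)]
    refine Finset.sum_congr rfl fun b _ => ?_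
    rw [partialDeriv_smul (hJd b l).differentiableAt_infty (hat b),
      partialDeriv_comp (ha b) hτs.differentiableAt_infty, Finset.smul_sum]
    congr 1
    refine Finset.sum_congr rfl fun c _ => ?_
    rw [smul_smul, mul_comm]
    rfl
  have hbr : bracket G (formCoeff (A.form i) e' μ y) (formCoeff (A.form i) e' l y) =
      ∑ c, ∑ b, (J y c μ * J y b l) • bracket G (a c (τ y)) (a b (τ y)) := by
    rw [(hform μ).eq_of_nhds, (hform l).eq_of_nhds]
    simp only [← bracketCLM_apply, map_sum, map_smul, _root_.sum_apply, _root_.smul_apply,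
      Finset.smul_sum, smul_smul]
    rw [Finset.sum_comm]
    exact Finset.sum_congr rfl fun c _ => Finset.sum_congr rfl fun b _ => by rw [mul_comm]
  rw [Connection.fieldStrength, hder, hder, hbr]
  simp only [Connection.fieldStrength, smul_add, smul_sub, Finset.sum_add_distrib,
    Finset.sum_sub_distrib]
  rw [Finset.sum_comm (f := fun b c => (J y c μ * J y b l) • partialDeriv c (a b) (τ y)),
    Finset.sum_congr rfl fun b _ => by rw [hJsymm b μ l]]
  have e1 : ∑ x, ∑ i, (J y i l * J y x μ) • partialDeriv i (a x) (τ y) =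
      ∑ x, ∑ x_1, (J y x μ * J y x_1 l) • partialDeriv x_1 (a x) (τ y) :=
    Finset.sum_congr rfl fun x _ => Finset.sum_congr rfl fun z _ => by rw [mul_comm]
  rw [e1]
  abel

/-- The function `t(x)⁻¹ t` takes the value 1 at `x`, so its derivative there may be computed in
`chartOne`, whose derivative at 1 is the identity. -/
lemma leftLogDeriv_eq {t : M → G} {y} (hy : y ∈ e.target) (he : e ∈ IsManifold.maximalAtlas (𝓡 n) ∞ M)
    (ht : MDifferentiableAt (𝓡 n) (𝓡 d) t (e.symm y)) (l : Fin n) :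
    (leftLogDeriv t (e.symm y) (coordVector e y l) : EuclideanSpace ℝ (Fin d)) =
      partialDeriv l (fun z => chartOne d G ((t (e.symm y))⁻¹ * t (e.symm z))) y := by
  have hm : MDifferentiableAt (𝓡 n) (𝓡 d) (fun z => (t (e.symm y))⁻¹ * t z) (e.symm y) :=
    ((contMDiff_mul_left (n := ∞)).contMDiffAt.mdifferentiableAt (by simp)).comp (e.symm y) ht
  have := modelDeriv_dsymm he (chartOne_mem d G) hy (by simpa using one_mem_source) hm
    (EuclideanSpace.single l 1)
  rw [inv_mul_cancel, ← origin, dsymm_origin] at this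
  exact this

include he in
/-- The field strengths in two trivializations are related by the adjoint representation. -/
lemma fieldStrength_gauge {i j : ι} {y} (hyi : y ∈ chartDomain P i e) (hyj : y ∈ chartDomain P j e)
    (μ l : Fin n) :
    A.fieldStrength j e μ l y =
      adj (P.t i j (e.symm y))⁻¹ (A.fieldStrength i e μ l y) := by
  set a := P.t i j (e.symm y) with ha
  -- The transition function is a·σ with σ = 1 at the given point; `s` is σ in the chart at the
  -- identity. The constant `a` contributes only Ad(a⁻¹), and all derivatives are taken at the
  -- origin.
  let s : EuclideanSpace ℝ (Fin n) → EuclideanSpace ℝ (Fin d) :=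
    fun z => chartOne d G (a⁻¹ * P.t i j (e.symm z))
  have hU : IsOpen (chartDomain P i e ∩ chartDomain P j e) :=
    (isOpen_chartDomain i e).inter (isOpen_chartDomain j e)
  have htU : ∀ z ∈ chartDomain P i e ∩ chartDomain P j e,
      ContMDiffAt 𝓘(ℝ, EuclideanSpace ℝ (Fin n)) (𝓡 d) ∞ (fun z => P.t i j (e.symm z)) z := by
    intro z hz
    exact (((P.contMDiffOn_t i j).contMDiffAt (((P.isOpen_baseSet i).inter
      (P.isOpen_baseSet j)).mem_nhds ⟨hz.1.2, hz.2.2⟩))).comp z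
      (contMDiffAt_symm_of_mem_maximalAtlas he hz.1.1)
  have hg : ContMDiffAt 𝓘(ℝ, EuclideanSpace ℝ (Fin n)) (𝓡 d) ∞
      (fun z => a⁻¹ * P.t i j (e.symm z)) y := contMDiffAt_const.mul (htU y ⟨hyi, hyj⟩)
  have hs : ContDiffAt ℝ ∞ s y := contDiffAt_chartOne_comp hg (by simp [ha])
  have hsy : s y = origin d G := by simp [s, ha, origin]
  have hsrc : ∀ᶠ z in 𝓝 y, a⁻¹ * P.t i j (e.symm z) ∈ (chartOne d G).source :=
    eventually_comp_mem_source (d := d) hg.continuousAt (by simp [ha])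
  have hsymm : ∀ {z}, a⁻¹ * P.t i j (e.symm z) ∈ (chartOne d G).source →
      (chartOne d G).symm (s z) = a⁻¹ * P.t i j (e.symm z) := fun h => (chartOne d G).left_inv h
  have hpair : ContinuousAt (fun z => (s z, s z)) y := hs.continuousAt.prodMk hs.continuousAt
  have hldiv := contDiffAt_ldivChart d G
  have hsd := eventually_contDiffAt hs
  -- the logarithmic derivative of the transition function
  have hlog : ∀ l, ∀ᶠ z in 𝓝 y, (leftLogDeriv (P.t i j) (e.symm z) (coordVector e z l) :
      EuclideanSpace ℝ (Fin d)) = fderiv ℝ (ldivChart d G) (s z, s z) (0, partialDeriv l s z) := by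
    intro l
    have hp2 : ContinuousAt (fun z => (s z, s z)) y := hpair
    have h1 := eventually_contDiffAt hldiv
    rw [← hsy] at h1
    filter_upwards [hp2.eventually h1, hsrc.eventually_nhds, hsd, hU.mem_nhds ⟨hyi, hyj⟩]
      with z hz1 hz2 hz3 hz4
    rw [leftLogDeriv_eq hz4.1.1 he (((P.contMDiffOn_t i j).contMDiffAt
      (((P.isOpen_baseSet i).inter (P.isOpen_baseSet j)).mem_nhds
        ⟨hz4.1.2, hz4.2.2⟩)).mdifferentiableAt (by simp))]
    have h3 : (fun w => chartOne d G ((P.t i j (e.symm z))⁻¹ * P.t i j (e.symm w))) =ᶠ[𝓝 z]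
        fun w => ldivChart d G (s z, s w) := by
      filter_upwards [hz2] with w hw
      simp only [ldivChart]
      rw [hsymm hz2.self_of_nhds, hsymm hw]
      congr 1
      group
    rw [partialDeriv_congr h3]
    have h4 : fderiv ℝ (fun w => ldivChart d G (s z, s w)) z =
        ((fderiv ℝ (ldivChart d G) (s z, s z)).comp
          ((0 : EuclideanSpace ℝ (Fin n) →L[ℝ] EuclideanSpace ℝ (Fin d)).prod (fderiv ℝ s z))) :=
      (HasFDerivAt.comp (g := ldivChart d G) z hz1.hasFDerivAt
        ((hasFDerivAt_const (s z) z).prodMk hz3.hasFDerivAt)).fderiv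
    rw [partialDeriv, h4]
    rfl
  set b : Fin n → EuclideanSpace ℝ (Fin n) → EuclideanSpace ℝ (Fin d) :=
    fun l z => adj a⁻¹ (formCoeff (A.form i) e l z) with hb
  have hbd : ∀ l, DifferentiableAt ℝ (b l) y := fun l =>
    ((adj (d := d) a⁻¹).differentiableAt.comp y
      (contDiffAt_formCoeff he A hyi l).differentiableAt_infty)
  -- Near `y` the new connection form is Ad(σ⁻¹)b + σ⁻¹dσ, where b = Ad(a⁻¹)A is the old form
  -- rotated by a constant.
  have hform : ∀ l, formCoeff (A.form j) e l =ᶠ[𝓝 y] fun z =>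
      fderiv ℝ (conjInvChart d G) (s z, origin d G) (0, b l z) +
        fderiv ℝ (ldivChart d G) (s z, s z) (0, partialDeriv l s z) := by
    intro l
    have hc : ContinuousAt (fun z => (s z, origin d G)) y := hs.continuousAt.prodMk continuousAt_const
    have h1 := eventually_contDiffAt (contDiffAt_conjInvChart d G)
    have h2 : ∀ᶠ z in 𝓝 y, DifferentiableAt ℝ (conjInvChart d G) (s z, origin d G) := by
      refine hc.eventually ?_
      simpa only [hsy] using h1
    filter_upwards [hlog l, hU.mem_nhds ⟨hyi, hyj⟩, hsrc, h2] with z hz1 hz2 hz3 hz4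
    have h3 := A.form_transform i j (e.symm z) ⟨hz2.1.2, hz2.2.2⟩ (coordVector e z l)
    have h4 : formCoeff (A.form j) e l z = adj (P.t i j (e.symm z))⁻¹ (formCoeff (A.form i) e l z) +
        (id (leftLogDeriv (P.t i j) (e.symm z) (coordVector e z l)) : EuclideanSpace ℝ (Fin d)) := h3
    rw [h4]
    refine congrArg₂ (· + ·) ?_ hz1
    have h5 : (P.t i j (e.symm z))⁻¹ = ((chartOne d G).symm (s z))⁻¹ * a⁻¹ := by
      rw [hsymm hz3]; group
    rw [h5, adj_mul, ContinuousLinearMap.comp_apply, adj_eq, ← fderiv_pair_right hz4]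
    congr 2
    ext1 h
    simp [conjChart, conjInvChart]
  -- derivative of the logarithmic derivative
  have hlogd : ∀ l μ, partialDeriv μ (fun z =>
        fderiv ℝ (ldivChart d G) (s z, s z) (0, partialDeriv l s z)) y =
      partialDeriv μ (partialDeriv l s) y - mulMixed G (partialDeriv μ s y) (partialDeriv l s y) := by
    intro l μ
    have hps : HasFDerivAt (fun z => (s z, s z)) ((fderiv ℝ s y).prod (fderiv ℝ s y)) y :=
      hs.differentiableAt_infty.hasFDerivAt.prodMk hs.differentiableAt_infty.hasFDerivAt
    have h1 : HasFDerivAt (fun z => fderiv ℝ (ldivChart d G) (s z, s z))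
        ((fderiv ℝ (fderiv ℝ (ldivChart d G)) (s y, s y)).comp
          ((fderiv ℝ s y).prod (fderiv ℝ s y))) y := by
      refine HasFDerivAt.comp (g := fderiv ℝ (ldivChart d G)) y ?_ hps
      rw [hsy]
      exact (ContDiffAt.differentiableAt_fderiv hldiv).hasFDerivAt
    have h2 : HasFDerivAt (fun z => ((0 : EuclideanSpace ℝ (Fin d)), partialDeriv l s z))
        ((0 : EuclideanSpace ℝ (Fin n) →L[ℝ] EuclideanSpace ℝ (Fin d)).prod
          (fderiv ℝ (partialDeriv l s) y)) y :=
      (hasFDerivAt_const 0 y).prodMk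
        (contDiffAt_partialDeriv hs).differentiableAt_infty.hasFDerivAt
    rw [partialDeriv, (h1.clm_apply h2).fderiv, hsy]
    simp only [_root_.add_apply, ContinuousLinearMap.comp_apply, ContinuousLinearMap.prod_apply,
      ContinuousLinearMap.flip_apply, _root_.zero_apply]
    have h4 := fderiv_snd_eq hldiv (eventually_mem_target.mono fun y hy =>
      ldivChart_origin_left hy) (partialDeriv μ (partialDeriv l s) y)
    -- Both arguments move with `s`, but the second derivative purely in the second argument is
    -- zero, because left division by 1 is the identity; only the mixed part remains.
    have h5 : sndDeriv (ldivChart d G) (origin d G, origin d G)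
        (partialDeriv μ s y, partialDeriv μ s y) (0, partialDeriv l s y) =
        - mulMixed G (partialDeriv μ s y) (partialDeriv l s y) := by
      have h6 : ∀ v w, sndDeriv (ldivChart d G) (origin d G, origin d G) (0, v) (0, w) = 0 := by
        intro v w
        rw [← sndDeriv_pair_right hldiv, ← sndDeriv_id (origin d G) v w]
        refine sndDeriv_congr ?_ v w
        filter_upwards [eventually_mem_target] with z hz using ldivChart_origin_left hz
      have h7 : ∀ v : EuclideanSpace ℝ (Fin d), (v, v) = (v, 0) + ((0 : EuclideanSpace ℝ (Fin d)), v) := by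
        intro v; simp
      rw [h7 (partialDeriv μ s y), sndDeriv_add_left, sndDeriv_ldivChart, h6, add_zero]
    exact (congrArg₂ (· + ·) h4 h5).trans (sub_eq_add_neg _ _).symm |> fun h => by
      rw [← h]; rfl
  have hconjd : ∀ l μ, partialDeriv μ (fun z =>
      fderiv ℝ (conjInvChart d G) (s z, origin d G) (0, b l z)) y =
      partialDeriv μ (b l) y - bracket G (partialDeriv μ s y) (b l y) := fun l μ =>
    hasFDerivAt_conjInvChart hs.differentiableAt_infty hsy (hbd l) _
  have hdiff1 : ∀ l, DifferentiableAt ℝ (fun z =>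
      fderiv ℝ (conjInvChart d G) (s z, origin d G) (0, b l z)) y := by
    intro l
    have h1 : DifferentiableAt ℝ (fun z => fderiv ℝ (conjInvChart d G) (s z, origin d G)) y := by
      refine DifferentiableAt.comp (g := fderiv ℝ (conjInvChart d G)) y ?_
        (hs.differentiableAt_infty.prodMk (differentiableAt_const _))
      rw [hsy]; exact ContDiffAt.differentiableAt_fderiv (contDiffAt_conjInvChart d G)
    exact h1.clm_apply ((differentiableAt_const _).prodMk (hbd l))
  have hdiff2 : ∀ l, DifferentiableAt ℝ (fun z =>
      fderiv ℝ (ldivChart d G) (s z, s z) (0, partialDeriv l s z)) y := by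
    intro l
    have h1 : DifferentiableAt ℝ (fun z => fderiv ℝ (ldivChart d G) (s z, s z)) y := by
      refine DifferentiableAt.comp (g := fderiv ℝ (ldivChart d G)) y ?_
        (hs.differentiableAt_infty.prodMk hs.differentiableAt_infty)
      rw [hsy]; exact ContDiffAt.differentiableAt_fderiv hldiv
    exact h1.clm_apply ((differentiableAt_const _).prodMk
      (contDiffAt_partialDeriv hs).differentiableAt_infty)
  have hval : ∀ l, formCoeff (A.form j) e l y = b l y + partialDeriv l s y := by
    intro l
    rw [(hform l).eq_of_nhds, hsy]
    rw [fderiv_snd_eq hldiv (eventually_mem_target.mono fun y hy => ldivChart_origin_left hy),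
      fderiv_snd_eq (contDiffAt_conjInvChart d G) (eventually_mem_target.mono fun y hy => by
        simp [conjInvChart, (chartOne d G).right_inv hy])]
  have hder : ∀ l μ, partialDeriv μ (formCoeff (A.form j) e l) y =
      partialDeriv μ (b l) y - bracket G (partialDeriv μ s y) (b l y) +
      (partialDeriv μ (partialDeriv l s) y - mulMixed G (partialDeriv μ s y) (partialDeriv l s y)) := by
    intro l μ
    rw [partialDeriv_congr (hform l), partialDeriv_add (hdiff1 l) (hdiff2 l), hconjd, hlogd]
  have hbp : ∀ l μ, partialDeriv μ (b l) y = adj a⁻¹ (partialDeriv μ (formCoeff (A.form i) e l) y) :=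
    fun l μ => partialDeriv_clm _ (contDiffAt_formCoeff he A hyi l).differentiableAt_infty
  -- On antisymmetrizing, ∂_μ∂_l s cancels and the mixed terms combine to −[∂_μ s, ∂_l s]. This and
  -- the terms −[∂s, b] cancel against the expansion of [b + ∂s, b + ∂s], leaving the field strength
  -- of b.
  rw [Connection.fieldStrength, Connection.fieldStrength, hder, hder, hval, hval, map_add, map_sub,
    adj_bracket, hbp, hbp, partialDeriv_comm hs l]
  simp only [← bracketCLM_apply, map_add, _root_.add_apply]
  simp only [bracketCLM_apply]
  change _ = _ - _ + bracket G (b μ y) (b l y)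
  rw [bracket_skew (b μ y) (partialDeriv l s y), bracket_eq (partialDeriv μ s y) (partialDeriv l s y)]
  abel

end FieldStrength

/-- Contracting one pair of transformed indices with G' moves both Jacobians onto G', where
`invMetric_coordChange` absorbs them. -/
lemma sum_contract {n : ℕ} (J G' : Matrix (Fin n) (Fin n) ℝ) (Q : Fin n → Fin n → ℝ) :
    ∑ μ, ∑ α, G' μ α * ∑ a, ∑ c, J a μ * J c α * Q a c =
      ∑ a, ∑ c, (J * G' * J.transpose) a c * Q a c := by
  simp only [Matrix.mul_apply, Matrix.transpose_apply, Finset.mul_sum, Finset.sum_mul]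
  have h1 : ∀ μ, ∑ α, ∑ a, ∑ c, G' μ α * (J a μ * J c α * Q a c) =
      ∑ a, ∑ c, ∑ α, G' μ α * (J a μ * J c α * Q a c) := fun μ => by
    rw [Finset.sum_comm]
    exact Finset.sum_congr rfl fun a _ => Finset.sum_comm
  simp only [h1]
  rw [Finset.sum_comm]
  refine Finset.sum_congr rfl fun a _ => ?_
  rw [Finset.sum_comm]
  refine Finset.sum_congr rfl fun c _ => ?_
  rw [Finset.sum_comm]
  exact Finset.sum_congr rfl fun α _ => Finset.sum_congr rfl fun μ _ => by ring

/-! ### Invariance and smoothness of the energy density. -/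

section Energy

variable {n d : ℕ} {ι : Type*} {M : Type*} [TopologicalSpace M]
    [ChartedSpace (EuclideanSpace ℝ (Fin n)) M] {G : Type*} [TopologicalSpace G]
    [ChartedSpace (EuclideanSpace ℝ (Fin d)) G] [Group G] [IsManifold (𝓡 n) ∞ M]
    [LieGroup (𝓡 d) ∞ G]
  {e e' : OpenPartialHomeomorph M (EuclideanSpace ℝ (Fin n))}
  (he : e ∈ IsManifold.maximalAtlas (𝓡 n) ∞ M) (he' : e' ∈ IsManifold.maximalAtlas (𝓡 n) ∞ M)
  {P : PrincipalBundle n d ι M G} (A : Connection P) (g : RMetric n M)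

variable (G) in
/-- The Cartan-Killing metric as a continuous bilinear map. -/
def killingCLM : EuclideanSpace ℝ (Fin d) →L[ℝ] EuclideanSpace ℝ (Fin d) →L[ℝ] ℝ :=
  LinearMap.toContinuousBilinearMap (E := EuclideanSpace ℝ (Fin d)) (F := EuclideanSpace ℝ (Fin d))
    (-killingForm ℝ (GroupLieAlgebra (𝓡 d) G) :
      LinearMap.BilinForm ℝ (GroupLieAlgebra (𝓡 d) G))

lemma killingCLM_apply (x y : EuclideanSpace ℝ (Fin d)) :
    killingCLM G x y = killingMetric G x y := rfl

/-- The energy density in the `i`-th trivialization and the chart `e`. -/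
def energyIn (i : ι) (e : OpenPartialHomeomorph M (EuclideanSpace ℝ (Fin n)))
    (y : EuclideanSpace ℝ (Fin n)) : ℝ :=
  ∑ μ, ∑ l, ∑ α, ∑ β, invMetric g e y μ α * invMetric g e y l β *
    killingMetric G (A.fieldStrength i e μ l y) (A.fieldStrength i e α β y)

lemma energyDensity_eq (x : M) : A.energyDensity g x =
    energyIn A g (P.indexAt x) (chartAt (EuclideanSpace ℝ (Fin n)) x)
      (chartAt (EuclideanSpace ℝ (Fin n)) x x) := rfl

include he in
lemma energyIn_gauge {i j : ι} {y} (hyi : y ∈ chartDomain P i e) (hyj : y ∈ chartDomain P j e) :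
    energyIn A g j e y = energyIn A g i e y := by
  simp only [energyIn, fieldStrength_gauge he A hyi hyj, killingMetric_adj]

include he he' in
-- The two field strengths bring four Jacobians; each inverse metric absorbs two of them, so
-- `sum_contract` is used once per index pair.
lemma energyIn_coordChange {i : ι} {y} (hy : y ∈ overlap e' e) (hyi : e'.symm y ∈ P.baseSet i) :
    energyIn A g i e' y = energyIn A g i e (coordChange e' e y) := by
  set J := jacobian e' e y with hJ
  set F := fun a b => A.fieldStrength i e a b (coordChange e' e y) with hF
  have hP : ∀ μ l α β, killingMetric G (A.fieldStrength i e' μ l y) (A.fieldStrength i e' α β y) =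
      ∑ b, ∑ f, J b l * J f β * ∑ a, ∑ c, J a μ * J c α *
        killingMetric G (F a b) (F c f) := by
    intro μ l α β
    rw [fieldStrength_coordChange he he' A hy hyi, fieldStrength_coordChange he he' A hy hyi]
    simp only [← killingCLM_apply, map_sum, map_smul, _root_.sum_apply, _root_.smul_apply,
      smul_eq_mul, Finset.mul_sum]
    rw [Finset.sum_congr rfl fun c _ => Finset.sum_congr rfl fun f _ => Finset.sum_comm,
      Finset.sum_congr rfl fun c _ => Finset.sum_comm, Finset.sum_comm,
      Finset.sum_congr rfl fun b _ => Finset.sum_comm]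
    refine Finset.sum_congr rfl fun b _ => Finset.sum_congr rfl fun f _ => ?_
    rw [Finset.sum_comm]
    exact Finset.sum_congr rfl fun a _ => Finset.sum_congr rfl fun c _ => by
      simp only [hF, hJ]; ring
  -- Regroup the fourfold sum into two nested contractions, one for each inverse metric.
  have hre : ∀ (H : Matrix (Fin n) (Fin n) ℝ) (Q : Fin n → Fin n → Fin n → Fin n → ℝ),
      ∑ μ, ∑ l, ∑ α, ∑ β, H μ α * H l β * Q μ l α β =
      ∑ μ, ∑ α, H μ α * ∑ l, ∑ β, H l β * Q μ l α β := by
    intro H Q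
    refine Finset.sum_congr rfl fun μ _ => ?_
    rw [Finset.sum_comm]
    simp only [Finset.mul_sum, mul_assoc]
  rw [energyIn, energyIn, hre, hre]
  simp only [hP, sum_contract, ← hJ]
  have hG := invMetric_coordChange he he' g hy
  rw [← hJ] at hG
  rw [hG]
  have h2 : ∀ μ α, ∑ b, ∑ f, invMetric g e (coordChange e' e y) b f * ∑ a, ∑ c, J a μ * J c α *
      killingMetric G (F a b) (F c f) = ∑ a, ∑ c, J a μ * J c α *
      ∑ b, ∑ f, invMetric g e (coordChange e' e y) b f * killingMetric G (F a b) (F c f) := by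
    intro μ α
    simp only [Finset.mul_sum]
    rw [Finset.sum_congr rfl fun c _ => Finset.sum_comm, Finset.sum_comm]
    refine Finset.sum_congr rfl fun a _ => ?_
    rw [Finset.sum_congr rfl fun c _ => Finset.sum_comm, Finset.sum_comm]
    exact Finset.sum_congr rfl fun c _ => Finset.sum_congr rfl fun b _ =>
      Finset.sum_congr rfl fun f _ => by ring
  simp only [h2, sum_contract, hG]
  rfl

include he in
/-- The energy density does not depend on the chart and the trivialization. -/
lemma energyDensity_symm {i : ι} {y} (hy : y ∈ chartDomain P i e) :
    A.energyDensity g (e.symm y) = energyIn A g i e y := by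
  set x := e.symm y with hx
  set e₀ := chartAt (EuclideanSpace ℝ (Fin n)) x with he₀
  have he₀' : e₀ ∈ IsManifold.maximalAtlas (𝓡 n) ∞ M := IsManifold.chart_mem_maximalAtlas _
  have hx0 : e₀.symm (e₀ x) = x := e₀.left_inv (mem_chart_source _ x)
  have hi : x ∈ P.baseSet i := hy.2
  have h1 : e₀ x ∈ chartDomain P (P.indexAt x) e₀ :=
    ⟨mem_chart_target _ x, by rw [mem_preimage, hx0]; exact P.mem_baseSet_at x⟩
  have h2 : e₀ x ∈ chartDomain P i e₀ := ⟨mem_chart_target _ x, by rwa [mem_preimage, hx0]⟩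
  have hov : e₀ x ∈ overlap e₀ e := ⟨mem_chart_target _ x, by
    rw [mem_preimage, hx0]; exact e.map_target hy.1⟩
  rw [energyDensity_eq, ← he₀, energyIn_gauge he₀' A g h2 h1,
    energyIn_coordChange he he₀' A g hov h2.2, coordChange, hx0, hx, e.right_inv hy.1]

include he in
lemma contDiffAt_energyIn {i : ι} {y} (hy : y ∈ chartDomain P i e) :
    ContDiffAt ℝ ∞ (energyIn A g i e) y := by
  have hinv : ∀ a b, ContDiffAt ℝ ∞ (fun z => invMetric g e z a b) y := fun a b =>
    (contDiffOn_invMetric he g a b).contDiffAt (e.open_target.mem_nhds hy.1)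
  refine ContDiffAt.sum fun μ _ => ContDiffAt.sum fun l _ => ContDiffAt.sum fun α _ =>
    ContDiffAt.sum fun β _ => ((hinv μ α).mul (hinv l β)).mul ?_
  exact ((killingCLM G).contDiff.contDiffAt.comp y (contDiffAt_fieldStrength he A hy μ l)).clm_apply
    (contDiffAt_fieldStrength he A hy α β)

/-- The density is defined with a chart and a trivialization that vary with the point. By
`energyDensity_symm` they can be kept fixed near `x`, and the fixed expression is smooth. -/
lemma contMDiff_energyDensity : ContMDiff (𝓡 n) 𝓘(ℝ, ℝ) ∞ (A.energyDensity g) := by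
  intro x
  set e := chartAt (EuclideanSpace ℝ (Fin n)) x with he₀
  have he : e ∈ IsManifold.maximalAtlas (𝓡 n) ∞ M := IsManifold.chart_mem_maximalAtlas _
  have hx : x ∈ e.source := mem_chart_source _ x
  have hy : e x ∈ chartDomain P (P.indexAt x) e := ⟨mem_chart_target _ x, by
    rw [mem_preimage, e.left_inv hx]; exact P.mem_baseSet_at x⟩
  have h1 : ContMDiffAt (𝓡 n) 𝓘(ℝ, ℝ) ∞ (energyIn A g (P.indexAt x) e ∘ e) x :=
    (contDiffAt_energyIn he A g hy).contMDiffAt.comp x (contMDiffAt_of_mem_maximalAtlas he hx)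
  refine h1.congr_of_eventuallyEq ?_
  filter_upwards [e.open_source.mem_nhds hx, (P.isOpen_baseSet (P.indexAt x)).mem_nhds
    (P.mem_baseSet_at x)] with z hz hz'
  rw [Function.comp, ← energyDensity_symm he A g ⟨e.map_source hz, by
    rwa [mem_preimage, e.left_inv hz]⟩, e.left_inv hz]

end Energy

/-! ### The metric and the curvature at the centre of a first-order normal chart. -/

section Normal

variable {n : ℕ}

lemma partialDeriv_partialDeriv_mul {f h : EuclideanSpace ℝ (Fin n) → ℝ} {y}
    (hf : ContDiffAt ℝ ∞ f y) (hh : ContDiffAt ℝ ∞ h y) (i j : Fin n) :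
    partialDeriv i (partialDeriv j fun z => f z * h z) y =
      partialDeriv i (partialDeriv j f) y * h y + partialDeriv j f y * partialDeriv i h y +
      (partialDeriv i f y * partialDeriv j h y + f y * partialDeriv i (partialDeriv j h) y) := by
  have h1 : partialDeriv j (fun z => f z * h z) =ᶠ[𝓝 y]
      fun z => partialDeriv j f z * h z + f z * partialDeriv j h z := by
    filter_upwards [eventually_contDiffAt hf, eventually_contDiffAt hh] with z hz hz'
    exact partialDeriv_mul hz hz'
  have hf1 := hf.differentiableAt_infty
  have hh1 := hh.differentiableAt_infty
  have hf2 := (contDiffAt_partialDeriv (i := j) hf).differentiableAt_infty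
  have hh2 := (contDiffAt_partialDeriv (i := j) hh).differentiableAt_infty
  rw [partialDeriv_congr h1, partialDeriv_add (hf2.fun_mul hh1) (hf1.fun_mul hh2),
    partialDeriv_mul hf2 hh1, partialDeriv_mul hf1 hh2]

lemma partialDeriv_partialDeriv_sum {κ : Type*} {s : Finset κ}
    {f : κ → EuclideanSpace ℝ (Fin n) → ℝ} {y}
    (hf : ∀ k ∈ s, ContDiffAt ℝ ∞ (f k) y) (i j : Fin n) :
    partialDeriv i (partialDeriv j fun z => ∑ k ∈ s, f k z) y =
      ∑ k ∈ s, partialDeriv i (partialDeriv j (f k)) y := by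
  have h1 : partialDeriv j (fun z => ∑ k ∈ s, f k z) =ᶠ[𝓝 y]
      fun z => ∑ k ∈ s, partialDeriv j (f k) z := by
    filter_upwards [(Filter.eventually_all_finset s).2 fun k hk => eventually_contDiffAt (hf k hk)]
      with z hz
    exact partialDeriv_sum hz
  rw [partialDeriv_congr h1, partialDeriv_sum fun k hk =>
    (contDiffAt_partialDeriv (hf k hk)).differentiableAt_infty]

variable {M : Type*} [TopologicalSpace M]
    [ChartedSpace (EuclideanSpace ℝ (Fin n)) M] [IsManifold (𝓡 n) ∞ M]

/-- The chart `e` is normal to first order at the point with coordinates `y`. -/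
structure IsNormalAt (g : RMetric n M) (e : OpenPartialHomeomorph M (EuclideanSpace ℝ (Fin n)))
    (y : EuclideanSpace ℝ (Fin n)) : Prop where
  mem_atlas : e ∈ IsManifold.maximalAtlas (𝓡 n) ∞ M
  mem_target : y ∈ e.target
  metric_eq : metricCoeff g e y = 1
  deriv_eq : ∀ i j k, partialDeriv k (fun z => metricCoeff g e z i j) y = 0

variable {g : RMetric n M} {e : OpenPartialHomeomorph M (EuclideanSpace ℝ (Fin n))}
  {y : EuclideanSpace ℝ (Fin n)}

/-- The second derivatives of the metric. -/
def metricSnd (g : RMetric n M) (e : OpenPartialHomeomorph M (EuclideanSpace ℝ (Fin n)))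
    (y : EuclideanSpace ℝ (Fin n)) (a b c d : Fin n) : ℝ :=
  partialDeriv c (partialDeriv d (fun z => metricCoeff g e z a b)) y

lemma contDiffAt_metricCoeff (he : e ∈ IsManifold.maximalAtlas (𝓡 n) ∞ M) (hy : y ∈ e.target)
    (a b : Fin n) : ContDiffAt ℝ ∞ (fun z => metricCoeff g e z a b) y :=
  (contMDiffOn_inner_coordVector he g a b).contDiffAt (e.open_target.mem_nhds hy)

lemma contDiffAt_invMetric (he : e ∈ IsManifold.maximalAtlas (𝓡 n) ∞ M) (hy : y ∈ e.target)
    (a b : Fin n) : ContDiffAt ℝ ∞ (fun z => invMetric g e z a b) y :=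
  (contDiffOn_invMetric he g a b).contDiffAt (e.open_target.mem_nhds hy)

lemma metricCoeff_comm (a b : Fin n) (z) : metricCoeff g e z a b = metricCoeff g e z b a :=
  congrFun (congrFun (metricCoeff_transpose g e z) b) a

lemma metricSnd_comm_left (a b c d : Fin n) : metricSnd g e y a b c d = metricSnd g e y b a c d := by
  simp only [metricSnd, metricCoeff_comm a b]

lemma metricSnd_comm_right (he : e ∈ IsManifold.maximalAtlas (𝓡 n) ∞ M) (hy : y ∈ e.target)
    (a b c d : Fin n) : metricSnd g e y a b c d = metricSnd g e y a b d c :=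
  partialDeriv_comm (contDiffAt_metricCoeff he hy a b) d

lemma invMetric_mul_metricCoeff (he : e ∈ IsManifold.maximalAtlas (𝓡 n) ∞ M) (hy : y ∈ e.target) :
    invMetric g e y * metricCoeff g e y = 1 :=
  Matrix.nonsing_inv_mul _ (metricCoeff_det_pos he g hy).ne'.isUnit

lemma sum_invMetric_mul_metricCoeff (he : e ∈ IsManifold.maximalAtlas (𝓡 n) ∞ M)
    (hy : y ∈ e.target) (a b : Fin n) :
    (fun z => ∑ c, invMetric g e z a c * metricCoeff g e z c b) =ᶠ[𝓝 y]
      fun _ => (1 : Matrix (Fin n) (Fin n) ℝ) a b := by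
  filter_upwards [e.open_target.mem_nhds hy] with z hz
  rw [← invMetric_mul_metricCoeff (g := g) he hz, Matrix.mul_apply]

lemma sum_one_mul (f : Fin n → ℝ) (a : Fin n) :
    ∑ b, (1 : Matrix (Fin n) (Fin n) ℝ) a b * f b = f a := by
  simp [Matrix.one_apply]

lemma sum_mul_one (f : Fin n → ℝ) (a : Fin n) :
    ∑ b, f b * (1 : Matrix (Fin n) (Fin n) ℝ) b a = f a := by
  simp [Matrix.one_apply]

namespace IsNormalAt

variable (h : IsNormalAt g e y)
include h

lemma invMetric_eq : invMetric g e y = 1 := by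
  rw [invMetric, h.metric_eq, inv_one]

lemma deriv_invMetric (k a b : Fin n) : partialDeriv k (fun z => invMetric g e z a b) y = 0 := by
  have h1 := partialDeriv_congr (i := k) (sum_invMetric_mul_metricCoeff (g := g) h.mem_atlas
    h.mem_target a b)
  have hg := fun a b => contDiffAt_metricCoeff (g := g) h.mem_atlas h.mem_target a b
  have hi := fun a b => contDiffAt_invMetric (g := g) h.mem_atlas h.mem_target a b
  rw [partialDeriv_const, partialDeriv_sum
    (f := fun c z => invMetric g e z a c * metricCoeff g e z c b) fun c _ =>
    ((hi a c).mul (hg c b)).differentiableAt_infty] at h1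
  simp only [partialDeriv_mul (hi _ _).differentiableAt_infty (hg _ _).differentiableAt_infty,
    h.deriv_eq, h.metric_eq, mul_zero, add_zero, sum_mul_one] at h1
  exact h1

/-- Differentiate g⁻¹g = 1 twice; the cross terms contain first derivatives of the metric, which
vanish at the centre. -/
lemma deriv_deriv_invMetric (k l a b : Fin n) :
    partialDeriv k (partialDeriv l fun z => invMetric g e z a b) y = - metricSnd g e y a b k l := by
  have hg := fun a b => contDiffAt_metricCoeff (g := g) h.mem_atlas h.mem_target a b
  have hi := fun a b => contDiffAt_invMetric (g := g) h.mem_atlas h.mem_target a b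
  have h1 : partialDeriv k (partialDeriv l
      (fun z => ∑ c, invMetric g e z a c * metricCoeff g e z c b)) y = 0 := by
    have h2 : partialDeriv l (fun z => ∑ c, invMetric g e z a c * metricCoeff g e z c b) =ᶠ[𝓝 y]
        fun _ => 0 := by
      filter_upwards [(sum_invMetric_mul_metricCoeff (g := g) h.mem_atlas
        h.mem_target a b).eventually_nhds] with z hz
      rw [partialDeriv_congr hz, partialDeriv_const]
    rw [partialDeriv_congr h2, partialDeriv_const]
  rw [partialDeriv_partialDeriv_sum
    (f := fun c z => invMetric g e z a c * metricCoeff g e z c b) fun c _ =>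
    (hi a c).mul (hg c b)] at h1
  simp only [partialDeriv_partialDeriv_mul (hi _ _) (hg _ _), h.deriv_eq, h.metric_eq, mul_zero,
    add_zero, zero_add, h.invMetric_eq, Finset.sum_add_distrib, sum_mul_one, sum_one_mul] at h1
  exact eq_neg_of_add_eq_zero_left h1

lemma christoffel_eq (k i j : Fin n) : christoffel g e k i j y = 0 := by
  simp [christoffel, h.deriv_eq]

lemma deriv_christoffel (c a d b : Fin n) : partialDeriv c (christoffel g e a d b) y =
    1 / 2 * (metricSnd g e y b a c d + metricSnd g e y d a c b - metricSnd g e y d b c a) := by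
  have hg := fun a b c => (contDiffAt_partialDeriv (i := c) (contDiffAt_metricCoeff (g := g)
    h.mem_atlas h.mem_target a b)).differentiableAt_infty
  have hi := fun a b => (contDiffAt_invMetric (g := g) h.mem_atlas
    h.mem_target a b).differentiableAt_infty
  have hs : ∀ l, DifferentiableAt ℝ (fun z => partialDeriv d (fun z => metricCoeff g e z b l) z +
      partialDeriv b (fun z => metricCoeff g e z d l) z -
      partialDeriv l (fun z => metricCoeff g e z d b) z) y := fun l =>
    ((hg b l d).fun_add (hg d l b)).fun_sub (hg d b l)
  have e1 : christoffel g e a d b = fun z => (1 / 2) * ∑ l, invMetric g e z a l *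
      (partialDeriv d (fun z => metricCoeff g e z b l) z +
      partialDeriv b (fun z => metricCoeff g e z d l) z -
      partialDeriv l (fun z => metricCoeff g e z d b) z) := rfl
  rw [e1, partialDeriv_mul (differentiableAt_const _) (DifferentiableAt.fun_sum fun l _ =>
    (hi a l).fun_mul (hs l)), partialDeriv_const, zero_mul, zero_add,
    partialDeriv_sum (f := fun l z => invMetric g e z a l *
      (partialDeriv d (fun z => metricCoeff g e z b l) z +
      partialDeriv b (fun z => metricCoeff g e z d l) z -
      partialDeriv l (fun z => metricCoeff g e z d b) z)) fun l _ => (hi a l).fun_mul (hs l)]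
  simp only [partialDeriv_mul (hi _ _) (hs _), h.deriv_invMetric, zero_mul, zero_add,
    h.invMetric_eq, sum_one_mul, partialDeriv_sub ((hg b _ d).fun_add (hg d _ b)) (hg d b _),
    partialDeriv_add (hg b _ d) (hg d _ b)]
  rfl

/-- The Christoffel symbols vanish at the centre, so only their derivatives contribute and the
curvature is linear in the second derivatives of the metric. -/
lemma riemann_eq (a b c d : Fin n) : riemann g e a b c d y =
    1 / 2 * (metricSnd g e y d a c b - metricSnd g e y d b c a - metricSnd g e y c a d b +
      metricSnd g e y c b d a) := by
  simp only [riemann, h.metric_eq, sum_one_mul, riemannUp, h.christoffel_eq, mul_zero, sub_zero,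
    Finset.sum_const_zero, add_zero, h.deriv_christoffel]
  rw [metricSnd_comm_right h.mem_atlas h.mem_target b a c d]
  ring

lemma ricci_eq (b d : Fin n) : ricci g e b d y = ∑ a, riemann g e a b a d y := by
  simp only [riemann, ricci, h.metric_eq, sum_one_mul]

end IsNormalAt

lemma sum_swap_left (f : Fin n → Fin n → Fin n → Fin n → ℝ) :
    ∑ a, ∑ b, ∑ c, ∑ d, f a b c d = ∑ a, ∑ b, ∑ c, ∑ d, f b a c d := Finset.sum_comm

lemma sum_swap_mid (f : Fin n → Fin n → Fin n → Fin n → ℝ) :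
    ∑ a, ∑ b, ∑ c, ∑ d, f a b c d = ∑ a, ∑ b, ∑ c, ∑ d, f a c b d :=
  Finset.sum_congr rfl fun _ _ => Finset.sum_comm

lemma sum_swap_right (f : Fin n → Fin n → Fin n → Fin n → ℝ) :
    ∑ a, ∑ b, ∑ c, ∑ d, f a b c d = ∑ a, ∑ b, ∑ c, ∑ d, f a b d c :=
  Finset.sum_congr rfl fun _ _ => Finset.sum_congr rfl fun _ _ => Finset.sum_comm

/-- The algebraic identity between the curvature terms behind the Weitzenböck formula. -/
lemma curvature_identity (H P R : Fin n → Fin n → Fin n → Fin n → ℝ)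
    (hH1 : ∀ a b c d, H a b c d = H b a c d) (hH2 : ∀ a b c d, H a b c d = H a b d c)
    (hP1 : ∀ a b c d, P a b c d = - P b a c d) (hP2 : ∀ a b c d, P a b c d = P c d a b)
    (hR : ∀ a b c d, R a b c d = 1 / 2 * (H d a c b - H d b c a - H c a d b + H c b d a)) :
    - (∑ k, ∑ μ, ∑ α, ∑ l, H μ α k k * P μ l α l) +
      2 * (∑ k, ∑ γ, ∑ μ, ∑ l, (1 / 2 * (H k γ μ k + H k γ μ k - H k k μ γ)) * P γ l μ l) +
      2 * (∑ k, ∑ γ, ∑ μ, ∑ l, (1 / 2 * (H l γ μ k + H k γ μ l - H k l μ γ)) * P k γ μ l) =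
    2 * (∑ α, ∑ β, ∑ l, (∑ a, R a α a β) * P α l β l) -
      ∑ α, ∑ β, ∑ μ, ∑ l, R α β μ l * P α β μ l := by
  have hP3 : ∀ a b c d, P a b c d = - P a b d c := fun a b c d => by
    rw [hP2, hP1, hP2]
  -- Up to sign, each full contraction of H with P is `Y` or zero: H symmetric against P skew gives
  -- zero, and exchanging indices in a skew pair changes the sign. The partially traced sums reduce
  -- to `X1`, `X2` and `X3`.
  set Y := ∑ k, ∑ γ, ∑ μ, ∑ l, H l γ μ k * P k γ μ l with hY
  have e2 : ∑ k, ∑ γ, ∑ μ, ∑ l, H k γ μ l * P k γ μ l = 0 := by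
    have : ∑ k, ∑ γ, ∑ μ, ∑ l, H k γ μ l * P k γ μ l =
        - ∑ k, ∑ γ, ∑ μ, ∑ l, H k γ μ l * P k γ μ l := by
      conv_lhs => rw [sum_swap_left]
      simp only [← Finset.sum_neg_distrib]
      congr! 4 with a _ b _ c _ d
      rw [hH1, hP1, mul_neg]
    linarith
  have e3 : ∑ k, ∑ γ, ∑ μ, ∑ l, H k l μ γ * P k γ μ l = - Y := by
    rw [sum_swap_left, hY]
    simp only [← Finset.sum_neg_distrib]
    congr! 4 with a _ b _ c _ d
    rw [hH1, hP1, mul_neg]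
  have a1 : ∑ k, ∑ γ, ∑ μ, ∑ l, H l k μ γ * P k γ μ l = - Y := by
    simp only [hH1 _ _ _ _, ← e3]
  have a3 : ∑ k, ∑ γ, ∑ μ, ∑ l, H μ k l γ * P k γ μ l = Y := by
    rw [sum_swap_right, ← neg_neg Y, ← a1]
    simp only [← Finset.sum_neg_distrib]
    congr! 4 with a _ b _ c _ d
    rw [hP3, mul_neg]
  have a4 : ∑ k, ∑ γ, ∑ μ, ∑ l, H μ γ l k * P k γ μ l = - Y := by
    rw [sum_swap_right, hY]
    simp only [← Finset.sum_neg_distrib]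
    congr! 4 with a _ b _ c _ d
    rw [hP3, mul_neg]
  set X1 := ∑ k, ∑ μ, ∑ α, ∑ l, H μ α k k * P μ l α l with hX1
  set X2 := ∑ k, ∑ γ, ∑ μ, ∑ l, H k γ μ k * P γ l μ l with hX2
  set X3 := ∑ k, ∑ γ, ∑ μ, ∑ l, H k k μ γ * P γ l μ l with hX3
  have r : ∑ α, ∑ β, ∑ l, (∑ a, R a α a β) * P α l β l =
      ∑ a, ∑ α, ∑ β, ∑ l, R a α a β * P α l β l := by
    simp only [Finset.sum_mul]
    rw [sum_swap_right, sum_swap_mid, sum_swap_left]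
  have b1 : ∑ a, ∑ α, ∑ β, ∑ l, H β a a α * P α l β l = X2 := by
    rw [sum_swap_mid, hX2]
    congr! 4 with a _ b _ c _ d
    rw [hP2, hH1, hH2]
  have b2 : ∑ a, ∑ α, ∑ β, ∑ l, H β α a a * P α l β l = X1 := by
    rw [hX1]
    congr! 4 with a _ b _ c _ d
    rw [hH1]
  have b4 : ∑ a, ∑ α, ∑ β, ∑ l, H a α β a * P α l β l = X2 := rfl
  rw [r]
  simp only [hR, add_mul, sub_mul, mul_add, mul_sub, mul_assoc, Finset.sum_add_distrib,
    Finset.sum_sub_distrib, ← Finset.mul_sum]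
  simp only [← Finset.mul_sum] at b1 b2 b4 hX2 hX3
  rw [b1, b2, b4, a1, a3, a4, e2, e3, ← hY, ← hX3]
  ring

end Normal

/-! ### Linearity of the bracket and of the Killing metric. -/

section BracketAlgebra

variable {d : ℕ} {G : Type*} [TopologicalSpace G] [ChartedSpace (EuclideanSpace ℝ (Fin d)) G]
  [Group G] [LieGroup (𝓡 d) ∞ G]

lemma bracket_add_left (x y z : EuclideanSpace ℝ (Fin d)) :
    bracket G (x + y) z = bracket G x z + bracket G y z := by
  simp only [← bracketCLM_apply, map_add, _root_.add_apply]

lemma bracket_add_right (x y z : EuclideanSpace ℝ (Fin d)) :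
    bracket G x (y + z) = bracket G x y + bracket G x z := by
  simp only [← bracketCLM_apply, map_add]

lemma bracket_sub_left (x y z : EuclideanSpace ℝ (Fin d)) :
    bracket G (x - y) z = bracket G x z - bracket G y z := by
  simp only [← bracketCLM_apply, map_sub, _root_.sub_apply]

lemma bracket_sub_right (x y z : EuclideanSpace ℝ (Fin d)) :
    bracket G x (y - z) = bracket G x y - bracket G x z := by
  simp only [← bracketCLM_apply, map_sub]

lemma bracket_neg_right (x y : EuclideanSpace ℝ (Fin d)) :
    bracket G x (-y) = - bracket G x y := by
  simp only [← bracketCLM_apply, map_neg]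

lemma bracket_smul_right (x y : EuclideanSpace ℝ (Fin d)) (c : ℝ) :
    bracket G x (c • y) = c • bracket G x y := by
  simp only [← bracketCLM_apply, map_smul]

lemma bracket_sum_right {κ : Type*} (s : Finset κ) (x : EuclideanSpace ℝ (Fin d))
    (f : κ → EuclideanSpace ℝ (Fin d)) :
    bracket G x (∑ k ∈ s, f k) = ∑ k ∈ s, bracket G x (f k) := by
  simp only [← bracketCLM_apply, map_sum]

lemma killingMetric_comm (x y : EuclideanSpace ℝ (Fin d)) :
    killingMetric G x y = killingMetric G y x := by
  rw [killingMetric, killingMetric]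
  exact congrArg Neg.neg (LieModule.traceForm_comm ℝ (GroupLieAlgebra (𝓡 d) G)
    (GroupLieAlgebra (𝓡 d) G) x y)

lemma killingMetric_add_left (x y z : EuclideanSpace ℝ (Fin d)) :
    killingMetric G (x + y) z = killingMetric G x z + killingMetric G y z := by
  simp only [← killingCLM_apply, map_add, _root_.add_apply]

lemma killingMetric_neg_left (x z : EuclideanSpace ℝ (Fin d)) :
    killingMetric G (-x) z = -killingMetric G x z := by
  simp only [← killingCLM_apply, map_neg, _root_.neg_apply]

lemma killingMetric_neg_right (x z : EuclideanSpace ℝ (Fin d)) :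
    killingMetric G x (-z) = -killingMetric G x z := by
  simp only [← killingCLM_apply, map_neg]

lemma killingMetric_smul_left (c : ℝ) (x z : EuclideanSpace ℝ (Fin d)) :
    killingMetric G (c • x) z = c * killingMetric G x z := by
  simp only [← killingCLM_apply, map_smul, _root_.smul_apply, smul_eq_mul]

lemma killingMetric_sub_left (x y z : EuclideanSpace ℝ (Fin d)) :
    killingMetric G (x - y) z = killingMetric G x z - killingMetric G y z := by
  simp only [← killingCLM_apply, map_sub, _root_.sub_apply]

lemma killingMetric_sum_left {κ : Type*} (s : Finset κ) (f : κ → EuclideanSpace ℝ (Fin d))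
    (z : EuclideanSpace ℝ (Fin d)) :
    killingMetric G (∑ k ∈ s, f k) z = ∑ k ∈ s, killingMetric G (f k) z := by
  simp only [← killingCLM_apply, map_sum, _root_.sum_apply]

end BracketAlgebra

lemma sum_swap_pairs {n : ℕ} (f : Fin n → Fin n → Fin n → Fin n → ℝ) :
    ∑ a, ∑ b, ∑ c, ∑ d, f a b c d = ∑ c, ∑ d, ∑ a, ∑ b, f a b c d := by
  rw [sum_swap_mid, sum_swap_left, sum_swap_right, sum_swap_mid]

/-! ### The Bochner formula for Yang–Mills connections. -/

section Bochner

variable {n d : ℕ} {ι : Type*} {M : Type*} [TopologicalSpace M]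
    [ChartedSpace (EuclideanSpace ℝ (Fin n)) M] {G : Type*} [TopologicalSpace G]
    [ChartedSpace (EuclideanSpace ℝ (Fin d)) G] [Group G] [IsManifold (𝓡 n) ∞ M]
    [LieGroup (𝓡 d) ∞ G]
  {e : OpenPartialHomeomorph M (EuclideanSpace ℝ (Fin n))}
  {P : PrincipalBundle n d ι M G} (A : Connection P) {i : ι} {y : EuclideanSpace ℝ (Fin n)}

/-- The gauge covariant derivative `∂_α X + [A_α, X]`. -/
def covD (i : ι) (e : OpenPartialHomeomorph M (EuclideanSpace ℝ (Fin n))) (α : Fin n)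
    (X : EuclideanSpace ℝ (Fin n) → EuclideanSpace ℝ (Fin d)) (y : EuclideanSpace ℝ (Fin n)) :
    EuclideanSpace ℝ (Fin d) :=
  partialDeriv α X y + bracket G (formCoeff (A.form i) e α y) (X y)

variable {X Y : EuclideanSpace ℝ (Fin n) → EuclideanSpace ℝ (Fin d)}

lemma covD_congr (α : Fin n) (h : X =ᶠ[𝓝 y] Y) : covD A i e α X y = covD A i e α Y y := by
  rw [covD, covD, partialDeriv_congr h, h.eq_of_nhds]

lemma covD_neg (α : Fin n) : covD A i e α (fun z => - X z) y = - covD A i e α X y := by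
  rw [covD, covD, partialDeriv_neg, bracket_neg_right, neg_add]

lemma covD_sub (α : Fin n) (hX : DifferentiableAt ℝ X y) (hY : DifferentiableAt ℝ Y y) :
    covD A i e α (fun z => X z - Y z) y = covD A i e α X y - covD A i e α Y y := by
  rw [covD, covD, covD, partialDeriv_sub hX hY, bracket_sub_right]
  abel

lemma covD_sum (α : Fin n) {κ : Type*} {s : Finset κ}
    {f : κ → EuclideanSpace ℝ (Fin n) → EuclideanSpace ℝ (Fin d)}
    (hf : ∀ k ∈ s, DifferentiableAt ℝ (f k) y) :
    covD A i e α (fun z => ∑ k ∈ s, f k z) y = ∑ k ∈ s, covD A i e α (f k) y := by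
  simp only [covD, partialDeriv_sum hf, bracket_sum_right, Finset.sum_add_distrib]

lemma covD_smul (α : Fin n) {c : EuclideanSpace ℝ (Fin n) → ℝ} (hc : DifferentiableAt ℝ c y)
    (hX : DifferentiableAt ℝ X y) :
    covD A i e α (fun z => c z • X z) y = partialDeriv α c y • X y + c y • covD A i e α X y := by
  rw [covD, covD, partialDeriv_smul hc hX, bracket_smul_right, smul_add, add_assoc]

lemma covD_zero (α : Fin n) : covD A i e α (fun _ => (0 : EuclideanSpace ℝ (Fin d))) y = 0 := by
  rw [covD, partialDeriv_const, ← bracketCLM_apply, map_zero, zero_add]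

lemma fieldStrength_skew_fun (A : Connection P) (i : ι) (μ l : Fin n) :
    A.fieldStrength i e μ l = fun z => - A.fieldStrength i e l μ z :=
  funext fun z => fieldStrength_skew A i μ l z

lemma partialDeriv_bracket {α : Fin n} (hX : DifferentiableAt ℝ X y) (hY : DifferentiableAt ℝ Y y) :
    partialDeriv α (fun z => bracket G (X z) (Y z)) y =
      bracket G (partialDeriv α X y) (Y y) + bracket G (X y) (partialDeriv α Y y) :=
  partialDeriv_bilin (bracketCLM G) hX hY

/-- The terms with the connection form cancel because the Killing form is ad-invariant: the gauge
covariant derivative is metric. -/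
lemma partialDeriv_killingMetric (α : Fin n) (hX : DifferentiableAt ℝ X y)
    (hY : DifferentiableAt ℝ Y y) :
    partialDeriv α (fun z => killingMetric G (X z) (Y z)) y =
      killingMetric G (covD A i e α X y) (Y y) + killingMetric G (X y) (covD A i e α Y y) := by
  have h1 : partialDeriv α (fun z => killingMetric G (X z) (Y z)) y = _ :=
    partialDeriv_bilin (killingCLM G) hX hY
  rw [h1, covD, covD, killingMetric_add_left, killingMetric_comm (X y), killingMetric_add_left,
    killingMetric_bracket, killingMetric_comm _ (X y), killingMetric_comm _ (X y)]
  simp only [killingCLM_apply]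
  ring

lemma contDiffAt_killingMetric (hX : ContDiffAt ℝ ∞ X y) (hY : ContDiffAt ℝ ∞ Y y) :
    ContDiffAt ℝ ∞ (fun z => killingMetric G (X z) (Y z)) y :=
  ((killingCLM G).contDiff.contDiffAt.comp y hX).clm_apply hY

variable (he : e ∈ IsManifold.maximalAtlas (𝓡 n) ∞ M) (hy : y ∈ chartDomain P i e)
include he hy

lemma contDiffAt_covD (α : Fin n) (hX : ContDiffAt ℝ ∞ X y) :
    ContDiffAt ℝ ∞ (covD A i e α X) y :=
  (contDiffAt_partialDeriv hX).add (contDiffAt_bracket (contDiffAt_formCoeff he A hy α) hX)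

/-- The commutator of covariant derivatives acts by ad of the field strength: second derivatives of
X cancel and Jacobi collects the double brackets. No Riemann curvature appears, as `covD` contains
no Christoffel symbols. -/
lemma covD_comm (k μ : Fin n) (hX : ContDiffAt ℝ ∞ X y) :
    covD A i e k (covD A i e μ X) y = covD A i e μ (covD A i e k X) y +
      bracket G (A.fieldStrength i e k μ y) (X y) := by
  have ha := fun μ => (contDiffAt_formCoeff he A hy μ).differentiableAt_infty
  have hX1 := hX.differentiableAt_infty
  have hX2 := fun μ => (contDiffAt_partialDeriv (i := μ) hX).differentiableAt_infty
  have key : ∀ k μ, covD A i e k (covD A i e μ X) y = partialDeriv k (partialDeriv μ X) y +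
      (bracket G (partialDeriv k (formCoeff (A.form i) e μ) y) (X y) +
        bracket G (formCoeff (A.form i) e μ y) (partialDeriv k X y)) +
      (bracket G (formCoeff (A.form i) e k y) (partialDeriv μ X y) +
        bracket G (formCoeff (A.form i) e k y) (bracket G (formCoeff (A.form i) e μ y) (X y))) := by
    intro k μ
    have : partialDeriv k (covD A i e μ X) y = _ := partialDeriv_add (hX2 μ)
      (contDiffAt_bracket (G := G) (contDiffAt_formCoeff he A hy μ) hX).differentiableAt_infty
    rw [covD, this, partialDeriv_bracket (ha μ) hX1, covD, bracket_add_right]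
  rw [key, key, partialDeriv_comm hX μ, Connection.fieldStrength, bracket_add_left,
    bracket_sub_left, bracket_jacobi (formCoeff (A.form i) e k y)]
  abel

/-- In the cyclic sum the second derivatives of A cancel by symmetry, the quadratic terms by
skewness, and the cubic terms by the Jacobi identity. -/
lemma bianchi (α μ l : Fin n) :
    covD A i e α (A.fieldStrength i e μ l) y + covD A i e μ (A.fieldStrength i e l α) y +
      covD A i e l (A.fieldStrength i e α μ) y = 0 := by
  have hs := fun μ => contDiffAt_formCoeff he A hy μ
  have ha := fun μ => (hs μ).differentiableAt_infty
  have hd := fun μ l => (contDiffAt_partialDeriv (i := μ) (hs l)).differentiableAt_infty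
  have key : ∀ α μ l, covD A i e α (A.fieldStrength i e μ l) y =
      partialDeriv α (partialDeriv μ (formCoeff (A.form i) e l)) y -
      partialDeriv α (partialDeriv l (formCoeff (A.form i) e μ)) y +
      (bracket G (partialDeriv α (formCoeff (A.form i) e μ) y) (formCoeff (A.form i) e l y) +
        bracket G (formCoeff (A.form i) e μ y) (partialDeriv α (formCoeff (A.form i) e l) y)) +
      (bracket G (formCoeff (A.form i) e α y) (partialDeriv μ (formCoeff (A.form i) e l) y) -
        bracket G (formCoeff (A.form i) e α y) (partialDeriv l (formCoeff (A.form i) e μ) y) +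
        bracket G (formCoeff (A.form i) e α y)
          (bracket G (formCoeff (A.form i) e μ y) (formCoeff (A.form i) e l y))) := by
    intro α μ l
    have h1 : partialDeriv α (A.fieldStrength i e μ l) y = _ :=
      partialDeriv_add ((hd μ l).fun_sub (hd l μ))
        (contDiffAt_bracket (G := G) (hs μ) (hs l)).differentiableAt_infty
    rw [covD, h1, partialDeriv_sub (hd μ l) (hd l μ), partialDeriv_bracket (ha μ) (ha l),
      Connection.fieldStrength, bracket_add_right, bracket_sub_right]
  rw [key, key, key, partialDeriv_comm (hs l) μ, partialDeriv_comm (hs μ) l,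
    partialDeriv_comm (hs α) l]
  rw [bracket_jacobi (formCoeff (A.form i) e α y),
    bracket_skew (bracket G (formCoeff (A.form i) e α y) (formCoeff (A.form i) e μ y)),
    bracket_skew (formCoeff (A.form i) e α y) (formCoeff (A.form i) e l y), bracket_neg_right,
    bracket_skew (partialDeriv α (formCoeff (A.form i) e μ) y),
    bracket_skew (partialDeriv μ (formCoeff (A.form i) e l) y),
    bracket_skew (partialDeriv l (formCoeff (A.form i) e α) y)]
  abel

lemma covD_fieldStrength_eq (k μ l : Fin n) :
    covD A i e k (A.fieldStrength i e μ l) y =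
      covD A i e μ (A.fieldStrength i e k l) y - covD A i e l (A.fieldStrength i e k μ) y := by
  have := bianchi A he hy k μ l
  rw [fieldStrength_skew_fun A i l k, covD_neg] at this
  rw [add_eq_zero_iff_eq_neg.1 ((add_assoc _ _ _).symm.trans this)]
  abel

/-- Bianchi moves the inner derivative to another index, and commuting then places D_k on F_{k·}.
Summed over k this is a divergence, accessible to the Yang–Mills equation; the commutators produce
the cubic terms. -/
lemma covD_covD_fieldStrength (k μ l : Fin n) :
    covD A i e k (covD A i e k (A.fieldStrength i e μ l)) y =
      (covD A i e μ (covD A i e k (A.fieldStrength i e k l)) y +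
        bracket G (A.fieldStrength i e k μ y) (A.fieldStrength i e k l y)) -
      (covD A i e l (covD A i e k (A.fieldStrength i e k μ)) y +
        bracket G (A.fieldStrength i e k l y) (A.fieldStrength i e k μ y)) := by
  have hF := fun μ l => contDiffAt_fieldStrength he A hy μ l
  have h1 : covD A i e k (A.fieldStrength i e μ l) =ᶠ[𝓝 y] fun z =>
      covD A i e μ (A.fieldStrength i e k l) z - covD A i e l (A.fieldStrength i e k μ) z := by
    filter_upwards [(isOpen_chartDomain i e).mem_nhds hy] with z hz
    exact covD_fieldStrength_eq A he hz k μ l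
  rw [covD_congr A k h1, covD_sub A k (contDiffAt_covD A he hy μ (hF k l)).differentiableAt_infty
    (contDiffAt_covD A he hy l (hF k μ)).differentiableAt_infty, covD_comm A he hy k μ (hF k l),
    covD_comm A he hy k l (hF k μ)]

omit hy in
lemma contDiffAt_christoffel (g : RMetric n M) (hy : y ∈ e.target) (k a b : Fin n) :
    ContDiffAt ℝ ∞ (christoffel g e k a b) y :=
  contDiffAt_const.mul (ContDiffAt.sum fun l _ => (contDiffAt_invMetric he hy k l).mul
    (((contDiffAt_partialDeriv (contDiffAt_metricCoeff he hy b l)).add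
      (contDiffAt_partialDeriv (contDiffAt_metricCoeff he hy a l))).sub
      (contDiffAt_partialDeriv (contDiffAt_metricCoeff he hy a b))))

omit he in
/-- The Yang-Mills equation, differentiated at the centre of a normal chart. -/
lemma IsNormalAt.sum_covD_covD {g : RMetric n M} (h : IsNormalAt g e y) (hA : A.IsYangMills g)
    (m l : Fin n) :
    ∑ k, covD A i e m (covD A i e k (A.fieldStrength i e k l)) y =
      ∑ k, ∑ γ, (partialDeriv m (christoffel g e γ k k) y • A.fieldStrength i e γ l y +
        partialDeriv m (christoffel g e γ k l) y • A.fieldStrength i e k γ y) := by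
  have he := h.mem_atlas
  have hF := fun μ l => contDiffAt_fieldStrength he A hy μ l
  have hF1 := fun μ l => (hF μ l).differentiableAt_infty
  have hΓ := fun a b c => (contDiffAt_christoffel he g h.mem_target a b c).differentiableAt_infty
  have hi := fun a b => (contDiffAt_invMetric (g := g) he h.mem_target a b).differentiableAt_infty
  have hD := fun k μ => (contDiffAt_covD A he hy k (hF μ l)).differentiableAt_infty
  have hS1 : ∀ μ α, DifferentiableAt ℝ
      (fun z => ∑ γ, christoffel g e γ α μ z • A.fieldStrength i e γ l z) y := fun μ α =>
    DifferentiableAt.fun_sum fun γ _ => (hΓ γ α μ).fun_smul (hF1 γ l)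
  have hS2 : ∀ μ α, DifferentiableAt ℝ
      (fun z => ∑ γ, christoffel g e γ α l z • A.fieldStrength i e μ γ z) y := fun μ α =>
    DifferentiableAt.fun_sum fun γ _ => (hΓ γ α l).fun_smul (hF1 μ γ)
  have hC : ∀ μ α, DifferentiableAt ℝ (A.covDerivFieldStrength g i e μ l α) y := fun μ α =>
    ((hD α μ).fun_sub (hS1 μ α)).fun_sub (hS2 μ α)
  -- The Yang–Mills equation holds throughout a neighbourhood of the centre, so it may be
  -- differentiated.
  have h0 : (fun z => ∑ α, ∑ μ, invMetric g e z α μ • A.covDerivFieldStrength g i e μ l α z)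
      =ᶠ[𝓝 y] fun _ => 0 := by
    filter_upwards [(isOpen_chartDomain i e).mem_nhds hy] with z hz
    exact hA i e he z hz.1 hz.2 l
  have h1 := covD_congr A (i := i) (e := e) m h0
  rw [covD_zero, covD_sum A m (f := fun α z => ∑ μ, invMetric g e z α μ •
    A.covDerivFieldStrength g i e μ l α z) fun α _ => DifferentiableAt.fun_sum fun μ _ =>
    (hi α μ).fun_smul (hC μ α)] at h1
  -- The inverse metric is the identity with vanishing derivative at the centre, so it contributes
  -- only a trace.
  have h2 : ∀ α, covD A i e m (fun z => ∑ μ, invMetric g e z α μ •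
      A.covDerivFieldStrength g i e μ l α z) y =
      covD A i e m (A.covDerivFieldStrength g i e α l α) y := by
    intro α
    rw [covD_sum A m (f := fun μ z => invMetric g e z α μ •
      A.covDerivFieldStrength g i e μ l α z) fun μ _ => (hi α μ).fun_smul (hC μ α)]
    simp only [covD_smul A m (hi _ _) (hC _ _), h.deriv_invMetric, h.invMetric_eq, zero_smul,
      zero_add]
    simp [Matrix.one_apply]
  -- The Christoffel symbols vanish at the centre but their derivatives do not; these are what later
  -- becomes curvature.
  have h3 : ∀ α, covD A i e m (A.covDerivFieldStrength g i e α l α) y =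
      covD A i e m (covD A i e α (A.fieldStrength i e α l)) y -
      ∑ γ, (partialDeriv m (christoffel g e γ α α) y • A.fieldStrength i e γ l y +
        partialDeriv m (christoffel g e γ α l) y • A.fieldStrength i e α γ y) := by
    intro α
    have e1 : A.covDerivFieldStrength g i e α l α = fun z =>
      (covD A i e α (A.fieldStrength i e α l) z -
        ∑ γ, christoffel g e γ α α z • A.fieldStrength i e γ l z) -
        ∑ γ, christoffel g e γ α l z • A.fieldStrength i e α γ z := rfl
    rw [e1, covD_sub A m ((hD α α).fun_sub (hS1 α α)) (hS2 α α), covD_sub A m (hD α α) (hS1 α α),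
      covD_sum A m (f := fun γ z => christoffel g e γ α α z • A.fieldStrength i e γ l z) fun γ _ =>
        (hΓ γ α α).fun_smul (hF1 γ l),
      covD_sum A m (f := fun γ z => christoffel g e γ α l z • A.fieldStrength i e α γ z) fun γ _ =>
        (hΓ γ α l).fun_smul (hF1 α γ)]
    simp only [covD_smul A m (hΓ _ _ _) (hF1 _ _), h.christoffel_eq, zero_smul, add_zero,
      Finset.sum_add_distrib]
    abel
  simp only [h2, h3, Finset.sum_sub_distrib] at h1
  exact sub_eq_zero.1 h1

omit he in
-- The two halves of `covD_covD_fieldStrength` differ by exchanging μ and l, and skewness of F makes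
-- their sums equal: hence the factors 2. The differentiated Yang–Mills equation then replaces the
-- divergence terms.
lemma IsNormalAt.sum_killingMetric_covD_covD {g : RMetric n M} (h : IsNormalAt g e y)
    (hA : A.IsYangMills g) :
    ∑ k, ∑ μ, ∑ l, killingMetric G (covD A i e k (covD A i e k (A.fieldStrength i e μ l)) y)
        (A.fieldStrength i e μ l y) =
      2 * ∑ k, ∑ μ, ∑ l, killingMetric G (bracket G (A.fieldStrength i e k μ y)
        (A.fieldStrength i e k l y)) (A.fieldStrength i e μ l y) +
      2 * ∑ k, ∑ γ, ∑ μ, ∑ l, (partialDeriv μ (christoffel g e γ k k) y *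
        killingMetric G (A.fieldStrength i e γ l y) (A.fieldStrength i e μ l y)) +
      2 * ∑ k, ∑ γ, ∑ μ, ∑ l, (partialDeriv μ (christoffel g e γ k l) y *
        killingMetric G (A.fieldStrength i e k γ y) (A.fieldStrength i e μ l y)) := by
  have he := h.mem_atlas
  set F := fun a b => A.fieldStrength i e a b y with hF
  set D := fun μ k l => covD A i e μ (covD A i e k (A.fieldStrength i e k l)) y with hD
  have h1 : ∀ k μ l, killingMetric G (covD A i e k (covD A i e k (A.fieldStrength i e μ l)) y)
      (F μ l) =
      (killingMetric G (D μ k l) (F μ l) +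
        killingMetric G (bracket G (F k μ) (F k l)) (F μ l)) +
      (killingMetric G (D l k μ) (F l μ) +
        killingMetric G (bracket G (F k l) (F k μ)) (F l μ)) := by
    intro k μ l
    rw [covD_covD_fieldStrength A he hy, killingMetric_sub_left, killingMetric_add_left,
      killingMetric_add_left, sub_eq_add_neg, neg_add, ← killingMetric_neg_right,
      ← killingMetric_neg_right, show - F μ l = F l μ from (fieldStrength_skew A i l μ y).symm]
  have h2 : ∑ μ, ∑ l, ∑ k, killingMetric G (D μ k l) (F μ l) =
      ∑ k, ∑ γ, ∑ μ, ∑ l, (partialDeriv μ (christoffel g e γ k k) y *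
        killingMetric G (F γ l) (F μ l)) +
      ∑ k, ∑ γ, ∑ μ, ∑ l, (partialDeriv μ (christoffel g e γ k l) y *
        killingMetric G (F k γ) (F μ l)) := by
    simp only [← killingMetric_sum_left]
    simp only [hD, h.sum_covD_covD A hy hA, killingMetric_sum_left, killingMetric_add_left,
      killingMetric_smul_left, Finset.sum_add_distrib]
    exact congrArg₂ (· + ·)
      (sum_swap_pairs fun μ l k γ => partialDeriv μ (christoffel g e γ k k) y *
        killingMetric G (F γ l) (F μ l))
      (sum_swap_pairs fun μ l k γ => partialDeriv μ (christoffel g e γ k l) y *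
        killingMetric G (F k γ) (F μ l))
  have h3 : ∑ k, ∑ μ, ∑ l, killingMetric G (D μ k l) (F μ l) =
      ∑ μ, ∑ l, ∑ k, killingMetric G (D μ k l) (F μ l) := by
    rw [Finset.sum_comm]
    exact Finset.sum_congr rfl fun _ _ => Finset.sum_comm
  have h4 : ∀ f : Fin n → Fin n → Fin n → ℝ, ∑ k, ∑ μ, ∑ l, f k l μ = ∑ k, ∑ μ, ∑ l, f k μ l :=
    fun f => Finset.sum_congr rfl fun _ _ => Finset.sum_comm
  have h5 := h4 fun k μ l => killingMetric G (D μ k l) (F μ l)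
  have h6 := h4 fun k μ l => killingMetric G (bracket G (F k μ) (F k l)) (F μ l)
  have h7 : ∑ k, ∑ μ, ∑ l, killingMetric G
      (covD A i e k (covD A i e k (A.fieldStrength i e μ l)) y) (F μ l) = _ :=
    Finset.sum_congr rfl fun k _ => Finset.sum_congr rfl fun μ _ => Finset.sum_congr rfl
      fun l _ => h1 k μ l
  rw [h7]
  simp only [Finset.sum_add_distrib]
  rw [h5, h6, h3, h2]
  ring

omit he in
-- To first order the metric is constant at the centre, so only the field strengths are
-- differentiated.
lemma IsNormalAt.partialDeriv_energyIn {g : RMetric n M} (h : IsNormalAt g e y) (k : Fin n) :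
    partialDeriv k (energyIn A g i e) y =
      2 * ∑ μ, ∑ l, killingMetric G (covD A i e k (A.fieldStrength i e μ l) y)
        (A.fieldStrength i e μ l y) := by
  have he := h.mem_atlas
  have hF := fun μ l => contDiffAt_fieldStrength he A hy μ l
  have hi := fun a b => (contDiffAt_invMetric (g := g) he h.mem_target a b).differentiableAt_infty
  have hP := fun μ l α β => (contDiffAt_killingMetric (G := G) (hF μ l)
    (hF α β)).differentiableAt_infty
  have e1 : energyIn A g i e = fun z => ∑ μ, ∑ l, ∑ α, ∑ β, invMetric g e z μ α *
    invMetric g e z l β * killingMetric G (A.fieldStrength i e μ l z)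
      (A.fieldStrength i e α β z) := rfl
  have hQ := fun μ l α β => ((hi μ α).fun_mul (hi l β)).fun_mul (hP μ l α β)
  have h1 : ∀ μ l α β, partialDeriv k (fun z => invMetric g e z μ α *
      invMetric g e z l β * killingMetric G (A.fieldStrength i e μ l z)
      (A.fieldStrength i e α β z)) y = (1 : Matrix (Fin n) (Fin n) ℝ) μ α *
      ((1 : Matrix (Fin n) (Fin n) ℝ) l β * partialDeriv k (fun z =>
        killingMetric G (A.fieldStrength i e μ l z) (A.fieldStrength i e α β z)) y) := by
    intro μ l α β
    rw [partialDeriv_mul ((hi μ α).fun_mul (hi l β)) (hP μ l α β),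
      partialDeriv_mul (hi μ α) (hi l β), h.deriv_invMetric, h.deriv_invMetric, h.invMetric_eq]
    ring
  rw [e1, partialDeriv_sum fun μ _ => DifferentiableAt.fun_sum fun l _ =>
    DifferentiableAt.fun_sum fun α _ => DifferentiableAt.fun_sum fun β _ => hQ μ l α β,
    Finset.mul_sum]
  refine Finset.sum_congr rfl fun μ _ => ?_
  rw [partialDeriv_sum fun l _ => DifferentiableAt.fun_sum fun α _ => DifferentiableAt.fun_sum
    fun β _ => hQ μ l α β, Finset.mul_sum]
  refine Finset.sum_congr rfl fun l _ => ?_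
  rw [partialDeriv_sum fun α _ => DifferentiableAt.fun_sum fun β _ => hQ μ l α β]
  rw [Finset.sum_congr rfl fun α _ => partialDeriv_sum fun β _ => hQ μ l α β]
  simp only [h1, ← Finset.mul_sum, sum_one_mul]
  rw [partialDeriv_killingMetric A k (hF μ l).differentiableAt_infty
    (hF μ l).differentiableAt_infty (i := i) (e := e), killingMetric_comm (A.fieldStrength i e μ l y)]
  ring

omit he in
-- Second derivatives fall either on one of the two inverse metrics, giving minus the second
-- derivatives of the metric, or on the field strengths. First derivatives of the inverse metrics
-- remove the cross terms.
lemma IsNormalAt.partialDeriv_partialDeriv_energyIn {g : RMetric n M} (h : IsNormalAt g e y)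
    (k : Fin n) :
    partialDeriv k (partialDeriv k (energyIn A g i e)) y =
      2 * (- (∑ μ, ∑ α, ∑ l, metricSnd g e y μ α k k *
        killingMetric G (A.fieldStrength i e μ l y) (A.fieldStrength i e α l y)) +
      ∑ μ, ∑ l, killingMetric G (covD A i e k (covD A i e k (A.fieldStrength i e μ l)) y)
        (A.fieldStrength i e μ l y) +
      ∑ μ, ∑ l, killingMetric G (covD A i e k (A.fieldStrength i e μ l) y)
        (covD A i e k (A.fieldStrength i e μ l) y)) := by
  have he := h.mem_atlas
  have hF := fun μ l => contDiffAt_fieldStrength he A hy μ l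
  have hi := fun a b => contDiffAt_invMetric (g := g) he h.mem_target a b
  have hP := fun μ l α β => contDiffAt_killingMetric (G := G) (hF μ l) (hF α β)
  have e1 : energyIn A g i e = fun z => ∑ μ, ∑ l, ∑ α, ∑ β, invMetric g e z μ α *
    invMetric g e z l β * killingMetric G (A.fieldStrength i e μ l z)
      (A.fieldStrength i e α β z) := rfl
  have hQ := fun μ l α β => ((hi μ α).mul (hi l β)).mul (hP μ l α β)
  set F := fun a b => A.fieldStrength i e a b y with hFd
  have h1 : ∀ μ l α β, partialDeriv k (partialDeriv k (fun z => invMetric g e z μ α *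
      invMetric g e z l β * killingMetric G (A.fieldStrength i e μ l z)
      (A.fieldStrength i e α β z))) y =
      (1 : Matrix (Fin n) (Fin n) ℝ) l β * (- metricSnd g e y μ α k k *
        killingMetric G (F μ l) (F α β)) +
      (1 : Matrix (Fin n) (Fin n) ℝ) μ α * (- metricSnd g e y l β k k *
        killingMetric G (F μ l) (F α β)) +
      (1 : Matrix (Fin n) (Fin n) ℝ) μ α * ((1 : Matrix (Fin n) (Fin n) ℝ) l β *
        partialDeriv k (partialDeriv k (fun z =>
        killingMetric G (A.fieldStrength i e μ l z) (A.fieldStrength i e α β z))) y) := by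
    intro μ l α β
    rw [partialDeriv_partialDeriv_mul ((hi μ α).mul (hi l β)) (hP μ l α β),
      partialDeriv_partialDeriv_mul (hi μ α) (hi l β),
      partialDeriv_mul (hi μ α).differentiableAt_infty (hi l β).differentiableAt_infty,
      h.deriv_invMetric, h.deriv_invMetric, h.invMetric_eq, h.deriv_deriv_invMetric,
      h.deriv_deriv_invMetric]
    ring
  have h2 : ∀ μ l, partialDeriv k (partialDeriv k (fun z =>
      killingMetric G (A.fieldStrength i e μ l z) (A.fieldStrength i e μ l z))) y =
      2 * (killingMetric G (covD A i e k (covD A i e k (A.fieldStrength i e μ l)) y) (F μ l) +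
        killingMetric G (covD A i e k (A.fieldStrength i e μ l) y)
        (covD A i e k (A.fieldStrength i e μ l) y)) := by
    intro μ l
    have h3 : partialDeriv k (fun z =>
        killingMetric G (A.fieldStrength i e μ l z) (A.fieldStrength i e μ l z)) =ᶠ[𝓝 y] fun z =>
        2 * killingMetric G (covD A i e k (A.fieldStrength i e μ l) z)
          (A.fieldStrength i e μ l z) := by
      filter_upwards [(isOpen_chartDomain i e).mem_nhds hy] with z hz
      have := (contDiffAt_fieldStrength he A hz μ l).differentiableAt_infty
      rw [partialDeriv_killingMetric A k this this (i := i) (e := e),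
        killingMetric_comm (A.fieldStrength i e μ l z)]
      ring
    have h4 := contDiffAt_covD A he hy k (hF μ l)
    rw [partialDeriv_congr h3, partialDeriv_mul (differentiableAt_const _)
      (contDiffAt_killingMetric (G := G) h4 (hF μ l)).differentiableAt_infty,
      partialDeriv_const, partialDeriv_killingMetric A k h4.differentiableAt_infty
      (hF μ l).differentiableAt_infty (i := i) (e := e)]
    ring
  rw [e1, partialDeriv_partialDeriv_sum fun μ _ => ContDiffAt.sum fun l _ =>
    ContDiffAt.sum fun α _ => ContDiffAt.sum fun β _ => hQ μ l α β]
  have h3 : ∀ μ, partialDeriv k (partialDeriv k (fun z => ∑ l, ∑ α, ∑ β, invMetric g e z μ α *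
      invMetric g e z l β * killingMetric G (A.fieldStrength i e μ l z)
      (A.fieldStrength i e α β z))) y = ∑ l, ∑ α, ∑ β,
      partialDeriv k (partialDeriv k (fun z => invMetric g e z μ α *
      invMetric g e z l β * killingMetric G (A.fieldStrength i e μ l z)
      (A.fieldStrength i e α β z))) y := by
    intro μ
    rw [partialDeriv_partialDeriv_sum fun l _ => ContDiffAt.sum fun α _ => ContDiffAt.sum
      fun β _ => hQ μ l α β]
    refine Finset.sum_congr rfl fun l _ => ?_
    rw [partialDeriv_partialDeriv_sum fun α _ => ContDiffAt.sum fun β _ => hQ μ l α β]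
    exact Finset.sum_congr rfl fun α _ => partialDeriv_partialDeriv_sum
      (fun β _ => hQ μ l α β) _ _
  simp only [h3, h1, Finset.sum_add_distrib, ← Finset.mul_sum, sum_one_mul, h2]
  -- The contributions of the two inverse metrics agree, because F is skew in its two indices.
  have h5 : ∑ μ, ∑ l, ∑ β, - metricSnd g e y l β k k * killingMetric G (F μ l) (F μ β) =
      ∑ μ, ∑ l, ∑ α, - metricSnd g e y μ α k k * killingMetric G (F μ l) (F α l) := by
    rw [Finset.sum_comm]
    refine Finset.sum_congr rfl fun μ _ => Finset.sum_congr rfl fun l _ =>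
      Finset.sum_congr rfl fun α _ => ?_
    rw [show F l μ = - F μ l from fieldStrength_skew A i l μ y,
      show F l α = - F α l from fieldStrength_skew A i l α y, killingMetric_neg_left,
      killingMetric_neg_right, neg_neg]
  have h6 : ∑ μ, ∑ l, ∑ α, - metricSnd g e y μ α k k * killingMetric G (F μ l) (F α l) =
      - ∑ μ, ∑ α, ∑ l, metricSnd g e y μ α k k * killingMetric G (F μ l) (F α l) := by
    simp only [← Finset.sum_neg_distrib, neg_mul]
    exact Finset.sum_congr rfl fun μ _ => Finset.sum_comm
  simp only [← Finset.mul_sum] at h6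
  rw [h5, h6]
  simp only [hFd]
  ring

omit he in
/-- The Bochner formula for Yang-Mills connections, at the centre of a normal chart. -/
lemma IsNormalAt.bochner {g : RMetric n M} (h : IsNormalAt g e y) (hA : A.IsYangMills g) :
    1 / 2 * ∑ k, partialDeriv k (partialDeriv k (energyIn A g i e)) y =
      ∑ k, ∑ μ, ∑ l, killingMetric G (covD A i e k (A.fieldStrength i e μ l) y)
        (covD A i e k (A.fieldStrength i e μ l) y) +
      (2 * (∑ α, ∑ β, ∑ l, ricci g e α β y *
        killingMetric G (A.fieldStrength i e α l y) (A.fieldStrength i e β l y)) -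
      ∑ α, ∑ β, ∑ μ, ∑ l, riemann g e α β μ l y *
        killingMetric G (A.fieldStrength i e α β y) (A.fieldStrength i e μ l y)) +
      2 * ∑ k, ∑ μ, ∑ l, killingMetric G (bracket G (A.fieldStrength i e k μ y)
        (A.fieldStrength i e k l y)) (A.fieldStrength i e μ l y) := by
  -- H holds the second derivatives of the metric and P the Killing products of the field strengths.
  -- The left side of the identity gathers the terms from the inverse metrics and from the
  -- derivatives of the Christoffel symbols; the right side is the Weitzenböck curvature term.
  have hc := curvature_identity (fun a b c d => metricSnd g e y a b c d)
    (fun a b c d => killingMetric G (A.fieldStrength i e a b y) (A.fieldStrength i e c d y))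
    (fun a b c d => riemann g e a b c d y) metricSnd_comm_left
    (metricSnd_comm_right h.mem_atlas h.mem_target)
    (fun a b c d => by rw [fieldStrength_skew A i a b, killingMetric_neg_left])
    (fun a b c d => killingMetric_comm _ _) h.riemann_eq
  simp only [h.partialDeriv_partialDeriv_energyIn A hy, ← Finset.mul_sum, Finset.sum_add_distrib,
    Finset.sum_neg_distrib, h.sum_killingMetric_covD_covD A hy hA, h.deriv_christoffel,
    h.ricci_eq] at hc ⊢
  linarith

end Bochner

/-! ### From the Bochner formula to the Bochner inequality. -/

section BochnerInequality

variable {n d : ℕ} {ι : Type*} {M : Type*} [TopologicalSpace M]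
    [ChartedSpace (EuclideanSpace ℝ (Fin n)) M] {G : Type*} [TopologicalSpace G]
    [ChartedSpace (EuclideanSpace ℝ (Fin d)) G] [Group G] [IsManifold (𝓡 n) ∞ M]
    [LieGroup (𝓡 d) ∞ G] [T2Space G] [CompactSpace G]
    [LieAlgebra.IsSemisimple ℝ (GroupLieAlgebra (𝓡 d) G)]
  {e : OpenPartialHomeomorph M (EuclideanSpace ℝ (Fin n))}
  {P : PrincipalBundle n d ι M G} (A : Connection P) {i : ι} {y : EuclideanSpace ℝ (Fin n)}

lemma killingMetric_self_nonneg (x : EuclideanSpace ℝ (Fin d)) : 0 ≤ killingMetric G x x := by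
  obtain ⟨m, J, -, hJ, -⟩ := exists_killingMetric_embedding (d := d) (G := G)
  rw [← hJ]
  exact real_inner_self_nonneg

lemma killingMetric_sq_le (x y : EuclideanSpace ℝ (Fin d)) :
    killingMetric G x y ^ 2 ≤ killingMetric G x x * killingMetric G y y := by
  obtain ⟨m, J, -, hJ, -⟩ := exists_killingMetric_embedding (d := d) (G := G)
  rw [← hJ, ← hJ, ← hJ, sq]
  exact real_inner_mul_inner_self_le _ _

/-- In the Killing norm the bracket has norm at most 1, so the cubic term is bounded by w^{3/2} with
no constant depending on the group. -/
lemma abs_killingMetric_bracket_le {x y z : EuclideanSpace ℝ (Fin d)} {w : ℝ}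
    (hx : killingMetric G x x ≤ w) (hy : killingMetric G y y ≤ w) (hz : killingMetric G z z ≤ w) :
    |killingMetric G (bracket G x y) z| ≤ w * √w := by
  obtain ⟨m, J, -, hJ, hb⟩ := exists_killingMetric_embedding (d := d) (G := G)
  have h : ∀ x, killingMetric G x x ≤ w → ‖J x‖ ≤ √w := fun x hx => by
    apply Real.le_sqrt_of_sq_le
    rwa [← real_inner_self_eq_norm_sq, hJ]
  have hw : 0 ≤ w := (killingMetric_self_nonneg x).trans hx
  rw [← hJ]
  calc |inner ℝ (J (bracket G x y)) (J z)| ≤ ‖J (bracket G x y)‖ * ‖J z‖ :=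
        abs_real_inner_le_norm _ _
    _ ≤ (‖J x‖ * ‖J y‖) * ‖J z‖ := by gcongr; exact hb x y
    _ ≤ (√w * √w) * √w := by gcongr <;> [exact h x hx; exact h y hy; exact h z hz]
    _ = w * √w := by rw [Real.mul_self_sqrt hw]

/-- The curvature condition, summed over an orthonormal basis of the Lie algebra. -/
lemma IsNormalAt.le_curvature {g : RMetric n M} (h : IsNormalAt g e y) {c₀ : ℝ}
    (hg : CurvatureCondition g c₀) (F : Fin n → Fin n → EuclideanSpace ℝ (Fin d))
    (hF : ∀ μ l, F μ l = - F l μ) :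
    2 * c₀ * ∑ μ, ∑ l, killingMetric G (F μ l) (F μ l) ≤
      2 * (∑ α, ∑ β, ∑ l, ricci g e α β y * killingMetric G (F α l) (F β l)) -
      ∑ α, ∑ β, ∑ μ, ∑ l, riemann g e α β μ l y * killingMetric G (F α β) (F μ l) := by
  obtain ⟨m, J, -, hJ, -⟩ := exists_killingMetric_embedding (d := d) (G := G)
  have hk : ∀ x y : EuclideanSpace ℝ (Fin d), killingMetric G x y = ∑ a, J x a * J y a := by
    intro x y
    rw [← hJ, PiLp.inner_apply]
    exact Finset.sum_congr rfl fun a _ => by simp [mul_comm]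
  have h1 : ∀ a, c₀ * ∑ μ, ∑ l, J (F μ l) a * J (F μ l) a ≤
      (∑ α, ∑ β, ∑ l, ricci g e α β y * (J (F α l) a * J (F β l) a)) -
      1 / 2 * ∑ α, ∑ β, ∑ μ, ∑ l, riemann g e α β μ l y * (J (F α β) a * J (F μ l) a) := by
    intro a
    -- Each coordinate of F in the isometric embedding is a real skew matrix, to which the curvature
    -- condition applies. At the centre, raising indices does nothing.
    have h2 := hg e h.mem_atlas y h.mem_target (Matrix.of fun μ l => J (F μ l) a) (by
      ext μ l
      simp [hF l μ])
    simpa only [formNormSq, weitzenboeck, h.invMetric_eq, one_mul, mul_one, Matrix.of_apply,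
      mul_assoc] using h2
  have h2 := Finset.sum_le_sum fun a (_ : a ∈ Finset.univ) => h1 a
  simp only [Finset.sum_sub_distrib, ← Finset.mul_sum] at h2
  simp only [hk]
  have e1 : ∑ a, ∑ μ, ∑ l, J (F μ l) a * J (F μ l) a =
      ∑ μ, ∑ l, ∑ a, J (F μ l) a * J (F μ l) a := by
    rw [Finset.sum_comm]
    exact Finset.sum_congr rfl fun _ _ => Finset.sum_comm
  have e2 : ∑ a, ∑ α, ∑ β, ricci g e α β y * ∑ l, (J (F α l) a * J (F β l) a) =
      ∑ α, ∑ β, ricci g e α β y * ∑ l, ∑ a, J (F α l) a * J (F β l) a := by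
    rw [Finset.sum_comm]
    refine Finset.sum_congr rfl fun _ _ => ?_
    rw [Finset.sum_comm]
    refine Finset.sum_congr rfl fun _ _ => ?_
    rw [← Finset.mul_sum, Finset.sum_comm]
  have e3 : ∑ a, ∑ α, ∑ β, ∑ μ, ∑ l, riemann g e α β μ l y * (J (F α β) a * J (F μ l) a) =
      ∑ α, ∑ β, ∑ μ, ∑ l, riemann g e α β μ l y * ∑ a, J (F α β) a * J (F μ l) a := by
    rw [Finset.sum_comm]
    refine Finset.sum_congr rfl fun _ _ => ?_
    rw [Finset.sum_comm]
    refine Finset.sum_congr rfl fun _ _ => ?_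
    rw [Finset.sum_comm]
    refine Finset.sum_congr rfl fun _ _ => ?_
    rw [Finset.sum_comm]
    exact Finset.sum_congr rfl fun _ _ => (Finset.mul_sum _ _ _).symm
  simp only [← Finset.mul_sum] at e3
  rw [e1, e2, e3] at h2
  simp only [← Finset.mul_sum]
  linarith

lemma IsNormalAt.energyIn_eq {g : RMetric n M} (h : IsNormalAt g e y) :
    energyIn A g i e y = ∑ μ, ∑ l, killingMetric G (A.fieldStrength i e μ l y)
      (A.fieldStrength i e μ l y) := by
  simp only [energyIn, h.invMetric_eq, mul_assoc, ← Finset.mul_sum, sum_one_mul]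

lemma IsNormalAt.killingMetric_le_energyIn {g : RMetric n M} (h : IsNormalAt g e y) (μ l : Fin n) :
    killingMetric G (A.fieldStrength i e μ l y) (A.fieldStrength i e μ l y) ≤
      energyIn A g i e y := by
  rw [h.energyIn_eq A]
  exact (Finset.single_le_sum (f := fun l => killingMetric G (A.fieldStrength i e μ l y)
    (A.fieldStrength i e μ l y)) (fun _ _ => killingMetric_self_nonneg _)
    (Finset.mem_univ l)).trans (Finset.single_le_sum (f := fun μ => ∑ l, killingMetric G
      (A.fieldStrength i e μ l y) (A.fieldStrength i e μ l y))
      (fun _ _ => Finset.sum_nonneg fun _ _ => killingMetric_self_nonneg _) (Finset.mem_univ μ))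

lemma IsNormalAt.energyIn_nonneg {g : RMetric n M} (h : IsNormalAt g e y) :
    0 ≤ energyIn A g i e y := by
  rw [h.energyIn_eq A]
  exact Finset.sum_nonneg fun _ _ => Finset.sum_nonneg fun _ _ => killingMetric_self_nonneg _

/-- Kato's inequality. -/
lemma IsNormalAt.sq_partialDeriv_energyIn_le {g : RMetric n M} (h : IsNormalAt g e y)
    (hy : y ∈ chartDomain P i e) (k : Fin n) :
    partialDeriv k (energyIn A g i e) y ^ 2 ≤ 4 * energyIn A g i e y *
      ∑ μ, ∑ l, killingMetric G (covD A i e k (A.fieldStrength i e μ l) y)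
        (covD A i e k (A.fieldStrength i e μ l) y) := by
  rw [h.partialDeriv_energyIn A hy, h.energyIn_eq A]
  simp only [← Finset.sum_product', Finset.univ_product_univ]
  set D := fun p : Fin n × Fin n => covD A i e k (A.fieldStrength i e p.1 p.2) y
  set F := fun p : Fin n × Fin n => A.fieldStrength i e p.1 p.2 y
  -- Cauchy–Schwarz is used twice: for the Killing metric at each index pair, then for the sum over
  -- index pairs.
  have h1 : |∑ p, killingMetric G (D p) (F p)| ≤
      ∑ p, √(killingMetric G (D p) (D p)) * √(killingMetric G (F p) (F p)) := by
    refine (Finset.abs_sum_le_sum_abs _ _).trans (Finset.sum_le_sum fun p _ => ?_)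
    rw [← Real.sqrt_mul (killingMetric_self_nonneg _)]
    exact Real.abs_le_sqrt (killingMetric_sq_le _ _)
  have h2 := Finset.sum_mul_sq_le_sq_mul_sq Finset.univ
    (fun p => √(killingMetric G (D p) (D p))) (fun p => √(killingMetric G (F p) (F p)))
  simp only [Real.sq_sqrt (killingMetric_self_nonneg _)] at h2
  have h3 := (sq_le_sq₀ (abs_nonneg _) ((abs_nonneg _).trans h1)).2 h1
  rw [sq_abs] at h3
  calc (2 * ∑ p, killingMetric G (D p) (F p)) ^ 2 = 4 * (∑ p, killingMetric G (D p) (F p)) ^ 2 := by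
        ring
    _ ≤ 4 * ((∑ p, killingMetric G (D p) (D p)) * ∑ p, killingMetric G (F p) (F p)) := by
        linarith
    _ = _ := by ring

/-- The Bochner inequality for Yang-Mills connections, at the centre of a normal chart. -/
lemma IsNormalAt.bochner_le {g : RMetric n M} (h : IsNormalAt g e y) {c₀ : ℝ}
    (hg : CurvatureCondition g c₀) (hA : A.IsYangMills g) (hy : y ∈ chartDomain P i e)
    {ε : ℝ} (hε : 0 < ε) :
    (∑ k, partialDeriv k (energyIn A g i e) y ^ 2) / (4 * (energyIn A g i e y + ε)) +
      2 * c₀ * energyIn A g i e y - 2 * n ^ 3 * (energyIn A g i e y * √(energyIn A g i e y)) ≤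
    1 / 2 * ∑ k, partialDeriv k (partialDeriv k (energyIn A g i e)) y := by
  set w := energyIn A g i e y with hw
  have hw0 : 0 ≤ w := h.energyIn_nonneg A
  rw [h.bochner A hy hA]
  set D := ∑ k, ∑ μ, ∑ l, killingMetric G (covD A i e k (A.fieldStrength i e μ l) y)
        (covD A i e k (A.fieldStrength i e μ l) y) with hD
  have hD0 : 0 ≤ D := Finset.sum_nonneg fun _ _ => Finset.sum_nonneg fun _ _ =>
    Finset.sum_nonneg fun _ _ => killingMetric_self_nonneg _
  -- Kato's inequality; ε > 0 makes the quotient meaningful where F vanishes and only weakens the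
  -- bound.
  have h1 : (∑ k, partialDeriv k (energyIn A g i e) y ^ 2) / (4 * (w + ε)) ≤ D := by
    rw [div_le_iff₀ (by positivity)]
    calc _ ≤ 4 * w * D := by
          rw [hD, Finset.mul_sum]
          exact Finset.sum_le_sum fun k _ => h.sq_partialDeriv_energyIn_le A hy k
      _ ≤ D * (4 * (w + ε)) := by nlinarith
  have h2 := h.le_curvature (G := G) hg (fun μ l => A.fieldStrength i e μ l y)
    fun μ l => fieldStrength_skew A i μ l y
  rw [← h.energyIn_eq A, ← hw] at h2
  -- The factor n³ counts the index triples, each term being at most w^{3/2}.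
  have h3 : |∑ k, ∑ μ, ∑ l, killingMetric G (bracket G (A.fieldStrength i e k μ y)
      (A.fieldStrength i e k l y)) (A.fieldStrength i e μ l y)| ≤ n ^ 3 * (w * √w) := by
    have h4 : ∀ k μ l, |killingMetric G (bracket G (A.fieldStrength i e k μ y)
        (A.fieldStrength i e k l y)) (A.fieldStrength i e μ l y)| ≤ w * √w := fun k μ l =>
      abs_killingMetric_bracket_le (h.killingMetric_le_energyIn A k μ)
        (h.killingMetric_le_energyIn A k l) (h.killingMetric_le_energyIn A μ l)
    calc _ ≤ ∑ k : Fin n, ∑ μ : Fin n, ∑ l : Fin n, w * √w :=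
          (Finset.abs_sum_le_sum_abs _ _).trans <| Finset.sum_le_sum fun k _ =>
          (Finset.abs_sum_le_sum_abs _ _).trans <| Finset.sum_le_sum fun μ _ =>
          (Finset.abs_sum_le_sum_abs _ _).trans <| Finset.sum_le_sum fun l _ => h4 k μ l
      _ = n ^ 3 * (w * √w) := by simp; ring
  have h5 := (abs_le.1 h3).1
  linarith

end BochnerInequality

/-! ### Construction of first-order normal charts. -/

section NormalChart

variable {n : ℕ} {M : Type*} [TopologicalSpace M]
    [ChartedSpace (EuclideanSpace ℝ (Fin n)) M] [IsManifold (𝓡 n) ∞ M]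
  {e : OpenPartialHomeomorph M (EuclideanSpace ℝ (Fin n))}

/-- A smooth map that is a local diffeomorphism at `0` can be used as a change of coordinates. -/
lemma exists_chart_of_contDiff (he : e ∈ IsManifold.maximalAtlas (𝓡 n) ∞ M)
    {τ : EuclideanSpace ℝ (Fin n) → EuclideanSpace ℝ (Fin n)} (hτ : ContDiff ℝ ∞ τ)
    (h0 : τ 0 ∈ e.target) (hinj : Function.Injective (fderiv ℝ τ 0)) :
    ∃ e' ∈ IsManifold.maximalAtlas (𝓡 n) ∞ M, 0 ∈ overlap e' e ∧ e'.symm 0 = e.symm (τ 0) ∧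
      coordChange e' e =ᶠ[𝓝 0] τ := by
  let L : EuclideanSpace ℝ (Fin n) ≃L[ℝ] EuclideanSpace ℝ (Fin n) :=
    (LinearEquiv.ofInjectiveEndo (fderiv ℝ τ 0 : EuclideanSpace ℝ (Fin n) →ₗ[ℝ] _)
      hinj).toContinuousLinearEquiv
  have hL : (L : EuclideanSpace ℝ (Fin n) →L[ℝ] EuclideanSpace ℝ (Fin n)) = fderiv ℝ τ 0 := by
    ext v
    rfl
  have hd : HasFDerivAt τ (L : EuclideanSpace ℝ (Fin n) →L[ℝ] EuclideanSpace ℝ (Fin n)) 0 := by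
    rw [hL]
    exact (hτ.differentiable (by simp) 0).hasFDerivAt
  let ψ := hτ.contDiffAt.toOpenPartialHomeomorph τ hd (by simp)
  have hψ : ∀ z, ψ z = τ z := fun z => rfl
  -- The inverse function theorem gives smoothness of the inverse only where Dτ is invertible.
  -- Shrinking the domain to the open set of such points makes the inverse smooth on its whole
  -- domain.
  let U := fderiv ℝ τ ⁻¹' range ((↑) : (EuclideanSpace ℝ (Fin n) ≃L[ℝ] EuclideanSpace ℝ (Fin n)) →
      EuclideanSpace ℝ (Fin n) →L[ℝ] EuclideanSpace ℝ (Fin n))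
  have hU : IsOpen U := (hτ.continuous_fderiv (by simp)).isOpen_preimage _
    ContinuousLinearEquiv.isOpen
  let ψ' := ψ.restrOpen U hU
  have hψ'0 : 0 ∈ ψ'.source := by
    refine ⟨ContDiffAt.mem_toOpenPartialHomeomorph_source _ hd _, L, hL⟩
  have hsymm : ContDiffOn ℝ ∞ ψ'.symm ψ'.target := by
    intro z hz
    have h1 : ψ'.symm z ∈ U := (ψ'.map_target hz).2
    obtain ⟨L', hL'⟩ := h1
    refine (ψ'.contDiffAt_symm hz (f₀' := L') ?_ hτ.contDiffAt).contDiffWithinAt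
    rw [hL']
    exact (hτ.differentiable (by simp) _).hasFDerivAt
  let e' := e.trans ψ'.symm
  have hsrc : e'.source = e.source ∩ e ⁻¹' ψ'.target := e.trans_source _
  have htgt : e'.target = ψ'.source ∩ τ ⁻¹' e.target := e.trans_target _
  have h0' : 0 ∈ e'.target := by
    rw [htgt]
    exact ⟨hψ'0, h0⟩
  have hs : ∀ z, e'.symm z = e.symm (τ z) := fun z => rfl
  refine ⟨e', ?_, ⟨h0', ?_⟩, rfl, ?_⟩
  · apply OpenPartialHomeomorph.mem_maximalAtlas_of_contMDiffOn
    · refine (contMDiffOn_iff_contDiffOn.2 hsymm).comp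
        ((contMDiffOn_of_mem_maximalAtlas he).mono ?_) ?_
      · rw [hsrc]; exact inter_subset_left
      · rw [hsrc]; exact fun z hz => hz.2
    · refine (contMDiffOn_symm_of_mem_maximalAtlas he).comp
        (contMDiffOn_iff_contDiffOn.2 hτ.contDiffOn) ?_
      rw [htgt]
      exact fun z hz => hz.2
  · simp only [mem_preimage, hs]
    exact e.map_target h0
  · filter_upwards [e'.open_target.mem_nhds h0'] with z hz
    rw [htgt] at hz
    rw [coordChange, hs, e.right_inv hz.2]

lemma partialDeriv_coord (i : Fin n) (k : Fin n) (y : EuclideanSpace ℝ (Fin n)) :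
    partialDeriv k (fun z : EuclideanSpace ℝ (Fin n) => z i) y =
      (1 : Matrix (Fin n) (Fin n) ℝ) i k := by
  have : fderiv ℝ (fun z : EuclideanSpace ℝ (Fin n) => z i) y = EuclideanSpace.proj i :=
    (EuclideanSpace.proj (𝕜 := ℝ) i).fderiv
  rw [partialDeriv, this]
  simp [Matrix.one_apply, Pi.single_apply]

lemma clm_injective_of_matrix {L : EuclideanSpace ℝ (Fin n) →L[ℝ] EuclideanSpace ℝ (Fin n)}
    {B : Matrix (Fin n) (Fin n) ℝ}
    (hB : B * Matrix.of (fun i j => L (EuclideanSpace.single j 1) i) = 1) :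
    Function.Injective L := by
  rw [injective_iff_map_eq_zero]
  intro v hv
  have h1 : (Matrix.of (fun i j => L (EuclideanSpace.single j 1) i)).mulVec v.ofLp = 0 := by
    ext i
    have := congrArg (fun w : EuclideanSpace ℝ (Fin n) => w i) hv
    simp only [clm_eq_sum L v] at this
    simpa [Matrix.mulVec, dotProduct, mul_comm] using this
  have h2 : v.ofLp = 0 := by
    rw [← Matrix.one_mulVec v.ofLp, ← hB, ← Matrix.mulVec_mulVec, h1, Matrix.mulVec_zero]
  ext i
  exact congrFun h2 i

variable (g : RMetric n M)

open scoped MatrixOrder Matrix.Norms.L2Operator in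
-- In the C⋆-algebra of matrices, non-negative elements are exactly those of the form B⋆B.
lemma exists_conjTranspose_mul_self {A : Matrix (Fin n) (Fin n) ℝ} (hA : A.PosSemidef) :
    ∃ B : Matrix (Fin n) (Fin n) ℝ, A = B.conjTranspose * B :=
  CStarAlgebra.nonneg_iff_eq_star_mul_self.1 (Matrix.nonneg_iff_posSemidef.2 hA)

/-- Factor the metric at the point as BᵀB; the affine change of coordinates with linear part B⁻¹
turns it into the identity matrix. -/
lemma exists_chart_metricCoeff_eq_one (he : e ∈ IsManifold.maximalAtlas (𝓡 n) ∞ M)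
    {y} (hy : y ∈ e.target) : ∃ e' ∈ IsManifold.maximalAtlas (𝓡 n) ∞ M, 0 ∈ e'.target ∧
      e'.symm 0 = e.symm y ∧ metricCoeff g e' 0 = 1 := by
  obtain ⟨B, hB⟩ := exists_conjTranspose_mul_self
    (metricCoeff_posDef he g hy).posSemidef
  have hdet : IsUnit B.det := by
    have := (metricCoeff_posDef he g hy).det_pos.ne'
    rw [hB, Matrix.det_mul] at this
    exact (right_ne_zero_of_mul this).isUnit
  set L := Matrix.toEuclideanCLM (𝕜 := ℝ) B⁻¹ with hL
  let τ : EuclideanSpace ℝ (Fin n) → EuclideanSpace ℝ (Fin n) := fun z => y + L z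
  have hτ : ContDiff ℝ ∞ τ := contDiff_const.add L.contDiff
  have hτ0 : τ 0 = y := by simp [τ]
  have hd : fderiv ℝ τ 0 = L := by
    simp only [τ]
    rw [fderiv_const_add]
    exact L.fderiv
  have hLe : Matrix.of (fun i j => L (EuclideanSpace.single j 1) i) = B⁻¹ := by
    ext i j
    simp [hL]
  obtain ⟨e', he', h0, h1, h2⟩ := exists_chart_of_contDiff he hτ (by rwa [hτ0]) (by
    rw [hd]
    refine clm_injective_of_matrix (B := B) ?_
    rw [hLe, Matrix.mul_nonsing_inv _ hdet])
  refine ⟨e', he', h0.1, by rw [h1, hτ0], ?_⟩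
  have hJ : jacobian e' e 0 = B⁻¹ := by
    rw [← hLe]
    ext i j
    simp only [jacobian, Matrix.of_apply]
    rw [partialDeriv_congr h2, partialDeriv, hd]
  rw [metricCoeff_coordChange he he' g h0, hJ, h2.eq_of_nhds, hτ0, hB,
    Matrix.conjTranspose_eq_transpose_of_trivial, ← Matrix.mul_assoc, ← Matrix.transpose_mul,
    Matrix.mul_nonsing_inv _ hdet, Matrix.transpose_one, one_mul, Matrix.mul_nonsing_inv _ hdet]

/-- The existence of charts that are normal to first order at a given point. -/
lemma exists_isNormalAt (he : e ∈ IsManifold.maximalAtlas (𝓡 n) ∞ M)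
    {y} (hy : y ∈ e.target) : ∃ e', IsNormalAt g e' 0 ∧ e'.symm 0 = e.symm y := by
  obtain ⟨e₁, he₁, h0, h0y, hone⟩ := exists_chart_metricCoeff_eq_one g he hy
  -- `q` is minus the Christoffel symbol at the centre, where the metric is already the identity.
  -- The change of coordinates z + ½q(z,z) removes the first derivatives of the metric.
  let q : Fin n → Fin n → EuclideanSpace ℝ (Fin n) := fun i j => WithLp.toLp 2 fun a =>
    - (1 / 2) * (partialDeriv i (fun z => metricCoeff g e₁ z j a) 0 +
      partialDeriv j (fun z => metricCoeff g e₁ z i a) 0 -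
      partialDeriv a (fun z => metricCoeff g e₁ z i j) 0)
  have hq : ∀ i j a, q i j a = - (1 / 2) * (partialDeriv i (fun z => metricCoeff g e₁ z j a) 0 +
      partialDeriv j (fun z => metricCoeff g e₁ z i a) 0 -
      partialDeriv a (fun z => metricCoeff g e₁ z i j) 0) := fun _ _ _ => rfl
  have hqs : ∀ i j a, q i j a = q j i a := fun i j a => by
    simp only [hq, metricCoeff_comm i j]; ring
  let R : EuclideanSpace ℝ (Fin n) → EuclideanSpace ℝ (Fin n) := fun z =>
    ∑ b, ∑ c, (1 / 2 * (z b * z c)) • q b c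
  let τ : EuclideanSpace ℝ (Fin n) → EuclideanSpace ℝ (Fin n) := fun z => z + R z
  have hcoord : ∀ b : Fin n, ContDiff ℝ ∞ fun z : EuclideanSpace ℝ (Fin n) => z b := fun b =>
    (EuclideanSpace.proj (𝕜 := ℝ) b).contDiff
  have hcoordd : ∀ (b : Fin n) z, DifferentiableAt ℝ (fun z : EuclideanSpace ℝ (Fin n) => z b) z :=
    fun b z => (hcoord b).differentiable (by simp) z
  have hterm : ∀ b c, ContDiff ℝ ∞ fun z : EuclideanSpace ℝ (Fin n) =>
      (1 / 2 * (z b * z c)) • q b c := fun b c =>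
    (contDiff_const.mul ((hcoord b).mul (hcoord c))).smul contDiff_const
  have hR : ContDiff ℝ ∞ R := ContDiff.sum fun b _ => ContDiff.sum fun c _ => hterm b c
  have hτ : ContDiff ℝ ∞ τ := contDiff_id.add hR
  have hτ0 : τ 0 = 0 := by simp [τ, R]
  have hRd : ∀ i z, partialDeriv i R z = ∑ c, z c • q i c := by
    intro i z
    have h1 : ∀ b c, partialDeriv i (fun z : EuclideanSpace ℝ (Fin n) =>
        (1 / 2 * (z b * z c)) • q b c) z =
        (1 / 2 * (1 : Matrix (Fin n) (Fin n) ℝ) b i) • (z c • q b c) +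
        (1 / 2 * (1 : Matrix (Fin n) (Fin n) ℝ) c i) • (z b • q b c) := by
      intro b c
      rw [partialDeriv_smul (((differentiableAt_const _).fun_mul
        ((hcoordd b z).fun_mul (hcoordd c z)))) (differentiableAt_const _), partialDeriv_const,
        partialDeriv_mul (differentiableAt_const _) ((hcoordd b z).fun_mul (hcoordd c z)),
        partialDeriv_const, partialDeriv_mul (hcoordd b z) (hcoordd c z), partialDeriv_coord,
        partialDeriv_coord, smul_zero, add_zero, smul_smul, smul_smul, ← add_smul]
      congr 1
      ring
    have h2 : partialDeriv i R z = ∑ b, ∑ c, partialDeriv i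
        (fun z : EuclideanSpace ℝ (Fin n) => (1 / 2 * (z b * z c)) • q b c) z := by
      have hd := fun b c => (hterm b c).differentiable (by simp) z
      refine (partialDeriv_sum fun b _ => DifferentiableAt.fun_sum fun c _ => hd b c).trans ?_
      exact Finset.sum_congr rfl fun b _ => partialDeriv_sum fun c _ => hd b c
    have hq2 : ∀ b, q b i = q i b := fun b => by ext a; exact hqs b i a
    rw [h2]
    simp only [h1, Finset.sum_add_distrib]
    rw [Finset.sum_comm]
    simp only [Matrix.one_apply, mul_ite, mul_one, mul_zero, ite_smul, zero_smul,
      Finset.sum_ite_eq', Finset.mem_univ, if_true, hq2, ← Finset.sum_add_distrib, ← add_smul]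
    norm_num
  have hτd : ∀ i z, partialDeriv i τ z = EuclideanSpace.single i 1 + ∑ c, z c • q i c := by
    intro i z
    have h1 : partialDeriv i τ z = partialDeriv i (fun z => z) z + partialDeriv i R z :=
      partialDeriv_add differentiableAt_id (hR.differentiable (by simp) z)
    rw [h1, hRd, partialDeriv, fderiv_fun_id]
    rfl
  obtain ⟨e', he', h0', h1, h2⟩ := exists_chart_of_contDiff he₁ hτ (by rwa [hτ0]) (by
    refine clm_injective_of_matrix (B := 1) ?_
    rw [one_mul]
    ext i j
    have := hτd j 0
    rw [partialDeriv] at this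
    simp [this, Matrix.one_apply, Pi.single_apply])
  have hJ : ∀ᶠ z in 𝓝 (0 : EuclideanSpace ℝ (Fin n)), ∀ a i, jacobian e' e₁ z a i =
      (1 : Matrix (Fin n) (Fin n) ℝ) a i + ∑ c, z c * q i c a := by
    filter_upwards [h2.eventually_nhds] with z hz a i
    simp only [jacobian, Matrix.of_apply]
    rw [partialDeriv_congr hz, hτd]
    simp [Matrix.one_apply, Pi.single_apply]
  have hJ0 : jacobian e' e₁ 0 = 1 := by
    ext a i
    simp [hJ.self_of_nhds]
  refine ⟨e', ⟨he', h0'.1, ?_, ?_⟩, by rw [h1, hτ0, h0y]⟩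
  · rw [metricCoeff_coordChange he₁ he' g h0', hJ0, h2.eq_of_nhds, hτ0, hone]
    simp
  · intro i j k
    have h3 : (fun z => metricCoeff g e' z i j) =ᶠ[𝓝 0] fun z => ∑ b, (∑ a,
        ((1 : Matrix (Fin n) (Fin n) ℝ) a i + ∑ c, z c * q i c a) * metricCoeff g e₁ (τ z) a b) *
        ((1 : Matrix (Fin n) (Fin n) ℝ) b j + ∑ c, z c * q j c b) := by
      filter_upwards [h2, hJ, (isOpen_overlap e₁ e').mem_nhds h0'] with z hz hJz hzo
      rw [metricCoeff_coordChange he₁ he' g hzo, hz]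
      simp only [Matrix.mul_apply, Matrix.transpose_apply, hJz]
    have hl : ∀ i a, DifferentiableAt ℝ (fun z : EuclideanSpace ℝ (Fin n) =>
        (1 : Matrix (Fin n) (Fin n) ℝ) a i + ∑ c, z c * q i c a) 0 := fun i a =>
      (differentiableAt_const _).fun_add (DifferentiableAt.fun_sum fun c _ =>
        (hcoordd c 0).fun_mul (differentiableAt_const _))
    have hld : ∀ i a, partialDeriv k (fun z : EuclideanSpace ℝ (Fin n) =>
        (1 : Matrix (Fin n) (Fin n) ℝ) a i + ∑ c, z c * q i c a) 0 = q i k a := by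
      intro i a
      rw [partialDeriv_add (differentiableAt_const _) (DifferentiableAt.fun_sum fun c _ =>
        (hcoordd c 0).fun_mul (differentiableAt_const _)), partialDeriv_const, zero_add,
        partialDeriv_sum fun c _ => (hcoordd c 0).fun_mul (differentiableAt_const _)]
      simp only [partialDeriv_mul (hcoordd _ 0) (differentiableAt_const _), partialDeriv_coord,
        partialDeriv_const, mul_zero, add_zero]
      simp [Matrix.one_apply]
    have hg : ∀ a b, DifferentiableAt ℝ (fun z => metricCoeff g e₁ z a b) (τ 0) := fun a b => by
      rw [hτ0]
      exact (contDiffAt_metricCoeff he₁ h0 a b).differentiableAt_infty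
    have hτD := hτ.differentiable (by simp) 0
    have hgτ : ∀ a b, DifferentiableAt ℝ (fun z => metricCoeff g e₁ (τ z) a b) 0 := fun a b =>
      DifferentiableAt.comp (f := τ) (g := fun z => metricCoeff g e₁ z a b) 0 (hg a b) hτD
    have hgd : ∀ a b, partialDeriv k (fun z => metricCoeff g e₁ (τ z) a b) 0 =
        partialDeriv k (fun z => metricCoeff g e₁ z a b) 0 := by
      intro a b
      rw [partialDeriv_comp (f := fun z => metricCoeff g e₁ z a b) (hg a b) hτD, hτ0]
      simp [hτd, Pi.single_apply]
    have hprod : ∀ b, DifferentiableAt ℝ (fun z : EuclideanSpace ℝ (Fin n) => ∑ a,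
        ((1 : Matrix (Fin n) (Fin n) ℝ) a i + ∑ c, z c * q i c a) *
        metricCoeff g e₁ (τ z) a b) 0 := fun b =>
      DifferentiableAt.fun_sum fun a _ => (hl i a).fun_mul (hgτ a b)
    rw [partialDeriv_congr h3, partialDeriv_sum fun b _ => (hprod b).fun_mul (hl j b)]
    simp only [partialDeriv_mul (hprod _) (hl j _)]
    rw [Finset.sum_congr rfl fun b _ => by
      rw [partialDeriv_sum fun a _ => (hl i a).fun_mul (hgτ a b)]]
    simp only [partialDeriv_mul (hl i _) (hgτ _ _), hld, hgd]
    simp only [hτ0, hone, PiLp.zero_apply, zero_mul,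
      Finset.sum_const_zero, add_zero, Finset.sum_add_distrib, add_mul, sum_mul_one]
    have e1 : ∀ f : Fin n → ℝ, ∑ a, (1 : Matrix (Fin n) (Fin n) ℝ) a i * f a = f i := fun f => by
      simp [Matrix.one_apply]
    simp only [e1, sum_mul_one, sum_one_mul, hq]
    -- What remains is ∂_k g_{ij} plus the j-th component of q(i,k) plus the i-th component of
    -- q(j,k). The last two sum to −∂_k g_{ij}.
    simp only [metricCoeff_comm k j, metricCoeff_comm k i, metricCoeff_comm j i]
    ring

end NormalChart

/-! ### The Riemannian volume measure. -/

section Volume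

variable {n : ℕ} {M : Type*} [TopologicalSpace M]
    [ChartedSpace (EuclideanSpace ℝ (Fin n)) M] [IsManifold (𝓡 n) ∞ M]
  {e e' : OpenPartialHomeomorph M (EuclideanSpace ℝ (Fin n))}

/-- The density `√(det g_{ij})` of the Riemannian volume in the chart `e`. -/
def volDensity (g : RMetric n M) (e : OpenPartialHomeomorph M (EuclideanSpace ℝ (Fin n)))
    (y : EuclideanSpace ℝ (Fin n)) : ℝ := Real.sqrt (metricCoeff g e y).det

lemma contDiffAt_volDensity (he : e ∈ IsManifold.maximalAtlas (𝓡 n) ∞ M) (g : RMetric n M) {y}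
    (hy : y ∈ e.target) : ContDiffAt ℝ ∞ (volDensity g e) y := by
  have h1 : ContDiffAt ℝ ∞ (fun z => (metricCoeff g e z).det) y :=
    (contDiffOn_det fun i j => contMDiffOn_inner_coordVector he g i j).contDiffAt
      (e.open_target.mem_nhds hy)
  exact h1.sqrt (metricCoeff_det_pos he g hy).ne'

lemma volDensity_pos (he : e ∈ IsManifold.maximalAtlas (𝓡 n) ∞ M) (g : RMetric n M) {y}
    (hy : y ∈ e.target) : 0 < volDensity g e y :=
  Real.sqrt_pos.2 (metricCoeff_det_pos he g hy)

lemma continuousOn_volDensity (he : e ∈ IsManifold.maximalAtlas (𝓡 n) ∞ M) (g : RMetric n M) :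
    ContinuousOn (volDensity g e) e.target := fun _ hy =>
  (contDiffAt_volDensity he g hy).continuousAt.continuousWithinAt

lemma aemeasurable_volDensity (he : e ∈ IsManifold.maximalAtlas (𝓡 n) ∞ M) (g : RMetric n M) :
    AEMeasurable (fun y => ENNReal.ofReal (volDensity g e y)) (volume.restrict e.target) :=
  ((continuousOn_volDensity he g).aemeasurable e.open_target.measurableSet).ennreal_ofReal

variable [MeasurableSpace M] [BorelSpace M]

lemma aemeasurable_symm (e : OpenPartialHomeomorph M (EuclideanSpace ℝ (Fin n))) :
    AEMeasurable e.symm (volume.restrict e.target) :=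
  e.continuousOn_symm.aemeasurable e.open_target.measurableSet

lemma measurableSet_target_inter_preimage
    (e : OpenPartialHomeomorph M (EuclideanSpace ℝ (Fin n))) {S : Set M} (hS : MeasurableSet S) :
    MeasurableSet (e.target ∩ e.symm ⁻¹' S) := by
  have h1 : Measurable (e.target.domRestrict e.symm) :=
    (continuousOn_iff_continuous_domRestrict.1 e.continuousOn_symm).measurable
  have h2 := e.open_target.measurableSet.subtype_image (h1 hS)
  convert h2 using 1
  ext z
  simp [Set.domRestrict, and_comm]

lemma chartVolume_apply (g : RMetric n M) (e : OpenPartialHomeomorph M (EuclideanSpace ℝ (Fin n)))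
    {S : Set M} (hS : MeasurableSet S) : chartVolume g e S =
      ∫⁻ y in e.target ∩ e.symm ⁻¹' S, ENNReal.ofReal (volDensity g e y) := by
  rw [chartVolume, Measure.map_apply_of_aemeasurable ((aemeasurable_symm e).mono_ac
    (withDensity_absolutelyContinuous _ _)) hS, withDensity_apply',
    Measure.restrict_restrict' e.open_target.measurableSet, inter_comm]
  simp only [volDensity]

lemma det_fderiv_eq (τ : EuclideanSpace ℝ (Fin n) → EuclideanSpace ℝ (Fin n)) (y) :
    (fderiv ℝ τ y).det = (Matrix.of fun i j => partialDeriv j τ y i).det := by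
  rw [ContinuousLinearMap.det,
    ← LinearMap.det_toMatrix (EuclideanSpace.basisFun (Fin n) ℝ).toBasis]
  congr 1

/-- From g' = JᵀgJ the determinant acquires the factor (det J)², whose root is |det J|. -/
lemma volDensity_coordChange (he : e ∈ IsManifold.maximalAtlas (𝓡 n) ∞ M)
    (he' : e' ∈ IsManifold.maximalAtlas (𝓡 n) ∞ M) (g : RMetric n M) {y}
    (hy : y ∈ overlap e' e) : volDensity g e' y =
      |(fderiv ℝ (coordChange e' e) y).det| * volDensity g e (coordChange e' e y) := by
  rw [volDensity, metricCoeff_coordChange he he' g hy, Matrix.det_mul, Matrix.det_mul,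
    Matrix.det_transpose, det_fderiv_eq, volDensity, ← Real.sqrt_sq_eq_abs, ← Real.sqrt_mul
    (sq_nonneg _)]
  congr 1
  rw [jacobian]
  ring

/-- The change of variables formula: the Jacobian factor of the integral is the one by which the
densities differ. -/
lemma chartVolume_congr (he : e ∈ IsManifold.maximalAtlas (𝓡 n) ∞ M)
    (he' : e' ∈ IsManifold.maximalAtlas (𝓡 n) ∞ M) (g : RMetric n M) {S : Set M}
    (hS : MeasurableSet S) (h1 : S ⊆ e.source) (h2 : S ⊆ e'.source) :
    chartVolume g e S = chartVolume g e' S := by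
  rw [chartVolume_apply g e hS, chartVolume_apply g e' hS]
  have hsub : ∀ y ∈ e'.target ∩ e'.symm ⁻¹' S, y ∈ overlap e' e := fun y hy => ⟨hy.1, h1 hy.2⟩
  have himg : e.target ∩ e.symm ⁻¹' S = coordChange e' e '' (e'.target ∩ e'.symm ⁻¹' S) := by
    ext z
    constructor
    · rintro ⟨hz, hzS⟩
      have hz' : z ∈ overlap e e' := ⟨hz, h2 hzS⟩
      refine ⟨coordChange e e' z, ⟨(coordChange_mem _ _ hz').1, ?_⟩,
        coordChange_coordChange _ _ hz'⟩
      rw [mem_preimage, symm_coordChange _ _ hz']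
      exact hzS
    · rintro ⟨y, hy, rfl⟩
      refine ⟨(coordChange_mem _ _ (hsub y hy)).1, ?_⟩
      rw [mem_preimage, symm_coordChange _ _ (hsub y hy)]
      exact hy.2
  rw [himg, lintegral_image_eq_lintegral_abs_det_fderiv_mul volume
    (measurableSet_target_inter_preimage e' hS)
    (fun y hy => (differentiableAt_coordChange he he'
      (hsub y hy)).hasFDerivAt.hasFDerivWithinAt)]
  · refine setLIntegral_congr_fun (measurableSet_target_inter_preimage e' hS) fun y hy => ?_
    rw [volDensity_coordChange he he' g (hsub y hy), ENNReal.ofReal_mul (abs_nonneg _)]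
  · intro y hy z hz hyz
    rw [← coordChange_coordChange _ _ (hsub y hy), hyz, coordChange_coordChange _ _ (hsub z hz)]

lemma chartVolume_compl_source (g : RMetric n M)
    (e : OpenPartialHomeomorph M (EuclideanSpace ℝ (Fin n))) :
    chartVolume g e e.sourceᶜ = 0 := by
  rw [chartVolume_apply g e e.open_source.measurableSet.compl]
  have : e.target ∩ e.symm ⁻¹' e.sourceᶜ = ∅ := by
    ext z
    simp only [mem_inter_iff, mem_preimage, mem_compl_iff, mem_empty_iff_false, iff_false, not_and,
      not_not]
    exact fun hz => e.map_target hz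
  rw [this, Measure.restrict_empty, lintegral_zero_measure]

lemma chartVolume_inter_source (g : RMetric n M)
    (e : OpenPartialHomeomorph M (EuclideanSpace ℝ (Fin n))) (S : Set M) :
    chartVolume g e (S ∩ e.source) = chartVolume g e S := by
  refine measure_congr ?_
  have h : ∀ᵐ x ∂(chartVolume g e), x ∈ e.source := by
    rw [ae_iff]
    exact chartVolume_compl_source g e
  filter_upwards [h] with x hx
  simp only [eq_iff_iff]
  exact ⟨fun hx' => hx'.1, fun hx' => ⟨hx', hx⟩⟩

lemma chartVolume_restrict (he : e ∈ IsManifold.maximalAtlas (𝓡 n) ∞ M)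
    (he' : e' ∈ IsManifold.maximalAtlas (𝓡 n) ∞ M) (g : RMetric n M) :
    (chartVolume g e).restrict e'.source = (chartVolume g e').restrict e.source := by
  ext S hS
  rw [Measure.restrict_apply hS, Measure.restrict_apply hS, ← chartVolume_inter_source g e,
    ← chartVolume_inter_source g e', inter_assoc, inter_assoc, inter_comm e'.source]
  exact chartVolume_congr he he' g (hS.inter
    (e.open_source.measurableSet.inter e'.open_source.measurableSet))
    (inter_subset_right.trans inter_subset_left) (inter_subset_right.trans inter_subset_right)

/-- The measure of every chart in the atlas is bounded by that of `e` plus the volume outside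
`e.source`, since the two chart measures agree on the overlap. Hence so is the supremum. -/
lemma volumeMeasure_restrict_le (he : e ∈ IsManifold.maximalAtlas (𝓡 n) ∞ M) (g : RMetric n M) :
    (volumeMeasure g).restrict e.source ≤ chartVolume g e := by
  have h1 : volumeMeasure g ≤ chartVolume g e + (volumeMeasure g).restrict e.sourceᶜ := by
    refine iSup₂_le fun e' he' => ?_
    have he'' := IsManifold.subset_maximalAtlas (I := 𝓡 n) (n := ∞) he'
    rw [← Measure.restrict_add_restrict_compl (μ := chartVolume g e') e.open_source.measurableSet,
      chartVolume_restrict he'' he g]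
    exact add_le_add Measure.restrict_le_self (Measure.restrict_mono le_rfl
      (le_iSup₂ (f := fun e (_ : e ∈ atlas (EuclideanSpace ℝ (Fin n)) M) => chartVolume g e) e' he'))
  calc (volumeMeasure g).restrict e.source
      ≤ (chartVolume g e + (volumeMeasure g).restrict e.sourceᶜ).restrict e.source :=
        Measure.restrict_mono le_rfl h1
    _ = (chartVolume g e).restrict e.source := by
        rw [Measure.restrict_add, Measure.restrict_restrict e.open_source.measurableSet,
          inter_compl_self, Measure.restrict_empty, add_zero]
    _ ≤ chartVolume g e := Measure.restrict_le_self

lemma restrict_source_chartVolume (g : RMetric n M)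
    (e : OpenPartialHomeomorph M (EuclideanSpace ℝ (Fin n))) :
    (chartVolume g e).restrict e.source = chartVolume g e := by
  ext S hS
  rw [Measure.restrict_apply hS, chartVolume_inter_source]

lemma volumeMeasure_restrict_of_mem_atlas (he : e ∈ atlas (EuclideanSpace ℝ (Fin n)) M)
    (g : RMetric n M) : (volumeMeasure g).restrict e.source = chartVolume g e := by
  refine le_antisymm (volumeMeasure_restrict_le (IsManifold.subset_maximalAtlas he) g) ?_
  rw [← restrict_source_chartVolume g e]
  exact Measure.restrict_mono le_rfl
      (le_iSup₂ (f := fun e (_ : e ∈ atlas (EuclideanSpace ℝ (Fin n)) M) => chartVolume g e) e he)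

variable [CompactSpace M]

/-- The supremum runs over the atlas, while `e` may be any chart of the maximal atlas. Finitely many
atlas charts cover the compact manifold, and equality is checked on each of them. -/
lemma volumeMeasure_restrict (he : e ∈ IsManifold.maximalAtlas (𝓡 n) ∞ M) (g : RMetric n M) :
    (volumeMeasure g).restrict e.source = chartVolume g e := by
  obtain ⟨t, ht⟩ := CompactSpace.elim_nhds_subcover
    (fun x : M => (chartAt (EuclideanSpace ℝ (Fin n)) x).source)
    (fun x => chart_source_mem_nhds _ x)
  have h := (Measure.restrict_biUnion_congr (μ := (volumeMeasure g).restrict e.source)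
    (ν := chartVolume g e) t.countable_toSet
    (t := fun x : M => (chartAt (EuclideanSpace ℝ (Fin n)) x).source)).2 fun x _ => by
      have hx : (chartAt (EuclideanSpace ℝ (Fin n)) x) ∈ IsManifold.maximalAtlas (𝓡 n) ∞ M :=
        IsManifold.chart_mem_maximalAtlas x
      have hm := (chartAt (EuclideanSpace ℝ (Fin n)) x).open_source.measurableSet
      rw [Measure.restrict_restrict hm, inter_comm,
        ← Measure.restrict_restrict e.open_source.measurableSet,
        volumeMeasure_restrict_of_mem_atlas (chart_mem_atlas _ x) g, chartVolume_restrict hx he g]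
  simp only [Finset.mem_coe] at h
  rwa [ht, top_eq_univ, Measure.restrict_univ, Measure.restrict_univ] at h

lemma volumeMeasure_apply (he : e ∈ IsManifold.maximalAtlas (𝓡 n) ∞ M) (g : RMetric n M)
    {S : Set M} (hS : MeasurableSet S) (hS' : S ⊆ e.source) : volumeMeasure g S =
      ∫⁻ y in e.target ∩ e.symm ⁻¹' S, ENNReal.ofReal (volDensity g e y) := by
  rw [← chartVolume_apply g e hS, ← volumeMeasure_restrict he g, Measure.restrict_apply hS,
    inter_eq_left.2 hS']

/-- The density is bounded on a closed ball inside a chart, so the measure is locally finite;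
compactness does the rest. -/
instance isFiniteMeasure_volumeMeasure (g : RMetric n M) : IsFiniteMeasure (volumeMeasure g) := by
  have : IsLocallyFiniteMeasure (volumeMeasure g) := by
    refine ⟨fun x => ?_⟩
    set e := chartAt (EuclideanSpace ℝ (Fin n)) x
    have he : e ∈ IsManifold.maximalAtlas (𝓡 n) ∞ M := IsManifold.chart_mem_maximalAtlas x
    have hx := mem_chart_source (EuclideanSpace ℝ (Fin n)) x
    obtain ⟨r, hr, hball⟩ := Metric.nhds_basis_closedBall.mem_iff.1
      (e.open_target.mem_nhds (e.map_source hx))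
    set S := e.source ∩ e ⁻¹' Metric.ball (e x) r
    have hSo : IsOpen S := e.isOpen_inter_preimage Metric.isOpen_ball
    refine ⟨S, hSo.mem_nhds ⟨hx, Metric.mem_ball_self hr⟩, ?_⟩
    rw [volumeMeasure_apply he g hSo.measurableSet inter_subset_left]
    have hsub : e.target ∩ e.symm ⁻¹' S ⊆ Metric.closedBall (e x) r := by
      rintro z ⟨hz, hz'⟩
      have := hz'.2
      rw [mem_preimage, e.right_inv hz] at this
      exact Metric.ball_subset_closedBall this
    refine (lintegral_mono_set hsub).trans_lt ?_
    have hint : IntegrableOn (volDensity g e) (Metric.closedBall (e x) r) :=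
      ((continuousOn_volDensity he g).mono hball).integrableOn_compact (isCompact_closedBall _ _)
    exact hint.lintegral_lt_top
  exact CompactSpace.isFiniteMeasure

/-- The density is strictly positive. This property later turns almost-everywhere equality of
continuous functions into equality. -/
instance isOpenPosMeasure_volumeMeasure (g : RMetric n M) :
    (volumeMeasure g).IsOpenPosMeasure := by
  refine ⟨fun U hU ⟨x, hx⟩ h0 => ?_⟩
  set e := chartAt (EuclideanSpace ℝ (Fin n)) x
  have he : e ∈ IsManifold.maximalAtlas (𝓡 n) ∞ M := IsManifold.chart_mem_maximalAtlas x
  have hxe := mem_chart_source (EuclideanSpace ℝ (Fin n)) x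
  have h1 : volumeMeasure g (U ∩ e.source) = 0 := measure_mono_null inter_subset_left h0
  rw [volumeMeasure_apply he g (hU.inter e.open_source).measurableSet inter_subset_right] at h1
  set V := e.target ∩ e.symm ⁻¹' (U ∩ e.source)
  have hV : IsOpen V := e.isOpen_inter_preimage_symm (hU.inter e.open_source)
  have hVne : V.Nonempty := ⟨e x, e.map_source hxe, by
    rw [mem_preimage, e.left_inv hxe]; exact ⟨hx, hxe⟩⟩
  have h2 : ∀ᵐ y ∂(volume.restrict V), False := by
    have h3 := (lintegral_eq_zero_iff' ((aemeasurable_volDensity he g).mono_measure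
      (Measure.restrict_mono inter_subset_left le_rfl))).1 h1
    filter_upwards [h3, ae_restrict_mem hV.measurableSet] with y hy hyV
    exact absurd (ENNReal.ofReal_eq_zero.1 hy) (not_le.2 (volDensity_pos he g hyV.1))
  have h4 : volume V = 0 := by simpa using h2
  exact hV.measure_ne_zero volume hVne h4

/-- The integral over the domain of a chart, in coordinates. -/
lemma setIntegral_source (he : e ∈ IsManifold.maximalAtlas (𝓡 n) ∞ M) (g : RMetric n M)
    {f : M → ℝ} (hf : AEStronglyMeasurable f (volumeMeasure g)) :
    ∫ x in e.source, f x ∂(volumeMeasure g) =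
      ∫ y in e.target, volDensity g e y * f (e.symm y) := by
  have hf' : AEStronglyMeasurable f (chartVolume g e) := by
    rw [← volumeMeasure_restrict he g]
    exact hf.restrict
  rw [volumeMeasure_restrict he g]
  have hv : chartVolume g e = Measure.map e.symm ((volume.restrict e.target).withDensity
    fun y => ENNReal.ofReal (volDensity g e y)) := rfl
  rw [hv] at hf' ⊢
  rw [integral_map ((aemeasurable_symm e).mono_ac (withDensity_absolutelyContinuous _ _)) hf']
  rw [integral_withDensity_eq_integral_toReal_smul₀ (aemeasurable_volDensity he g)
      (ae_of_all _ fun _ => ENNReal.ofReal_lt_top)]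
  refine integral_congr_ae (ae_of_all _ fun y => ?_)
  simp only [smul_eq_mul]
  rw [ENNReal.toReal_ofReal (show 0 ≤ volDensity g e y from Real.sqrt_nonneg _)]

end Volume

/-! ### Compactly supported functions in coordinates. -/

section Coordinates

variable {n : ℕ}

/-- Integration by parts against the constant function 1. -/
lemma integral_partialDeriv_eq_zero {W : EuclideanSpace ℝ (Fin n) → ℝ} (hW : ContDiff ℝ ∞ W)
    (hc : HasCompactSupport W) (i : Fin n) : ∫ y, partialDeriv i W y = 0 := by
  have hd : Continuous (partialDeriv i W) :=
    (hW.continuous_fderiv (by simp)).clm_apply continuous_const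
  have hdc : HasCompactSupport (partialDeriv i W) := hc.fderiv_apply ℝ _
  have h := integral_mul_fderiv_eq_neg_fderiv_mul_of_integrable (μ := volume)
    (f := fun _ : EuclideanSpace ℝ (Fin n) => (1 : ℝ)) (g := W)
    (v := EuclideanSpace.single i 1) (by simp)
    (by simp only [one_mul]; exact hd.integrable_of_hasCompactSupport hdc)
    (by simpa using hW.continuous.integrable_of_hasCompactSupport hc)
    (fun x _ => differentiableAt_const _)
    (fun x _ => hW.differentiable (by simp) x)
  simpa [partialDeriv] using h

/-- Each point lies in the open set U, where f is smooth, or in the open complement of K, where the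
extension by zero vanishes. -/
lemma contDiff_indicator {f : EuclideanSpace ℝ (Fin n) → ℝ} {U K : Set (EuclideanSpace ℝ (Fin n))}
    (hU : IsOpen U) (hK : IsClosed K) (hf : ∀ y ∈ U, ContDiffAt ℝ ∞ f y)
    (hKU : K ⊆ U) (h0 : ∀ y ∈ U, y ∉ K → f y = 0) : ContDiff ℝ ∞ (U.indicator f) := by
  rw [contDiff_iff_contDiffAt]
  intro y
  by_cases hy : y ∈ U
  · refine (hf y hy).congr_of_eventuallyEq ?_
    filter_upwards [hU.mem_nhds hy] with z hz
    exact indicator_of_mem hz f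
  · refine (contDiffAt_const (c := 0)).congr_of_eventuallyEq ?_
    filter_upwards [hK.isOpen_compl.mem_nhds fun h => hy (hKU h)] with z hz
    by_cases hzU : z ∈ U
    · rw [indicator_of_mem hzU, h0 z hzU hz]
    · rw [indicator_of_notMem hzU]

lemma hasCompactSupport_indicator {f : EuclideanSpace ℝ (Fin n) → ℝ}
    {U K : Set (EuclideanSpace ℝ (Fin n))} (hK : IsCompact K)
    (h0 : ∀ y ∈ U, y ∉ K → f y = 0) : HasCompactSupport (U.indicator f) := by
  refine HasCompactSupport.intro hK fun y hy => ?_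
  by_cases hyU : y ∈ U
  · rw [indicator_of_mem hyU, h0 y hyU hy]
  · rw [indicator_of_notMem hyU]

lemma partialDeriv_indicator {f : EuclideanSpace ℝ (Fin n) → ℝ}
    {U K : Set (EuclideanSpace ℝ (Fin n))} (hU : IsOpen U) (hK : IsClosed K)
    (hKU : K ⊆ U) (h0 : ∀ y ∈ U, y ∉ K → f y = 0) (i : Fin n) :
    partialDeriv i (U.indicator f) = U.indicator (partialDeriv i f) := by
  ext y
  by_cases hy : y ∈ U
  · rw [indicator_of_mem hy]
    refine partialDeriv_congr ?_
    filter_upwards [hU.mem_nhds hy] with z hz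
    exact indicator_of_mem hz f
  · rw [indicator_of_notMem hy, ← partialDeriv_const (i := i) (y := y) (0 : ℝ)]
    refine partialDeriv_congr ?_
    filter_upwards [hK.isOpen_compl.mem_nhds fun h => hy (hKU h)] with z hz
    by_cases hzU : z ∈ U
    · rw [indicator_of_mem hzU, h0 z hzU hz]
    · rw [indicator_of_notMem hzU]

end Coordinates

/-! ### The Laplace–Beltrami operator, Green's formula and the divergence theorem. -/

section Laplacian

variable {n : ℕ} {M : Type*} [TopologicalSpace M]
    [ChartedSpace (EuclideanSpace ℝ (Fin n)) M] [IsManifold (𝓡 n) ∞ M]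
  {e e' : OpenPartialHomeomorph M (EuclideanSpace ℝ (Fin n))}
  (he : e ∈ IsManifold.maximalAtlas (𝓡 n) ∞ M) (he' : e' ∈ IsManifold.maximalAtlas (𝓡 n) ∞ M)
  (g : RMetric n M)

/-- The components `√g g^{ij} ∂_j f` of the gradient density. -/
def gradDensity (g : RMetric n M) (e : OpenPartialHomeomorph M (EuclideanSpace ℝ (Fin n)))
    (f : EuclideanSpace ℝ (Fin n) → ℝ) (i : Fin n) (y : EuclideanSpace ℝ (Fin n)) : ℝ :=
  volDensity g e y * ∑ j, invMetric g e y i j * partialDeriv j f y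

/-- The Laplace-Beltrami operator in the chart `e`, in divergence form. -/
def divLap (g : RMetric n M) (e : OpenPartialHomeomorph M (EuclideanSpace ℝ (Fin n)))
    (f : EuclideanSpace ℝ (Fin n) → ℝ) (y : EuclideanSpace ℝ (Fin n)) : ℝ :=
  (volDensity g e y)⁻¹ * ∑ i, partialDeriv i (gradDensity g e f i) y

include he in
lemma contDiffAt_gradDensity {f : EuclideanSpace ℝ (Fin n) → ℝ} {y} (hy : y ∈ e.target)
    (hf : ContDiffAt ℝ ∞ f y) (i : Fin n) : ContDiffAt ℝ ∞ (gradDensity g e f i) y :=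
  (contDiffAt_volDensity he g hy).mul (ContDiffAt.sum fun j _ =>
    (contDiffAt_invMetric he hy i j).mul (contDiffAt_partialDeriv hf))

include he in
lemma contDiffAt_divLap {f : EuclideanSpace ℝ (Fin n) → ℝ} {y} (hy : y ∈ e.target)
    (hf : ContDiffAt ℝ ∞ f y) : ContDiffAt ℝ ∞ (divLap g e f) y :=
  ((contDiffAt_volDensity he g hy).inv (volDensity_pos he g hy).ne').mul
    (ContDiffAt.sum fun i _ => contDiffAt_partialDeriv (contDiffAt_gradDensity he g hy hf i))

lemma hasFDerivAt_det_zero {E : Type*} [NormedAddCommGroup E] [NormedSpace ℝ E]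
    {m : E → Matrix (Fin n) (Fin n) ℝ} {x : E}
    (hm : ∀ i j, HasFDerivAt (fun z => m z i j) (0 : E →L[ℝ] ℝ) x) :
    HasFDerivAt (fun z => (m z).det) (0 : E →L[ℝ] ℝ) x := by
  simp only [Matrix.det_apply]
  have h := HasFDerivAt.fun_sum (u := Finset.univ) fun (σ : Equiv.Perm (Fin n)) _ =>
    (HasFDerivAt.finsetProd (u := Finset.univ) fun i _ => hm (σ i) i).const_smul
      (Equiv.Perm.sign σ)
  simpa using h

variable {g} in
lemma IsNormalAt.hasFDerivAt_metricCoeff {y} (h : IsNormalAt g e y) (i j : Fin n) :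
    HasFDerivAt (fun z => metricCoeff g e z i j) (0 : EuclideanSpace ℝ (Fin n) →L[ℝ] ℝ) y := by
  have h1 := (contDiffAt_metricCoeff (g := g) h.mem_atlas
    h.mem_target i j).differentiableAt_infty.hasFDerivAt
  have h2 : fderiv ℝ (fun z => metricCoeff g e z i j) y = 0 := by
    ext v
    rw [clm_eq_sum]
    simpa [partialDeriv] using Finset.sum_eq_zero fun k _ => by
      have := h.deriv_eq i j k
      rw [partialDeriv] at this
      rw [this, mul_zero]
  rwa [h2] at h1

variable {g} in
lemma IsNormalAt.volDensity_eq {y} (h : IsNormalAt g e y) : volDensity g e y = 1 := by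
  rw [volDensity, h.metric_eq, Matrix.det_one, Real.sqrt_one]

variable {g} in
lemma IsNormalAt.deriv_volDensity {y} (h : IsNormalAt g e y) (k : Fin n) :
    partialDeriv k (volDensity g e) y = 0 := by
  have h1 := (hasFDerivAt_det_zero h.hasFDerivAt_metricCoeff).sqrt
    (metricCoeff_det_pos h.mem_atlas g h.mem_target).ne'
  rw [partialDeriv]
  unfold volDensity
  rw [h1.fderiv]
  simp

variable {g} in
-- The volume density and the inverse metric are constant to first order at the centre, so they pass
-- through the outer derivative.
lemma IsNormalAt.divLap_eq {y} (h : IsNormalAt g e y) {f : EuclideanSpace ℝ (Fin n) → ℝ}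
    (hf : ContDiffAt ℝ ∞ f y) : divLap g e f y = ∑ k, partialDeriv k (partialDeriv k f) y := by
  have hi := fun a b => (contDiffAt_invMetric (g := g) h.mem_atlas h.mem_target
    a b).differentiableAt_infty
  have hd := fun j => (contDiffAt_partialDeriv (i := j) hf).differentiableAt_infty
  have h1 : ∀ i, partialDeriv i (gradDensity g e f i) y = partialDeriv i (partialDeriv i f) y := by
    intro i
    have : gradDensity g e f i = fun z => volDensity g e z *
      ∑ j, invMetric g e z i j * partialDeriv j f z := rfl
    rw [this, partialDeriv_mul (contDiffAt_volDensity h.mem_atlas g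
      h.mem_target).differentiableAt_infty (DifferentiableAt.fun_sum fun j _ =>
      (hi i j).fun_mul (hd j)), h.deriv_volDensity, h.volDensity_eq, zero_mul, zero_add, one_mul,
      partialDeriv_sum fun j _ => (hi i j).fun_mul (hd j)]
    simp only [partialDeriv_mul (hi _ _) (hd _), h.deriv_invMetric, h.invMetric_eq, zero_mul,
      zero_add, sum_one_mul]
  simp only [divLap, h1, h.volDensity_eq, inv_one, one_mul]

/-- `g(Du, Dv)` on `M`. -/
def gradPair (g : RMetric n M) (u v : M → ℝ) (x : M) : ℝ :=
  gradInner g (chartAt (EuclideanSpace ℝ (Fin n)) x)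
    (fun y => u ((chartAt (EuclideanSpace ℝ (Fin n)) x).symm y))
    (fun y => v ((chartAt (EuclideanSpace ℝ (Fin n)) x).symm y))
    (chartAt (EuclideanSpace ℝ (Fin n)) x x)

lemma gradNormSq_eq (u : M → ℝ) (x : M) : gradNormSq g u x = gradPair g u u x := rfl

include he in
lemma contDiffAt_comp_symm {u : M → ℝ} (hu : ContMDiff (𝓡 n) 𝓘(ℝ, ℝ) ∞ u) {y}
    (hy : y ∈ e.target) : ContDiffAt ℝ ∞ (fun z => u (e.symm z)) y :=
  (hu.contMDiffAt.comp y (contMDiffAt_symm_of_mem_maximalAtlas he hy)).contDiffAt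

variable {u v : M → ℝ} (hu : ContMDiff (𝓡 n) 𝓘(ℝ, ℝ) ∞ u) (hv : ContMDiff (𝓡 n) 𝓘(ℝ, ℝ) ∞ v)

include he hu hv in
lemma gradPair_symm {y} (hy : y ∈ e.target) : gradPair g u v (e.symm y) =
    gradInner g e (fun z => u (e.symm z)) (fun z => v (e.symm z)) y := by
  set e' := chartAt (EuclideanSpace ℝ (Fin n)) (e.symm y) with he'
  have he'm : e' ∈ IsManifold.maximalAtlas (𝓡 n) ∞ M := IsManifold.chart_mem_maximalAtlas _
  have hyo : y ∈ overlap e e' := ⟨hy, mem_chart_source (EuclideanSpace ℝ (Fin n)) (e.symm y)⟩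
  have ht := (coordChange_mem _ _ hyo).1
  exact (gradInner_coordChange he'm he g hyo
    (contDiffAt_comp_symm he'm hu ht).differentiableAt_infty
    (contDiffAt_comp_symm he'm hv ht).differentiableAt_infty).symm

include he in
lemma continuousAt_of_symm {f : M → ℝ} {x : M} (hx : x ∈ e.source)
    (hf : ContinuousAt (fun y => f (e.symm y)) (e x)) : ContinuousAt f x := by
  have h1 : ContinuousAt (fun z => f (e.symm (e z))) x := hf.comp (e.continuousAt hx)
  refine h1.congr ?_
  filter_upwards [e.open_source.mem_nhds hx] with z hz
  rw [e.left_inv hz]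

include hu hv in
lemma continuous_gradPair : Continuous (gradPair g u v) := by
  rw [continuous_iff_continuousAt]
  intro x
  set e := chartAt (EuclideanSpace ℝ (Fin n)) x
  have he : e ∈ IsManifold.maximalAtlas (𝓡 n) ∞ M := IsManifold.chart_mem_maximalAtlas _
  have hx := mem_chart_source (EuclideanSpace ℝ (Fin n)) x
  refine continuousAt_of_symm he hx ?_
  have hc : ContDiffAt ℝ ∞ (fun y => gradInner g e (fun z => u (e.symm z))
      (fun z => v (e.symm z)) y) (e x) :=
    ContDiffAt.sum fun i _ => ContDiffAt.sum fun j _ =>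
      ((contDiffAt_invMetric he (e.map_source hx) i j).mul
        (contDiffAt_partialDeriv (contDiffAt_comp_symm he hu (e.map_source hx)))).mul
        (contDiffAt_partialDeriv (contDiffAt_comp_symm he hv (e.map_source hx)))
  refine hc.continuousAt.congr ?_
  filter_upwards [e.open_target.mem_nhds (e.map_source hx)] with y hy
  exact (gradPair_symm he g hu hv hy).symm

/-- The Laplace-Beltrami operator in the chart `e`, as a function on `M`. -/
def lapIn (g : RMetric n M) (e : OpenPartialHomeomorph M (EuclideanSpace ℝ (Fin n))) (u : M → ℝ)
    (x : M) : ℝ := divLap g e (fun z => u (e.symm z)) (e x)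

include he hu in
lemma continuousOn_lapIn : ContinuousOn (lapIn g e u) e.source := fun _ hx =>
  ((contDiffAt_divLap he g (e.map_source hx)
    (contDiffAt_comp_symm he hu (e.map_source hx))).continuousAt.comp
    (e.continuousAt hx)).continuousWithinAt

variable [CompactSpace M] [T2Space M] [MeasurableSpace M] [BorelSpace M]

lemma continuous_mul_of_tsupport_subset {φ f : M → ℝ} {U : Set M} (hU : IsOpen U)
    (hφ : Continuous φ) (hs : tsupport φ ⊆ U) (hf : ContinuousOn f U) :
    Continuous fun x => φ x * f x := by
  rw [continuous_iff_continuousAt]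
  intro x
  by_cases hx : x ∈ U
  · exact hφ.continuousAt.mul (hf.continuousAt (hU.mem_nhds hx))
  · refine (continuousAt_const (y := (0 : ℝ))).congr ?_
    filter_upwards [(isClosed_tsupport φ).isOpen_compl.mem_nhds fun h => hx (hs h)] with z hz
    rw [image_eq_zero_of_notMem_tsupport hz, zero_mul]

lemma integrable_of_continuous {f : M → ℝ} (hf : Continuous f) :
    Integrable f (volumeMeasure g) :=
  hf.integrable_of_hasCompactSupport (HasCompactSupport.of_compactSpace f)

lemma gradPair_eq_zero_of_notMem {φ : M → ℝ} (v : M → ℝ) {x : M} (hx : x ∉ tsupport φ) :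
    gradPair g φ v x = 0 := by
  set e := chartAt (EuclideanSpace ℝ (Fin n)) x with he
  have hxe := mem_chart_source (EuclideanSpace ℝ (Fin n)) x
  have h1 : (fun y => φ (e.symm y)) =ᶠ[𝓝 (e x)] fun _ => 0 := by
    have h2 : Tendsto e.symm (𝓝 (e x)) (𝓝 x) := by
      have := (e.continuousAt_symm (e.map_source hxe)).tendsto
      rwa [e.left_inv hxe] at this
    filter_upwards [h2.eventually ((isClosed_tsupport φ).isOpen_compl.mem_nhds hx)] with y hy
    exact image_eq_zero_of_notMem_tsupport hy
  simp only [gradPair, gradInner, ← he, partialDeriv_congr h1, partialDeriv_const, mul_zero,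
    zero_mul, Finset.sum_const_zero]

include he hu in
/-- Green's formula for test functions supported in a chart. -/
lemma integral_mul_lapIn {φ : M → ℝ} (hφ : ContMDiff (𝓡 n) 𝓘(ℝ, ℝ) ∞ φ)
    (hs : tsupport φ ⊆ e.source) :
    ∫ x, φ x * lapIn g e u x ∂(volumeMeasure g) =
      - ∫ x, gradPair g φ u x ∂(volumeMeasure g) := by
  have hc1 : Continuous fun x => φ x * lapIn g e u x :=
    continuous_mul_of_tsupport_subset e.open_source hφ.continuous hs (continuousOn_lapIn he g hu)
  have hc2 := continuous_gradPair g hφ hu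
  rw [← add_eq_zero_iff_eq_neg, ← integral_add (integrable_of_continuous g hc1)
    (integrable_of_continuous g hc2)]
  have hc : Continuous fun x => φ x * lapIn g e u x + gradPair g φ u x := hc1.add hc2
  rw [← setIntegral_eq_integral_of_forall_compl_eq_zero (s := e.source) fun x hx => by
    have hx' : x ∉ tsupport φ := fun h => hx (hs h)
    rw [image_eq_zero_of_notMem_tsupport hx', gradPair_eq_zero_of_notMem g u hx', zero_mul,
      add_zero], setIntegral_source he g hc.aestronglyMeasurable]
  set f := fun z => u (e.symm z) with hf
  set ψ := fun z => φ (e.symm z) with hψ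
  have hfs : ∀ y ∈ e.target, ContDiffAt ℝ ∞ f y := fun y hy => contDiffAt_comp_symm he hu hy
  have hψs : ∀ y ∈ e.target, ContDiffAt ℝ ∞ ψ y := fun y hy => contDiffAt_comp_symm he hφ hy
  set K := e '' tsupport φ with hKdef
  have hK : IsCompact K :=
    (isClosed_tsupport φ).isCompact.image_of_continuousOn (e.continuousOn.mono hs)
  have hKU : K ⊆ e.target := by
    rintro _ ⟨x, hx, rfl⟩
    exact e.map_source (hs hx)
  have hψ0 : ∀ y ∈ e.target, y ∉ K → ψ y = 0 := by
    intro y hy hyK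
    exact image_eq_zero_of_notMem_tsupport (f := φ) fun h => hyK ⟨e.symm y, h, e.right_inv hy⟩
  -- W is the density of φ times the gradient of u. By the product rule its divergence is √g(φΔu +
  -- g(Dφ,Du)), and it has compact support in the chart.
  let W : Fin n → EuclideanSpace ℝ (Fin n) → ℝ := fun i y => ψ y * gradDensity g e f i y
  have hW0 : ∀ i, ∀ y ∈ e.target, y ∉ K → W i y = 0 := fun i y hy hyK => by
    simp only [W, hψ0 y hy hyK, zero_mul]
  have hWs : ∀ i, ∀ y ∈ e.target, ContDiffAt ℝ ∞ (W i) y := fun i y hy =>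
    (hψs y hy).mul (contDiffAt_gradDensity he g hy (hfs y hy) i)
  have key : ∀ y ∈ e.target, volDensity g e y *
      (φ (e.symm y) * lapIn g e u (e.symm y) + gradPair g φ u (e.symm y)) =
      ∑ i, partialDeriv i (W i) y := by
    intro y hy
    have h1 : ∀ i, partialDeriv i (W i) y = partialDeriv i ψ y * gradDensity g e f i y +
        ψ y * partialDeriv i (gradDensity g e f i) y := fun i =>
      partialDeriv_mul (hψs y hy).differentiableAt_infty
        (contDiffAt_gradDensity he g hy (hfs y hy) i).differentiableAt_infty
    have h2 : lapIn g e u (e.symm y) = divLap g e f y := by rw [lapIn, e.right_inv hy]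
    rw [gradPair_symm he g hφ hu hy, h2]
    simp only [h1, Finset.sum_add_distrib, ← Finset.mul_sum, divLap, gradInner, gradDensity]
    rw [mul_add, add_comm]
    congr 1
    · rw [Finset.mul_sum]
      refine Finset.sum_congr rfl fun i _ => ?_
      rw [Finset.mul_sum, Finset.mul_sum, Finset.mul_sum]
      exact Finset.sum_congr rfl fun j _ => by ring
    · have := (volDensity_pos he g hy).ne'
      simp only [hψ]
      field_simp
  rw [setIntegral_congr_fun e.open_target.measurableSet key,
    ← integral_indicator e.open_target.measurableSet]
  have h3 : e.target.indicator (fun y => ∑ i, partialDeriv i (W i) y) =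
      fun y => ∑ i, partialDeriv i (e.target.indicator (W i)) y := by
    ext y
    simp only [partialDeriv_indicator e.open_target hK.isClosed hKU (hW0 _)]
    by_cases hy : y ∈ e.target
    · simp [indicator_of_mem hy]
    · simp [indicator_of_notMem hy]
  have hWi : ∀ i, ContDiff ℝ ∞ (e.target.indicator (W i)) := fun i =>
    contDiff_indicator e.open_target hK.isClosed (hWs i) hKU (hW0 i)
  have hWc : ∀ i, HasCompactSupport (e.target.indicator (W i)) := fun i =>
    hasCompactSupport_indicator hK (hW0 i)
  rw [h3, integral_finsetSum]
  · exact Finset.sum_eq_zero fun i _ => integral_partialDeriv_eq_zero (hWi i) (hWc i) i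
  · intro i _
    exact (((hWi i).continuous_fderiv (by simp)).clm_apply
      continuous_const).integrable_of_hasCompactSupport ((hWc i).fderiv_apply ℝ _)

include he he' hu in
-- By Green's formula both operators have the same integral against every test function supported in
-- the overlap, as the gradient pairing does not refer to `e` or `e'`. They are continuous, and open
-- sets have positive volume, so they agree everywhere there.
lemma lapIn_eq {x : M} (hx : x ∈ e.source) (hx' : x ∈ e'.source) :
    lapIn g e u x = lapIn g e' u x := by
  set U := e.source ∩ e'.source with hUd
  have hU : IsOpen U := e.open_source.inter e'.open_source
  have hc := (continuousOn_lapIn he g hu).mono (inter_subset_left : U ⊆ _)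
  have hc' := (continuousOn_lapIn he' g hu).mono (inter_subset_right : U ⊆ _)
  have h1 := hU.ae_eq_zero_of_integral_contMDiff_smul_eq_zero (𝓡 n) (μ := volumeMeasure g)
    ((hc.sub hc').locallyIntegrableOn hU.measurableSet) fun φ hφ _ hs => by
      have hi := integrable_of_continuous g
        (continuous_mul_of_tsupport_subset hU hφ.continuous hs hc)
      have hi' := integrable_of_continuous g
        (continuous_mul_of_tsupport_subset hU hφ.continuous hs hc')
      simp only [smul_eq_mul, Pi.sub_apply, mul_sub]
      rw [integral_sub hi hi', integral_mul_lapIn he g hu hφ (hs.trans inter_subset_left),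
        integral_mul_lapIn he' g hu hφ (hs.trans inter_subset_right), sub_self]
  have h2 : lapIn g e u =ᵐ[(volumeMeasure g).restrict U] lapIn g e' u := by
    rw [EventuallyEq, ae_restrict_iff' hU.measurableSet]
    filter_upwards [h1] with z hz hzU
    exact sub_eq_zero.1 (hz hzU)
  exact Measure.eqOn_open_of_ae_eq h2 hU hc hc' ⟨hx, hx'⟩

variable (M) in
/-- A finite smooth partition of unity subordinate to coordinate charts. -/
lemma exists_finite_partition : ∃ (t : Finset M) (φ : M → M → ℝ),
    (∀ x, ContMDiff (𝓡 n) 𝓘(ℝ, ℝ) ∞ (φ x)) ∧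
    (∀ x, tsupport (φ x) ⊆ (chartAt (EuclideanSpace ℝ (Fin n)) x).source) ∧
    (∀ x z, 0 ≤ φ x z) ∧ (∀ x z, φ x z ≤ 1) ∧ ∀ z, ∑ x ∈ t, φ x z = 1 := by
  obtain ⟨f, hf⟩ := SmoothPartitionOfUnity.exists_isSubordinate_chartAt_source (𝓡 n) M
  have hfin : {x | (Function.support (f x)).Nonempty}.Finite :=
    f.locallyFinite.finite_nonempty_of_compact
  refine ⟨hfin.toFinset, fun x => f x, fun x => (f x).contMDiff, hf, f.nonneg,
    fun x z => f.le_one x z, fun z => ?_⟩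
  rw [← f.sum_eq_one (mem_univ z)]
  refine (finsum_eq_sum_of_support_subset _ fun x hx => ?_).symm
  simp only [Finite.coe_toFinset, mem_ofPred_eq]
  exact ⟨z, hx⟩

/-- The Laplace-Beltrami operator on `M`. -/
def laplacian (g : RMetric n M) (u : M → ℝ) (x : M) : ℝ :=
  lapIn g (chartAt (EuclideanSpace ℝ (Fin n)) x) u x

include he hu in
lemma laplacian_eq {x : M} (hx : x ∈ e.source) : laplacian g u x = lapIn g e u x :=
  lapIn_eq (IsManifold.chart_mem_maximalAtlas x) he g hu
    (mem_chart_source (EuclideanSpace ℝ (Fin n)) x) hx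

include hu in
lemma continuous_laplacian : Continuous (laplacian g u) := by
  rw [continuous_iff_continuousAt]
  intro x
  set e := chartAt (EuclideanSpace ℝ (Fin n)) x
  have he : e ∈ IsManifold.maximalAtlas (𝓡 n) ∞ M := IsManifold.chart_mem_maximalAtlas _
  have hx := mem_chart_source (EuclideanSpace ℝ (Fin n)) x
  refine ((continuousOn_lapIn he g hu).continuousAt (e.open_source.mem_nhds hx)).congr ?_
  filter_upwards [e.open_source.mem_nhds hx] with z hz
  exact (laplacian_eq he g hu hz).symm

lemma gradPair_finsetSum {κ : Type*} (t : Finset κ) {φ : κ → M → ℝ}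
    (hφ : ∀ k, ContMDiff (𝓡 n) 𝓘(ℝ, ℝ) ∞ (φ k)) (v : M → ℝ) (x : M) :
    gradPair g (fun z => ∑ k ∈ t, φ k z) v x = ∑ k ∈ t, gradPair g (φ k) v x := by
  set e := chartAt (EuclideanSpace ℝ (Fin n)) x with he
  have hem : e ∈ IsManifold.maximalAtlas (𝓡 n) ∞ M := IsManifold.chart_mem_maximalAtlas _
  have hx := mem_chart_source (EuclideanSpace ℝ (Fin n)) x
  have h1 : ∀ i, partialDeriv i (fun y => ∑ k ∈ t, φ k (e.symm y)) (e x) =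
      ∑ k ∈ t, partialDeriv i (fun y => φ k (e.symm y)) (e x) := fun i =>
    partialDeriv_sum (f := fun k y => φ k (e.symm y)) fun k _ =>
      (contDiffAt_comp_symm hem (hφ k) (e.map_source hx)).differentiableAt_infty
  simp only [gradPair, gradInner, ← he, h1, Finset.mul_sum, Finset.sum_mul]
  rw [Finset.sum_congr rfl fun i _ => Finset.sum_comm]
  exact Finset.sum_comm

include hu in
/-- The divergence theorem on a closed manifold. -/
lemma integral_laplacian : ∫ x, laplacian g u x ∂(volumeMeasure g) = 0 := by
  obtain ⟨t, φ, hφ, hs, -, -, hone⟩ := exists_finite_partition (n := n) M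
  have hsrc := fun x : M => (chartAt (EuclideanSpace ℝ (Fin n)) x).open_source
  have hmem : ∀ x : M, chartAt (EuclideanSpace ℝ (Fin n)) x ∈ IsManifold.maximalAtlas (𝓡 n) ∞ M :=
    fun x => IsManifold.chart_mem_maximalAtlas _
  have h1 : ∀ z, laplacian g u z = ∑ x ∈ t, φ x z *
      lapIn g (chartAt (EuclideanSpace ℝ (Fin n)) x) u z := by
    intro z
    rw [← one_mul (laplacian g u z), ← hone z, Finset.sum_mul]
    refine Finset.sum_congr rfl fun x _ => ?_
    by_cases hz : z ∈ tsupport (φ x)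
    · rw [laplacian_eq (hmem x) g hu (hs x hz)]
    · rw [image_eq_zero_of_notMem_tsupport hz, zero_mul, zero_mul]
  simp only [h1]
  rw [integral_finsetSum _ fun x _ => integrable_of_continuous g
    (continuous_mul_of_tsupport_subset (hsrc x) (hφ x).continuous (hs x)
      (continuousOn_lapIn (hmem x) g hu))]
  simp only [integral_mul_lapIn (hmem _) g hu (hφ _) (hs _), Finset.sum_neg_distrib]
  rw [← integral_finsetSum _ fun x _ => integrable_of_continuous g
    (continuous_gradPair g (hφ x) hu)]
  -- The functions of the partition sum to 1, and the gradient of a constant is zero.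
  simp only [← gradPair_finsetSum g t hφ, hone]
  simp [gradPair, gradInner, partialDeriv_const]

end Laplacian

/-! ### The energy gap. -/

section Gap

variable {n d : ℕ} {ι : Type*} {M : Type*} [TopologicalSpace M] [T2Space M] [CompactSpace M]
    [ChartedSpace (EuclideanSpace ℝ (Fin n)) M] [IsManifold (𝓡 n) ∞ M]
    {G : Type*} [TopologicalSpace G] [T2Space G] [CompactSpace G] [Group G]
    [ChartedSpace (EuclideanSpace ℝ (Fin d)) G] [LieGroup (𝓡 d) ∞ G]
    [LieAlgebra.IsSemisimple ℝ (GroupLieAlgebra (𝓡 d) G)]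
    {P : PrincipalBundle n d ι M G} (A : Connection P) (g : RMetric n M)

lemma partialDeriv_partialDeriv_congr {f h : EuclideanSpace ℝ (Fin n) → ℝ} {y}
    (hfh : f =ᶠ[𝓝 y] h) (i j : Fin n) :
    partialDeriv i (partialDeriv j f) y = partialDeriv i (partialDeriv j h) y := by
  refine partialDeriv_congr ?_
  filter_upwards [hfh.eventually_nhds] with z hz
  exact partialDeriv_congr hz

/-- Near the centre of a normal chart, the energy density is given by `energyIn`. -/
lemma exists_isNormalAt_energyDensity (x : M) : ∃ e, IsNormalAt g e 0 ∧ e.symm 0 = x ∧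
    0 ∈ chartDomain P (P.indexAt x) e ∧
    (fun z => A.energyDensity g (e.symm z)) =ᶠ[𝓝 0] energyIn A g (P.indexAt x) e := by
  obtain ⟨e, he, h0⟩ := exists_isNormalAt g (IsManifold.chart_mem_maximalAtlas (I := 𝓡 n) x)
    ((chartAt (EuclideanSpace ℝ (Fin n)) x).map_source (mem_chart_source _ x))
  rw [OpenPartialHomeomorph.left_inv _ (mem_chart_source _ x)] at h0
  have hd : 0 ∈ chartDomain P (P.indexAt x) e := ⟨he.mem_target, by
    rw [mem_preimage, h0]; exact P.mem_baseSet_at x⟩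
  refine ⟨e, he, h0, hd, ?_⟩
  filter_upwards [(isOpen_chartDomain _ e).mem_nhds hd] with z hz
  exact energyDensity_symm he.mem_atlas A g hz

lemma energyDensity_nonneg (x : M) : 0 ≤ A.energyDensity g x := by
  obtain ⟨e, he, h0, hd, heq⟩ := exists_isNormalAt_energyDensity A g x
  rw [← h0, heq.eq_of_nhds]
  exact he.energyIn_nonneg A

lemma eq_zero_of_killingMetric_self_nonpos {x : EuclideanSpace ℝ (Fin d)}
    (hx : killingMetric G x x ≤ 0) : x = 0 := by
  obtain ⟨m, J, hinj, hJ, -⟩ := exists_killingMetric_embedding (d := d) (G := G)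
  rw [← hJ] at hx
  exact hinj (by rw [map_zero]; exact real_inner_self_nonpos.1 hx)

/-- Around the point there is a normal chart, in which the density dominates the Killing norm of
every component of F. The transformation law carries the vanishing to an arbitrary chart. -/
lemma isFlat_of_energyDensity_eq_zero (h : ∀ x, A.energyDensity g x = 0) : A.IsFlat := by
  intro i e he y hy hyi μ l
  obtain ⟨e', he', h0⟩ := exists_isNormalAt g he hy
  have hd : 0 ∈ chartDomain P i e' := ⟨he'.mem_target, by rwa [mem_preimage, h0]⟩
  have hF : ∀ a b, A.fieldStrength i e' a b 0 = 0 := fun a b => by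
    refine eq_zero_of_killingMetric_self_nonpos ((he'.killingMetric_le_energyIn A a b).trans ?_)
    rw [← energyDensity_symm he'.mem_atlas A g hd, h]
  have hs : e.symm y ∈ e'.source := by
    rw [← h0]; exact e'.map_target he'.mem_target
  have hc : coordChange e e' y = 0 := by
    rw [coordChange, ← h0, e'.right_inv he'.mem_target]
  rw [fieldStrength_coordChange he'.mem_atlas he A ⟨hy, hs⟩ hyi, hc]
  simp [hF]

variable [MeasurableSpace M] [BorelSpace M]

/-- The Bochner inequality for Yang-Mills connections. -/
lemma bochner_le {c₀ : ℝ} (hg : CurvatureCondition g c₀) (hA : A.IsYangMills g) {ε : ℝ}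
    (hε : 0 < ε) (x : M) :
    gradNormSq g (A.energyDensity g) x / (4 * (A.energyDensity g x + ε)) +
      2 * c₀ * A.energyDensity g x -
      2 * n ^ 3 * (A.energyDensity g x * √(A.energyDensity g x)) ≤
    1 / 2 * laplacian g (A.energyDensity g) x := by
  obtain ⟨e, he, h0, hd, heq⟩ := exists_isNormalAt_energyDensity A g x
  have hw := contMDiff_energyDensity A g
  have hx : x ∈ e.source := by rw [← h0]; exact e.map_target he.mem_target
  have hex : e x = 0 := by rw [← h0, e.right_inv he.mem_target]
  have h1 : laplacian g (A.energyDensity g) x =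
      ∑ k, partialDeriv k (partialDeriv k (energyIn A g (P.indexAt x) e)) 0 := by
    rw [laplacian_eq he.mem_atlas g hw hx, lapIn, hex,
      he.divLap_eq (contDiffAt_comp_symm he.mem_atlas hw he.mem_target)]
    simp only [partialDeriv_partialDeriv_congr heq]
  have h2 : gradNormSq g (A.energyDensity g) x =
      ∑ k, partialDeriv k (energyIn A g (P.indexAt x) e) 0 ^ 2 := by
    rw [gradNormSq_eq, ← h0, gradPair_symm he.mem_atlas g hw hw he.mem_target, h0]
    simp only [gradInner, partialDeriv_congr heq, he.invMetric_eq, mul_assoc, sum_one_mul, sq]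
  have h3 : A.energyDensity g x = energyIn A g (P.indexAt x) e 0 := by
    rw [← heq.eq_of_nhds, h0]
  rw [h1, h2, h3]
  exact he.bochner_le A hg hA hd hε

omit [T2Space M] [CompactSpace M] [MeasurableSpace M] [BorelSpace M] in
-- |F| = √w need not be smooth where F vanishes, whereas √(w+ε) is an admissible test function for
-- the Sobolev inequality.
lemma contMDiff_sqrt_add {w : M → ℝ} (hw : ContMDiff (𝓡 n) 𝓘(ℝ, ℝ) ∞ w) (hw0 : ∀ x, 0 ≤ w x)
    {ε : ℝ} (hε : 0 < ε) : ContMDiff (𝓡 n) 𝓘(ℝ, ℝ) ∞ fun x => √(w x + ε) := by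
  intro x
  have h1 : ContDiffAt ℝ ∞ (fun t : ℝ => √(t + ε)) (w x) :=
    (contDiffAt_id.add contDiffAt_const).sqrt (by have := hw0 x; simp only [id]; positivity)
  exact h1.contMDiffAt.comp x (hw x)

omit [T2Space M] [CompactSpace M] [MeasurableSpace M] [BorelSpace M] in
lemma gradNormSq_sqrt_add {w : M → ℝ} (hw : ContMDiff (𝓡 n) 𝓘(ℝ, ℝ) ∞ w) (hw0 : ∀ x, 0 ≤ w x)
    {ε : ℝ} (hε : 0 < ε) (x : M) :
    gradNormSq g (fun x => √(w x + ε)) x = gradNormSq g w x / (4 * (w x + ε)) := by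
  set e := chartAt (EuclideanSpace ℝ (Fin n)) x with he
  have hem : e ∈ IsManifold.maximalAtlas (𝓡 n) ∞ M := IsManifold.chart_mem_maximalAtlas _
  have hx := mem_chart_source (EuclideanSpace ℝ (Fin n)) x
  have hpos : 0 < w x + ε := by have := hw0 x; positivity
  have hd : ∀ i, partialDeriv i (fun y => √(w (e.symm y) + ε)) (e x) =
      (2 * √(w x + ε))⁻¹ * partialDeriv i (fun y => w (e.symm y)) (e x) := by
    intro i
    have h1 := ((contDiffAt_comp_symm hem hw
      (e.map_source hx)).differentiableAt_infty.hasFDerivAt.add_const ε).sqrt (by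
        rw [e.left_inv hx]; exact hpos.ne')
    rw [partialDeriv, h1.fderiv, e.left_inv hx]
    simp [partialDeriv]
  simp only [gradNormSq_eq, gradPair, gradInner, ← he, hd, div_eq_mul_inv, Finset.sum_mul]
  refine Finset.sum_congr rfl fun i _ => Finset.sum_congr rfl fun j _ => ?_
  have h2 : (4 * (w x + ε))⁻¹ = (2 * √(w x + ε))⁻¹ * (2 * √(w x + ε))⁻¹ := by
    rw [← mul_inv]
    congr 1
    nlinarith [Real.mul_self_sqrt hpos.le]
  rw [h2]
  ring

omit [TopologicalSpace M] [T2Space M] [CompactSpace M] [ChartedSpace (EuclideanSpace ℝ (Fin n)) M]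
  [IsManifold (𝓡 n) ∞ M] [BorelSpace M] in
lemma integral_add_le_integral_add {μ : Measure M} {f₁ f₂ f₃ f₄ : M → ℝ} (h₁ : Integrable f₁ μ)
    (h₂ : Integrable f₂ μ) (h₃ : Integrable f₃ μ) (h₄ : Integrable f₄ μ)
    (h : ∀ x, f₁ x + f₂ x ≤ f₃ x + f₄ x) :
    ∫ x, f₁ x ∂μ + ∫ x, f₂ x ∂μ ≤ ∫ x, f₃ x ∂μ + ∫ x, f₄ x ∂μ := by
  rw [← integral_add h₁ h₂, ← integral_add h₃ h₄]
  exact integral_mono (h₁.add h₂) (h₃.add h₄) h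

/-- Integrate the pointwise inequality. Its quotient term is the squared gradient of √(w+ε), and the
Laplacian integrates to zero. -/
lemma integral_bochner_le {c₀ : ℝ} (hg : CurvatureCondition g c₀) (hA : A.IsYangMills g) {ε : ℝ}
    (hε : 0 < ε) :
    (∫ x, gradNormSq g (fun x => √(A.energyDensity g x + ε)) x ∂(volumeMeasure g)) +
      2 * c₀ * (∫ x, A.energyDensity g x ∂(volumeMeasure g)) ≤
    2 * n ^ 3 * ∫ x, √(A.energyDensity g x) * A.energyDensity g x ∂(volumeMeasure g) := by
  have hw := contMDiff_energyDensity A g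
  have hf := contMDiff_sqrt_add hw (energyDensity_nonneg A g) hε
  have i1 : Integrable (gradNormSq g (fun x => √(A.energyDensity g x + ε))) (volumeMeasure g) :=
    (funext (gradNormSq_eq g _)) ▸ integrable_of_continuous g (continuous_gradPair g hf hf)
  have i2 : Integrable (fun x => 2 * c₀ * A.energyDensity g x) (volumeMeasure g) :=
    integrable_of_continuous g (continuous_const.mul hw.continuous)
  have i3 : Integrable (fun x => 2 * n ^ 3 * (√(A.energyDensity g x) * A.energyDensity g x))
      (volumeMeasure g) :=
    integrable_of_continuous g (continuous_const.mul (hw.continuous.sqrt.mul hw.continuous))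
  have i4 : Integrable (fun x => 1 / 2 * laplacian g (A.energyDensity g) x) (volumeMeasure g) :=
    integrable_of_continuous g (continuous_const.mul (continuous_laplacian g hw))
  have h1 := integral_add_le_integral_add i1 i2 i3 i4 fun x => by
    have := bochner_le A g hg hA hε x
    rw [← gradNormSq_sqrt_add g hw (energyDensity_nonneg A g) hε] at this
    linarith
  rwa [integral_const_mul, integral_const_mul, integral_const_mul, integral_laplacian g hw,
    mul_zero, add_zero] at h1

/-- Hölder for √w·w with conjugate exponents n/2 and n/(n−2): the first factor is exactly the
energy. In the second, w ≤ w+ε and (w+ε)^{n/(n−2)} is the 2n/(n−2) power of √(w+ε). -/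
lemma integral_sqrt_mul_le (hn : 3 ≤ n) {ε : ℝ} (hε : 0 < ε) :
    ∫ x, √(A.energyDensity g x) * A.energyDensity g x ∂(volumeMeasure g) ≤
      A.energy g * (∫ x, |√(A.energyDensity g x + ε)| ^ ((2 * n : ℝ) / (n - 2))
        ∂(volumeMeasure g)) ^ (((n : ℝ) - 2) / n) := by
  have hn' : (3 : ℝ) ≤ n := by exact_mod_cast hn
  have hw := contMDiff_energyDensity A g
  have hw0 := energyDensity_nonneg A g
  have hpq : ((n : ℝ) / 2).HolderConjugate (n / (n - 2)) := by
    rw [Real.holderConjugate_iff]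
    constructor
    · linarith
    · field_simp
      ring
  have h1 := integral_mul_le_Lp_mul_Lq_of_nonneg hpq (μ := volumeMeasure g)
    (f := fun x => √(A.energyDensity g x)) (g := fun x => A.energyDensity g x)
    (ae_of_all _ fun x => Real.sqrt_nonneg _) (ae_of_all _ hw0)
    (hw.continuous.sqrt.memLp_of_hasCompactSupport (HasCompactSupport.of_compactSpace _))
    (hw.continuous.memLp_of_hasCompactSupport (HasCompactSupport.of_compactSpace _))
  refine h1.trans ?_
  rw [one_div_div, one_div_div]
  refine mul_le_mul_of_nonneg_left ?_ (Real.rpow_nonneg (integral_nonneg fun x => by positivity) _)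
  have hq : 0 ≤ (n : ℝ) / (n - 2) := div_nonneg (by linarith) (by linarith)
  have hq2 : 0 ≤ (2 * n : ℝ) / (n - 2) := div_nonneg (by linarith) (by linarith)
  refine Real.rpow_le_rpow (integral_nonneg fun x => Real.rpow_nonneg (hw0 x) _) ?_
    (div_nonneg (by linarith) (by linarith))
  refine integral_mono (integrable_of_continuous g (hw.continuous.rpow_const fun _ => Or.inr hq))
    (integrable_of_continuous g (((hw.continuous.add continuous_const).sqrt.abs).rpow_const
      fun _ => Or.inr hq2)) fun x => ?_
  have h2 : |√(A.energyDensity g x + ε)| ^ ((2 * n : ℝ) / (n - 2)) =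
      (A.energyDensity g x + ε) ^ ((n : ℝ) / (n - 2)) := by
    rw [abs_of_nonneg (Real.sqrt_nonneg _), Real.sqrt_eq_rpow,
      ← Real.rpow_mul (by have := hw0 x; positivity)]
    congr 1
    field_simp
  simp only
  rw [h2]
  exact Real.rpow_le_rpow (hw0 x) (by linarith) hq

/-- The threshold is chosen so that, after Hölder and Sobolev, the right side has coefficient at
most 1 on the Dirichlet integral and at most c₀ on ∫w. The left side has coefficients 1 and 2c₀,
which leaves c₀∫w to be controlled by ε alone. -/
theorem energy_gap (hn : 3 ≤ n) {c₀ c₁ c₂ : ℝ} (hc₀ : 0 < c₀) (hg : CurvatureCondition g c₀)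
    (hS : SobolevInequality g c₁ c₂) (hA : A.IsYangMills g)
    (hE : A.energy g < min 1 c₀ / (2 * n ^ 3 * (1 + |c₁| + |c₂|))) : A.IsFlat := by
  have hn' : (3 : ℝ) ≤ n := by exact_mod_cast hn
  have hw := contMDiff_energyDensity A g
  have hw0 := energyDensity_nonneg A g
  refine isFlat_of_energyDensity_eq_zero A g ?_
  set b := ∫ x, A.energyDensity g x ∂(volumeMeasure g) with hb
  have hb0 : 0 ≤ b := integral_nonneg hw0
  set V := (volumeMeasure g).real univ with hV
  have hV0 : 0 ≤ V := measureReal_nonneg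
  have hE0 : 0 ≤ A.energy g := Real.rpow_nonneg (integral_nonneg fun x => by positivity) _
  have key : ∀ ε : ℝ, 0 < ε → b ≤ ε * V := by
    intro ε hε
    have hf := contMDiff_sqrt_add hw hw0 hε
    set a := ∫ x, gradNormSq g (fun x => √(A.energyDensity g x + ε)) x ∂(volumeMeasure g) with ha
    have ha0 : 0 ≤ a := by
      refine integral_nonneg fun x => ?_
      obtain ⟨e, he, h0⟩ := exists_isNormalAt g (IsManifold.chart_mem_maximalAtlas (I := 𝓡 n) x)
        ((chartAt (EuclideanSpace ℝ (Fin n)) x).map_source (mem_chart_source _ x))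
      rw [OpenPartialHomeomorph.left_inv _ (mem_chart_source _ x)] at h0
      rw [gradNormSq_eq, ← h0, gradPair_symm he.mem_atlas g hf hf he.mem_target]
      simp only [gradInner, he.invMetric_eq, mul_assoc, sum_one_mul]
      exact Finset.sum_nonneg fun i _ => mul_self_nonneg _
    have h1 := integral_bochner_le A g hg hA hε
    have h2 := integral_sqrt_mul_le A g hn hε
    have h3 := hS _ hf
    have hsq : ∫ x, √(A.energyDensity g x + ε) ^ 2 ∂(volumeMeasure g) = b + ε * V := by
      have : ∀ x, √(A.energyDensity g x + ε) ^ 2 = A.energyDensity g x + ε := fun x =>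
        Real.sq_sqrt (by have := hw0 x; positivity)
      simp only [this]
      rw [integral_add (integrable_of_continuous g hw.continuous) (integrable_const _),
        integral_const, smul_eq_mul, mul_comm V]
    rw [hsq, ← ha] at h3
    rw [← ha, ← hb] at h1
    set L := (∫ x, |√(A.energyDensity g x + ε)| ^ ((2 * n : ℝ) / (n - 2))
        ∂(volumeMeasure g)) ^ (((n : ℝ) - 2) / n) with hL
    have hL0 : 0 ≤ L := Real.rpow_nonneg (integral_nonneg fun x => by positivity) _
    have hC : (0 : ℝ) < 1 + |c₁| + |c₂| := by positivity
    have hE' : 2 * n ^ 3 * A.energy g * (1 + |c₁| + |c₂|) ≤ min 1 c₀ := by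
      have := (lt_div_iff₀ (by positivity)).1 hE
      linarith
    -- The Sobolev constants may have any sign, so absolute values are taken; 1 + |c₁| + |c₂|
    -- dominates both and is positive.
    have hL1 : L ≤ (1 + |c₁| + |c₂|) * (a + (b + ε * V)) := by
      have e1 : c₁ * a ≤ |c₁| * a := mul_le_mul_of_nonneg_right (le_abs_self _) ha0
      have e2 : c₂ * (b + ε * V) ≤ |c₂| * (b + ε * V) :=
        mul_le_mul_of_nonneg_right (le_abs_self _) (by positivity)
      have e3 : 0 ≤ |c₁| * (b + ε * V) := by positivity
      have e4 : 0 ≤ |c₂| * a := by positivity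
      have e5 : 0 ≤ b + ε * V := by positivity
      nlinarith
    have h4 : a + 2 * c₀ * b ≤ min 1 c₀ * (a + (b + ε * V)) := by
      calc a + 2 * c₀ * b ≤ 2 * n ^ 3 * (A.energy g * L) := h1.trans (by gcongr)
        _ ≤ 2 * n ^ 3 * (A.energy g * ((1 + |c₁| + |c₂|) * (a + (b + ε * V)))) := by gcongr
        _ = (2 * n ^ 3 * A.energy g * (1 + |c₁| + |c₂|)) * (a + (b + ε * V)) := by ring
        _ ≤ min 1 c₀ * (a + (b + ε * V)) := by gcongr
    have h5 : min 1 c₀ * a ≤ 1 * a := by gcongr; exact min_le_left _ _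
    have h6 : min 1 c₀ * (b + ε * V) ≤ c₀ * (b + ε * V) := by gcongr; exact min_le_right _ _
    have h7 : c₀ * b ≤ c₀ * (ε * V) := by linarith
    exact le_of_mul_le_mul_left h7 hc₀
  have hb1 : b ≤ 0 := by
    refine le_of_forall_pos_le_add fun δ hδ => ?_
    have := key (δ / (V + 1)) (by positivity)
    calc b ≤ δ / (V + 1) * V := this
      _ ≤ δ / (V + 1) * (V + 1) := by gcongr; linarith
      _ = 0 + δ := by field_simp; ring
  have hb2 : b = 0 := le_antisymm hb1 hb0
  have h1 := (integral_eq_zero_iff_of_nonneg hw0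
    (integrable_of_continuous g hw.continuous)).1 hb2
  -- The density vanishes almost everywhere and is continuous, so it vanishes everywhere.
  have h2 := hw.continuous.ae_eq_iff_eq (volumeMeasure g) continuous_const |>.1 h1
  exact fun x => congrFun h2 x

end Gap

/-! ### The Sobolev inequality on Euclidean space. -/

section EuclideanSobolev

variable {n : ℕ}

lemma norm_fderiv_sq_le (W : EuclideanSpace ℝ (Fin n) → ℝ) (y : EuclideanSpace ℝ (Fin n)) :
    ‖fderiv ℝ W y‖ ^ 2 ≤ ∑ i, partialDeriv i W y ^ 2 := by
  have h : ‖fderiv ℝ W y‖ ≤ √(∑ i, partialDeriv i W y ^ 2) := by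
    refine ContinuousLinearMap.opNorm_le_bound _ (Real.sqrt_nonneg _) fun v => ?_
    rw [clm_eq_sum, EuclideanSpace.norm_eq, ← Real.sqrt_mul (Finset.sum_nonneg fun _ _ =>
      sq_nonneg _)]
    refine Real.abs_le_sqrt ?_
    simp only [smul_eq_mul, Real.norm_eq_abs, sq_abs]
    have := Finset.sum_mul_sq_le_sq_mul_sq Finset.univ v.ofLp fun i => partialDeriv i W y
    rw [mul_comm (∑ i, v.ofLp i ^ 2)] at this
    exact this
  calc ‖fderiv ℝ W y‖ ^ 2 ≤ √(∑ i, partialDeriv i W y ^ 2) ^ 2 := by gcongr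
    _ = _ := Real.sq_sqrt (Finset.sum_nonneg fun _ _ => sq_nonneg _)

lemma integrable_norm_fderiv_sq {W : EuclideanSpace ℝ (Fin n) → ℝ} (hW : ContDiff ℝ ∞ W)
    (hc : HasCompactSupport W) : Integrable fun y => ‖fderiv ℝ W y‖ ^ 2 := by
  have h1 : Continuous fun y => ‖fderiv ℝ W y‖ ^ 2 := (hW.continuous_fderiv (by simp)).norm.pow 2
  have h2 : HasCompactSupport fun y => ‖fderiv ℝ W y‖ ^ 2 := by
    refine HasCompactSupport.intro (hc.fderiv ℝ) fun y hy => ?_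
    rw [image_eq_zero_of_notMem_tsupport hy, norm_zero]
    norm_num
  exact h1.integrable_of_hasCompactSupport h2

lemma integrable_abs_rpow {W : EuclideanSpace ℝ (Fin n) → ℝ} (hW : ContDiff ℝ ∞ W)
    (hc : HasCompactSupport W) {q : ℝ} (hq : 0 < q) : Integrable fun y => |W y| ^ q :=
  (hW.continuous.abs.rpow_const fun _ => Or.inr hq.le).integrable_of_hasCompactSupport
    (hc.comp_left (g := fun t : ℝ => |t| ^ q) (by simp [Real.zero_rpow hq.ne']))

variable (n) in
/-- The Sobolev inequality for test functions on Euclidean space. -/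
lemma exists_sobolev_euclidean (hn : 3 ≤ n) : ∃ S : ℝ, 0 ≤ S ∧
    ∀ W : EuclideanSpace ℝ (Fin n) → ℝ, ContDiff ℝ ∞ W → HasCompactSupport W →
      ∫ y, |W y| ^ ((2 * n : ℝ) / (n - 2)) ≤
        S * (∫ y, ‖fderiv ℝ W y‖ ^ 2) ^ ((n : ℝ) / (n - 2)) := by
  have hn' : (3 : ℝ) ≤ n := by exact_mod_cast hn
  have hq : 0 < (2 * n : ℝ) / (n - 2) := div_pos (by linarith) (by linarith)
  -- The critical exponent: 1/q = 1/2 − 1/n.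
  let q : NNReal := ⟨(2 * n : ℝ) / (n - 2), hq.le⟩
  have hqc : (q : ℝ) = (2 * n : ℝ) / (n - 2) := rfl
  set C : NNReal := eLpNormLESNormFDerivOfEqInnerConst
    (volume : Measure (EuclideanSpace ℝ (Fin n))) ((2 : NNReal) : ℝ) with hC
  refine ⟨(C : ℝ) ^ (q : ℝ), by positivity, fun W hW hc => ?_⟩
  have hfc : Continuous (fderiv ℝ W) := hW.continuous_fderiv (by simp)
  have hm := hW.continuous.memLp_of_hasCompactSupport (p := (q : ENNReal)) (μ := volume) hc
  have hm' := hfc.memLp_of_hasCompactSupport (p := ((2 : NNReal) : ENNReal)) (μ := volume)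
    (hc.fderiv ℝ)
  have hq0 : (q : ENNReal) ≠ 0 := by
    rw [Ne, ENNReal.coe_eq_zero]
    exact fun h => hq.ne' (congrArg NNReal.toReal h)
  have h1 := eLpNorm_le_eLpNorm_fderiv_of_eq_inner (F' := ℝ)
    (volume : Measure (EuclideanSpace ℝ (Fin n)))
    (hW.of_le (by simp)) hc (p := 2) (p' := q) (by norm_num) (by simp; omega) (by
      rw [hqc, finrank_euclideanSpace_fin, inv_div]
      push_cast
      field_simp)
  rw [hm.eLpNorm_eq_integral_rpow_norm hq0 ENNReal.coe_ne_top,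
    hm'.eLpNorm_eq_integral_rpow_norm (by norm_num) ENNReal.coe_ne_top, ← hC,
    ← ENNReal.ofReal_coe_nnreal (p := C),
    ← ENNReal.ofReal_mul (by positivity), ENNReal.ofReal_le_ofReal_iff (by positivity)] at h1
  simp only [ENNReal.coe_toReal, NNReal.coe_ofNat, Real.rpow_ofNat, Real.norm_eq_abs] at h1
  set I := ∫ y, |W y| ^ (q : ℝ) with hI
  have hI0 : 0 ≤ I := integral_nonneg fun y => by positivity
  set D := ∫ y, ‖fderiv ℝ W y‖ ^ 2 with hD
  have hD0 : 0 ≤ D := integral_nonneg fun y => by positivity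
  -- Raising the norm inequality to the power q removes the outer root on the left; on the right the
  -- exponent becomes q/2 = n/(n−2).
  have h2 := Real.rpow_le_rpow (by positivity) h1 (show 0 ≤ (q : ℝ) from hq.le)
  rw [← Real.rpow_mul hI0, inv_mul_cancel₀ (show (q : ℝ) ≠ 0 from hq.ne'), Real.rpow_one,
    Real.mul_rpow (by positivity) (by positivity), ← Real.rpow_mul hD0] at h2
  have h3 : (2 : ℝ)⁻¹ * q = n / (n - 2) := by
    rw [hqc, ← mul_div_assoc, inv_mul_cancel_left₀ two_ne_zero]
  rwa [h3] at h2

/-- Write A = BᵀB and v = Bᵀw; then vᵀA⁻¹v = |w|², and Cauchy–Schwarz in each component of v leaves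
the squared Hilbert–Schmidt norm of B, which is tr A. With A the metric, this compares Euclidean and
Riemannian gradients. -/
lemma sum_sq_le_trace_mul {A : Matrix (Fin n) (Fin n) ℝ} (hA : A.PosDef) (v : Fin n → ℝ) :
    ∑ i, v i ^ 2 ≤ A.trace * ∑ i, ∑ j, A⁻¹ i j * v i * v j := by
  obtain ⟨B, hB⟩ := exists_conjTranspose_mul_self hA.posSemidef
  rw [Matrix.conjTranspose_eq_transpose_of_trivial] at hB
  have hdet : IsUnit B.det := by
    have := hA.det_pos.ne'
    rw [hB, Matrix.det_mul] at this
    exact (right_ne_zero_of_mul this).isUnit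
  set w := (B⁻¹).transpose.mulVec v with hw
  have hv : v = B.transpose.mulVec w := by
    rw [hw, Matrix.mulVec_mulVec, ← Matrix.transpose_mul, Matrix.nonsing_inv_mul _ hdet,
      Matrix.transpose_one, Matrix.one_mulVec]
  have h1 : ∑ i, ∑ j, A⁻¹ i j * v i * v j = ∑ k, w k ^ 2 := by
    have h2 : v ⬝ᵥ (A⁻¹).mulVec v = w ⬝ᵥ w := by
      rw [hB, Matrix.mul_inv_rev, ← Matrix.mulVec_mulVec, ← Matrix.transpose_nonsing_inv, ← hw,
        Matrix.dotProduct_mulVec, ← Matrix.mulVec_transpose, ← hw]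
    simp only [dotProduct, Matrix.mulVec, Finset.mul_sum] at h2
    simp only [sq]
    rw [← h2]
    exact Finset.sum_congr rfl fun i _ => Finset.sum_congr rfl fun j _ => by ring
  have h3 : A.trace = ∑ i, ∑ k, B k i ^ 2 := by
    rw [hB]
    simp only [Matrix.trace, Matrix.diag, Matrix.mul_apply, Matrix.transpose_apply, sq]
  rw [h1, h3, Finset.sum_mul]
  refine Finset.sum_le_sum fun i _ => ?_
  conv_lhs => rw [hv]
  exact Finset.sum_mul_sq_le_sq_mul_sq Finset.univ (fun k => B k i) w

end EuclideanSobolev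

/-! ### Existence of Sobolev constants on a closed manifold. -/

section Sobolev

variable {n : ℕ} {M : Type*} [TopologicalSpace M]
    [ChartedSpace (EuclideanSpace ℝ (Fin n)) M] [IsManifold (𝓡 n) ∞ M]
    [MeasurableSpace M] [BorelSpace M] [CompactSpace M]
  {e : OpenPartialHomeomorph M (EuclideanSpace ℝ (Fin n))}
  (he : e ∈ IsManifold.maximalAtlas (𝓡 n) ∞ M) (g : RMetric n M)

include he in
lemma integrableOn_target {f : M → ℝ} (hf : Integrable f (volumeMeasure g)) :
    IntegrableOn (fun y => volDensity g e y * f (e.symm y)) e.target := by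
  have h1 : Integrable f (chartVolume g e) := by
    rw [← volumeMeasure_restrict he g]
    exact hf.restrict
  have hv : chartVolume g e = Measure.map e.symm ((volume.restrict e.target).withDensity
    fun y => ENNReal.ofReal (volDensity g e y)) := rfl
  rw [hv] at h1
  rw [integrable_map_measure h1.1 ((aemeasurable_symm e).mono_ac
    (withDensity_absolutelyContinuous _ _)), integrable_withDensity_iff_integrable_smul₀'
    (aemeasurable_volDensity he g) (ae_of_all _ fun _ => ENNReal.ofReal_lt_top)] at h1
  refine h1.congr (ae_of_all _ fun y => ?_)
  simp only [smul_eq_mul, Function.comp]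
  rw [ENNReal.toReal_ofReal (show 0 ≤ volDensity g e y from Real.sqrt_nonneg _)]

omit [MeasurableSpace M] [BorelSpace M] [CompactSpace M] in
include he in
lemma gradInner_self_nonneg {y} (hy : y ∈ e.target) (f : EuclideanSpace ℝ (Fin n) → ℝ) :
    0 ≤ gradInner g e f f y := by
  rw [gradInner_eq]
  exact (invMetric_posDef he g hy).posSemidef.dotProduct_mulVec_nonneg _

omit [MeasurableSpace M] [BorelSpace M] [CompactSpace M] in
lemma gradPair_self_nonneg (u : M → ℝ) (x : M) : 0 ≤ gradPair g u u x :=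
  gradInner_self_nonneg (IsManifold.chart_mem_maximalAtlas x) g (mem_chart_target _ x) _

omit [MeasurableSpace M] [BorelSpace M] [CompactSpace M] in
include he in
-- The product rule, (a+b)² ≤ 2a² + 2b², and the comparison of Euclidean with Riemannian gradients.
lemma sum_sq_partialDeriv_mul_le {y} (hy : y ∈ e.target) {ψ f : EuclideanSpace ℝ (Fin n) → ℝ}
    (hψ : DifferentiableAt ℝ ψ y) (hf : DifferentiableAt ℝ f y) (hψ1 : ψ y ^ 2 ≤ 1) :
    ∑ i, partialDeriv i (fun y => ψ y * f y) y ^ 2 ≤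
      (2 * (metricCoeff g e y).trace + 2 * ∑ i, partialDeriv i ψ y ^ 2) *
        (gradInner g e f f y + f y ^ 2) := by
  have htr : ∑ i, partialDeriv i f y ^ 2 ≤ (metricCoeff g e y).trace * gradInner g e f f y :=
    sum_sq_le_trace_mul (metricCoeff_posDef he g hy) fun i => partialDeriv i f y
  have htr0 : 0 ≤ (metricCoeff g e y).trace :=
    (metricCoeff_posDef he g hy).posSemidef.trace_nonneg
  have hg0 := gradInner_self_nonneg he g hy f
  set B := ∑ i, partialDeriv i ψ y ^ 2 with hB
  have hB0 : 0 ≤ B := Finset.sum_nonneg fun _ _ => sq_nonneg _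
  calc ∑ i, partialDeriv i (fun y => ψ y * f y) y ^ 2
      ≤ ∑ i, (2 * partialDeriv i f y ^ 2 + 2 * (partialDeriv i ψ y ^ 2 * f y ^ 2)) := by
        refine Finset.sum_le_sum fun i _ => ?_
        rw [partialDeriv_mul hψ hf]
        nlinarith [sq_nonneg (partialDeriv i ψ y * f y - ψ y * partialDeriv i f y),
          mul_le_mul_of_nonneg_right hψ1 (sq_nonneg (partialDeriv i f y))]
    _ = 2 * (∑ i, partialDeriv i f y ^ 2) + 2 * (B * f y ^ 2) := by
        rw [Finset.sum_add_distrib, ← Finset.mul_sum, ← Finset.mul_sum, hB, Finset.sum_mul]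
    _ ≤ 2 * ((metricCoeff g e y).trace * gradInner g e f f y) + 2 * (B * f y ^ 2) := by
        gcongr
    _ ≤ (2 * (metricCoeff g e y).trace + 2 * B) * (gradInner g e f f y + f y ^ 2) := by
        have := mul_nonneg htr0 (sq_nonneg (f y))
        have := mul_nonneg hB0 hg0
        nlinarith

include he in
lemma integral_indicator_target_le {F : M → ℝ} (hF : Integrable F (volumeMeasure g))
    (hF0 : ∀ x, 0 ≤ F x) {C : ℝ} (hC : 0 ≤ C) {w : EuclideanSpace ℝ (Fin n) → ℝ}
    (hw : Integrable w)
    (h : ∀ y, w y ≤ e.target.indicator (fun y => C * (volDensity g e y * F (e.symm y))) y) :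
    ∫ y, w y ≤ C * ∫ x, F x ∂(volumeMeasure g) := by
  have hi := (integrableOn_target he g hF).const_mul C
  calc ∫ y, w y ≤ ∫ y, e.target.indicator (fun y => C * (volDensity g e y * F (e.symm y))) y :=
        integral_mono hw ((integrable_indicator_iff e.open_target.measurableSet).2 hi) h
    _ = C * ∫ x in e.source, F x ∂(volumeMeasure g) := by
        rw [integral_indicator e.open_target.measurableSet, integral_const_mul,
          setIntegral_source he g hF.1]
    _ ≤ C * ∫ x, F x ∂(volumeMeasure g) :=
        mul_le_mul_of_nonneg_left (setIntegral_le_integral hF (ae_of_all _ hF0)) hC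

include he in
lemma integral_le_of_indicator_target_le {F : M → ℝ} (hF : Integrable F (volumeMeasure g))
    (hF0 : ∀ x ∉ e.source, F x = 0) {w : EuclideanSpace ℝ (Fin n) → ℝ} (hw : Integrable w)
    (h : ∀ y, e.target.indicator (fun y => volDensity g e y * F (e.symm y)) y ≤ w y) :
    ∫ x, F x ∂(volumeMeasure g) ≤ ∫ y, w y := by
  rw [← setIntegral_eq_integral_of_forall_compl_eq_zero hF0, setIntegral_source he g hF.1,
    ← integral_indicator e.open_target.measurableSet]
  exact integral_mono ((integrable_indicator_iff e.open_target.measurableSet).2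
    (integrableOn_target he g hF)) hw h

include he in
/-- The Sobolev inequality for functions supported in a chart. -/
lemma exists_sobolev_chart (hn : 3 ≤ n) {φ : M → ℝ} (hφ : ContMDiff (𝓡 n) 𝓘(ℝ, ℝ) ∞ φ)
    (hs : tsupport φ ⊆ e.source) (h0 : ∀ x, 0 ≤ φ x) (h1 : ∀ x, φ x ≤ 1) :
    ∃ C : ℝ, 0 ≤ C ∧ ∀ u : M → ℝ, ContMDiff (𝓡 n) 𝓘(ℝ, ℝ) ∞ u →
      ∫ x, |φ x * u x| ^ ((2 * n : ℝ) / (n - 2)) ∂(volumeMeasure g) ≤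
        C * (∫ x, (gradPair g u u x + u x ^ 2) ∂(volumeMeasure g)) ^ ((n : ℝ) / (n - 2)) := by
  obtain ⟨S, hS0, hS⟩ := exists_sobolev_euclidean n hn
  have hn' : (3 : ℝ) ≤ n := by exact_mod_cast hn
  have hq : 0 < (2 * n : ℝ) / (n - 2) := div_pos (by linarith) (by linarith)
  have hq' : 0 < (n : ℝ) / (n - 2) := div_pos (by linarith) (by linarith)
  set ψ := fun z => φ (e.symm z) with hψ
  have hψs : ∀ y ∈ e.target, ContDiffAt ℝ ∞ ψ y := fun y hy => contDiffAt_comp_symm he hφ hy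
  set K := e '' tsupport φ with hKdef
  have hK : IsCompact K :=
    (isClosed_tsupport φ).isCompact.image_of_continuousOn (e.continuousOn.mono hs)
  have hKU : K ⊆ e.target := by
    rintro _ ⟨x, hx, rfl⟩
    exact e.map_source (hs hx)
  have hψ0 : ∀ y ∈ e.target, y ∉ K → ψ y = 0 := by
    intro y hy hyK
    exact image_eq_zero_of_notMem_tsupport (f := φ) fun h => hyK ⟨e.symm y, h, e.right_inv hy⟩
  have hρc : ContinuousOn (volDensity g e) K := (continuousOn_volDensity he g).mono hKU
  -- `R` bounds the volume density on the compact support of the cut-off, for passing from the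
  -- integral on M to Lebesgue measure.
  obtain ⟨R, hR⟩ := hK.exists_bound_of_continuousOn hρc
  have hcc : ContinuousOn (fun y => (2 * (metricCoeff g e y).trace +
      2 * ∑ i, partialDeriv i ψ y ^ 2) * (volDensity g e y)⁻¹) K := by
    intro y hy
    have hyt := hKU hy
    have c1 : ContDiffAt ℝ ∞ (fun y => (metricCoeff g e y).trace) y :=
      ContDiffAt.sum fun i _ => contDiffAt_metricCoeff he hyt i i
    have c2 : ContDiffAt ℝ ∞ (fun y => ∑ i, partialDeriv i ψ y ^ 2) y :=
      ContDiffAt.sum fun i _ => (contDiffAt_partialDeriv (hψs y hyt)).pow 2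
    exact (((continuousAt_const.mul c1.continuousAt).add
      (continuousAt_const.mul c2.continuousAt)).mul
      ((contDiffAt_volDensity he g hyt).continuousAt.inv₀
        (volDensity_pos he g hyt).ne')).continuousWithinAt
  -- `C` bounds the coefficient from `sum_sq_partialDeriv_mul_le` divided by the density, for
  -- passing back from Lebesgue measure to M.
  obtain ⟨C, hC⟩ := hK.exists_bound_of_continuousOn hcc
  refine ⟨|R| * (S * |C| ^ ((n : ℝ) / (n - 2))), by positivity, fun u hu => ?_⟩
  set f := fun z => u (e.symm z) with hf
  have hfs : ∀ y ∈ e.target, ContDiffAt ℝ ∞ f y := fun y hy => contDiffAt_comp_symm he hu hy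
  let W := e.target.indicator fun y => ψ y * f y
  have hW0 : ∀ y ∈ e.target, y ∉ K → ψ y * f y = 0 := fun y hy hyK => by
    rw [hψ0 y hy hyK, zero_mul]
  have hWs : ContDiff ℝ ∞ W := contDiff_indicator e.open_target hK.isClosed
    (fun y hy => (hψs y hy).mul (hfs y hy)) hKU hW0
  have hWc : HasCompactSupport W := hasCompactSupport_indicator hK hW0
  set X := ∫ x, (gradPair g u u x + u x ^ 2) ∂(volumeMeasure g) with hX
  have hcont : Continuous fun x => gradPair g u u x + u x ^ 2 :=
    (continuous_gradPair g hu hu).add (hu.continuous.pow 2)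
  have hpair0 : ∀ x, 0 ≤ gradPair g u u x := gradPair_self_nonneg g u
  have hX0 : 0 ≤ X := integral_nonneg fun x => add_nonneg (hpair0 x) (sq_nonneg _)
  have hint : Integrable (fun x => gradPair g u u x + u x ^ 2) (volumeMeasure g) :=
    hcont.integrable_of_hasCompactSupport (HasCompactSupport.of_compactSpace _)
  have hD : ∫ y, ‖fderiv ℝ W y‖ ^ 2 ≤ |C| * X := by
    refine integral_indicator_target_le he g hint (fun x => add_nonneg (hpair0 x) (sq_nonneg _))
      (abs_nonneg C) (integrable_norm_fderiv_sq hWs hWc) fun y => ?_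
    refine (norm_fderiv_sq_le W y).trans ?_
    simp only [W, partialDeriv_indicator e.open_target hK.isClosed hKU hW0]
    by_cases hy : y ∈ e.target
    · simp only [indicator_of_mem hy]
      rw [gradPair_symm he g hu hu hy]
      have hρ := volDensity_pos he g hy
      have hg0 : 0 ≤ gradInner g e f f y + f y ^ 2 :=
        add_nonneg (gradInner_self_nonneg he g hy f) (sq_nonneg _)
      by_cases hyK : y ∈ K
      · have hCy := (le_abs_self _).trans ((hC y hyK).trans (le_abs_self C))
        rw [← div_eq_mul_inv, div_le_iff₀ hρ] at hCy
        have hψ1 : ψ y ^ 2 ≤ 1 := pow_le_one₀ (h0 _) (h1 _)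
        refine (sum_sq_partialDeriv_mul_le he g hy (hψs y hy).differentiableAt_infty
          (hfs y hy).differentiableAt_infty hψ1).trans ?_
        rw [← mul_assoc]
        exact mul_le_mul_of_nonneg_right hCy hg0
      · have : (fun y => ψ y * f y) =ᶠ[𝓝 y] fun _ => 0 := by
          filter_upwards [hK.isClosed.isOpen_compl.mem_nhds hyK, e.open_target.mem_nhds hy]
            with z hz hz'
          exact hW0 z hz' hz
        simp only [partialDeriv_congr this, partialDeriv_const]
        simp only [ne_eq, OfNat.ofNat_ne_zero, not_false_eq_true, zero_pow,
          Finset.sum_const_zero]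
        exact mul_nonneg (abs_nonneg _) (mul_nonneg hρ.le hg0)
    · simp [indicator_of_notMem hy]
  have hφu : Continuous fun x => |φ x * u x| ^ ((2 * n : ℝ) / (n - 2)) :=
    (hφ.continuous.mul hu.continuous).abs.rpow_const fun _ => Or.inr hq.le
  have hI : ∫ x, |φ x * u x| ^ ((2 * n : ℝ) / (n - 2)) ∂(volumeMeasure g) ≤
      |R| * ∫ y, |W y| ^ ((2 * n : ℝ) / (n - 2)) := by
    have hWi : Integrable fun y => |W y| ^ ((2 * n : ℝ) / (n - 2)) :=
      integrable_abs_rpow hWs hWc hq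
    rw [← integral_const_mul]
    refine integral_le_of_indicator_target_le he g (hφu.integrable_of_hasCompactSupport
      (HasCompactSupport.of_compactSpace _)) (fun x hx => ?_) (hWi.const_mul _) fun y => ?_
    · have hx' : x ∉ tsupport φ := fun h => hx (hs h)
      rw [image_eq_zero_of_notMem_tsupport hx', zero_mul, abs_zero, Real.zero_rpow hq.ne']
    by_cases hy : y ∈ e.target
    · simp only [W, indicator_of_mem hy]
      by_cases hyK : y ∈ K
      · have := (le_abs_self _).trans ((hR y hyK).trans (le_abs_self R))
        gcongr
      · have h2 : φ (e.symm y) = 0 := hψ0 y hy hyK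
        rw [h2, zero_mul, abs_zero, Real.zero_rpow hq.ne', mul_zero]
        positivity
    · rw [indicator_of_notMem hy]
      positivity
  calc _ ≤ |R| * ∫ y, |W y| ^ ((2 * n : ℝ) / (n - 2)) := hI
    _ ≤ |R| * (S * (∫ y, ‖fderiv ℝ W y‖ ^ 2) ^ ((n : ℝ) / (n - 2))) := by
        gcongr
        exact hS W hWs hWc
    _ ≤ |R| * (S * (|C| * X) ^ ((n : ℝ) / (n - 2))) := by
        gcongr
    _ = _ := by
        rw [Real.mul_rpow (abs_nonneg _) hX0]
        ring

variable [T2Space M]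

/-- The existence of Sobolev constants. -/
theorem exists_sobolevInequality (hn : 3 ≤ n) : ∃ c₁ c₂ : ℝ, SobolevInequality g c₁ c₂ := by
  obtain ⟨t, φ, hφ, hs, h0, h1, hone⟩ := exists_finite_partition (n := n) M
  have hn' : (3 : ℝ) ≤ n := by exact_mod_cast hn
  have hq : 1 ≤ (2 * n : ℝ) / (n - 2) := by
    rw [le_div_iff₀ (by linarith)]; linarith
  have hθ : 0 ≤ ((n : ℝ) - 2) / n := div_nonneg (by linarith) (by linarith)
  have hchart := fun x => exists_sobolev_chart (IsManifold.chart_mem_maximalAtlas x) g hn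
    (hφ x) (hs x) (h0 x) (h1 x)
  choose C hC0 hC using hchart
  -- The power of the number of charts comes from convexity: |Σ aₓ|^q ≤ (card t)^{q−1} Σ |aₓ|^q.
  set N := (t.card : ℝ) ^ ((2 * n : ℝ) / (n - 2) - 1) * ∑ x ∈ t, C x with hN
  have hN0 : 0 ≤ N := mul_nonneg (by positivity) (Finset.sum_nonneg fun x _ => hC0 x)
  refine ⟨N ^ (((n : ℝ) - 2) / n), N ^ (((n : ℝ) - 2) / n), fun u hu => ?_⟩
  have i1 : Integrable (gradPair g u u) (volumeMeasure g) :=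
    integrable_of_continuous g (continuous_gradPair g hu hu)
  have i2 : Integrable (fun x => u x ^ 2) (volumeMeasure g) :=
    integrable_of_continuous g (hu.continuous.pow 2)
  have hgn : gradNormSq g u = gradPair g u u := funext (gradNormSq_eq g u)
  rw [hgn, ← mul_add, ← integral_add i1 i2]
  set X := ∫ x, (gradPair g u u x + u x ^ 2) ∂(volumeMeasure g) with hX
  have hX0 : 0 ≤ X :=
    integral_nonneg fun x => add_nonneg (gradPair_self_nonneg g u x) (sq_nonneg _)
  have hci : ∀ x, Integrable (fun z => |φ x z * u z| ^ ((2 * n : ℝ) / (n - 2)))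
      (volumeMeasure g) := fun x => integrable_of_continuous g
    (((hφ x).continuous.mul hu.continuous).abs.rpow_const fun _ => Or.inr (by linarith))
  have hle : ∫ z, |u z| ^ ((2 * n : ℝ) / (n - 2)) ∂(volumeMeasure g) ≤
      N * X ^ ((n : ℝ) / (n - 2)) := by
    calc ∫ z, |u z| ^ ((2 * n : ℝ) / (n - 2)) ∂(volumeMeasure g)
        ≤ ∫ z, (t.card : ℝ) ^ ((2 * n : ℝ) / (n - 2) - 1) *
          ∑ x ∈ t, |φ x z * u z| ^ ((2 * n : ℝ) / (n - 2)) ∂(volumeMeasure g) := by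
          refine integral_mono (integrable_of_continuous g (hu.continuous.abs.rpow_const
            fun _ => Or.inr (by linarith))) ((integrable_finsetSum t fun x _ =>
              hci x).const_mul _) fun z => ?_
          refine le_trans ?_ (Real.rpow_sum_le_const_mul_sum_rpow t (fun x => φ x z * u z) hq)
          refine Real.rpow_le_rpow (abs_nonneg _) ?_ (by linarith)
          calc |u z| = |∑ x ∈ t, φ x z * u z| := by rw [← Finset.sum_mul, hone, one_mul]
            _ ≤ _ := Finset.abs_sum_le_sum_abs _ _
      _ = (t.card : ℝ) ^ ((2 * n : ℝ) / (n - 2) - 1) *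
          ∑ x ∈ t, ∫ z, |φ x z * u z| ^ ((2 * n : ℝ) / (n - 2)) ∂(volumeMeasure g) := by
          rw [integral_const_mul, integral_finsetSum _ fun x _ => hci x]
      _ ≤ (t.card : ℝ) ^ ((2 * n : ℝ) / (n - 2) - 1) *
          ∑ x ∈ t, C x * X ^ ((n : ℝ) / (n - 2)) := by
          gcongr with x _
          exact hC x u hu
      _ = N * X ^ ((n : ℝ) / (n - 2)) := by rw [← Finset.sum_mul, hN]; ring
  -- The exponents n/(n−2) and (n−2)/n are reciprocal, so the final root makes the bound linear in
  -- X.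
  calc _ ≤ (N * X ^ ((n : ℝ) / (n - 2))) ^ (((n : ℝ) - 2) / n) :=
        Real.rpow_le_rpow (integral_nonneg fun z => by positivity) hle hθ
    _ = N ^ (((n : ℝ) - 2) / n) * X := by
        rw [Real.mul_rpow hN0 (by positivity), ← Real.rpow_mul hX0]
        congr 1
        have : (n : ℝ) / (n - 2) * ((n - 2) / n) = 1 := by
          have : (n : ℝ) - 2 ≠ 0 := by linarith
          field_simp
        rw [this, Real.rpow_one]

end Sobolev
end YangMills

end

theorem theorem1p2 (n : ℕ) (hn : 3 ≤ n) :
    (∀ (M : Type*) [TopologicalSpace M] [T2Space M] [CompactSpace M]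
        [ChartedSpace (EuclideanSpace ℝ (Fin n)) M] [IsManifold (𝓡 n) ∞ M]
        [MeasurableSpace M] [BorelSpace M] (g : YangMills.RMetric n M),
        ∃ c₁ c₂ : ℝ, YangMills.SobolevInequality g c₁ c₂) ∧
    ∀ (d : ℕ) (c₀ c₁ c₂ : ℝ), 0 < c₀ → ∃ κ₀ : ℝ, 0 < κ₀ ∧
      ∀ (M : Type*) [TopologicalSpace M] [T2Space M] [CompactSpace M]
        [ChartedSpace (EuclideanSpace ℝ (Fin n)) M] [IsManifold (𝓡 n) ∞ M]
        [MeasurableSpace M] [BorelSpace M] (g : YangMills.RMetric n M),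
        YangMills.CurvatureCondition g c₀ → YangMills.SobolevInequality g c₁ c₂ →
        ∀ (G : Type*) [TopologicalSpace G] [T2Space G] [CompactSpace G] [Group G]
          [ChartedSpace (EuclideanSpace ℝ (Fin d)) G] [LieGroup (𝓡 d) ∞ G]
          [LieAlgebra.IsSemisimple ℝ (GroupLieAlgebra (𝓡 d) G)]
          (ι : Type*) (P : YangMills.PrincipalBundle n d ι M G) (A : YangMills.Connection P),
          A.IsYangMills g → A.IsFlat ∨ κ₀ ≤ A.energy g := by
  -- The constant is the threshold of `energy_gap`; it does not involve `d`, because the bracket has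
  -- norm at most 1 in the Killing norm whatever the group.
  refine ⟨fun M _ _ _ _ _ _ _ g => YangMills.exists_sobolevInequality g hn,
    fun d c₀ c₁ c₂ hc₀ => ⟨min 1 c₀ / (2 * n ^ 3 * (1 + |c₁| + |c₂|)), ?_, ?_⟩⟩
  · have : (0 : ℝ) < n := by exact_mod_cast (by omega : 0 < n)
    exact div_pos (lt_min one_pos hc₀) (by positivity)
  · intro M _ _ _ _ _ _ _ g hg hS G _ _ _ _ _ _ _ ι P A hA
    refine or_iff_not_imp_right.2 fun hE => ?_
    exact YangMills.energy_gap A g hn hc₀ hg hS hA (not_le.1 hE)
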